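/- Setting. Let $(\Omega,\mathcal F,Q)$ be a probability space, $t\ge 1$, and let $\mathcal C_1,\dots,\mathcal C_t$ be convex sets of probability measures on $(\Omega,\mathcal F)$, each closed in total variation; put $\mathcal C=\bigcap_{i=1}^t\mathcal C_i$. For a probability measure $P$ and a finite measure $S$ let $I(P|S)=\int\ln(dP/dS)\,dP$ if $P\ll S$ and $I(P|S)=+\infty$ otherwise. A measure $P\in\mathcal D$ is the I-projection of $S$ onto a set $\mathcal D$ of probability measures if $I(P|S)=\inf_{R\in\mathcal D}I(R|S)<\infty$. Assume that some $V\in\mathcal C$ has $I(V|Q)<\infty$. For $x\in L_1(Q)$ let $f(x)=\int x\ln x\,dQ$ if $x\ge 0$ and $\int x\,dQ=1$, and $f(x)=+\infty$ otherwise. Let $\mathcal K_i=\{\alpha\,dP/dQ:\ P\in\mathcal C_i,\ P\ll Q,\ \alpha\ge 0\}\subset L_1(Q)$. For $\mathcal S\subset L_1(Q)$ let $\mathcal S^\oplus$ be the set of extended real valued measurable functions $y$ on $\Omega$ such that for every $x\in\mathcal S$ with $f(x)<\infty$ the integral $\int xy\,dQ$ is well defined and $\ge 0$. The primal problem is $\inf\{f(x):x\in\bigcap_i\mathcal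 K_i\}$ and the dual problem is $\inf\{\int e^y\,dQ:\ y\in(\bigcap_i\mathcal K_i)^\oplus\}$. Primal algorithm. $S_{0,i}=P_{0,i}=Q$ for all $i$. For $n\ge1$ and $i=1,\dots,t$ in turn, $S_{n,i}$ is the measure with $$\frac{dS_{n,i}}{dQ}=\frac{dP_{n,i-1}}{dQ}\Bigl(\frac{dP_{n-1,i}}{dS_{n-1,i}}\Bigr)^{-1},\qquad P_{n,0}:=P_{n-1,t},$$ (with $0^{-1}=\infty$, $0\cdot\infty=0$), and $P_{n,i}$ is the I-projection of $S_{n,i}$ onto $\mathcal C_i$. Dual algorithm. $y_{0,i}=0$ for all $i$. For $n\ge1$ and $i=1,\dots,t$ in turn, $y_{n,i}$ is a minimizer over $y\in\mathcal K_i^\oplus$ of $$\int e^{\,y_{n,1}+\dots+y_{n,i-1}+y+y_{n-1,i+1}+\dots+y_{n-1,t}}\,dQ .$$ Theorem 3.1. Let $(P_{n,i})$, $(S_{n,i})$ be sequences produced by the primal algorithm and $(y_{n,i})$ a sequence produced by the dual algorithm. Assume (A) $\sup_{n,i}\int dS_{n,i}<\infty$; (B) the integrals $\int\ln(dS_{n,i}/dQ)\,dP_{n,i}$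 exist and are finite, and $\sup_{n,i}\int\ln(dS_{n,i}/dQ)\,dP_{n,i}<\infty$; (C) the family $(y_{n,i})_{n,i}$ is uniformly integrable with respect to $Q$. Then: 1. The primal problem has a unique solution $x_0\in L_1(Q)$ and the dual problem has a unique ($Q$-a.e.) solution $y_0$. Moreover $x_0\ge 0$, $\int x_0\,dQ=1$, $x_0=e^{y_0}/\int e^{y_0}\,dQ$ ($Q$-a.e.), and, for every $i$, $dP_{n,i}/dQ\to x_0$ weakly in $L_1(Q)$ as $n\to\infty$. 2. $x_0=dP^*/dQ$ for some $P^*\in\mathcal C$ with $P^*\ll Q$, and $P^*$ is the I-projection of $Q$ onto $\mathcal C$. For every $i$, as $n\to\infty$, $I(P^*|P_{n,i})\to0$ and $\|P_{n,i}-P^*\|=\int\bigl|\tfrac{dP_{n,i}}{dQ}-\tfrac{dP^*}{dQ}\bigr|\,dQ\to0$, where $\|\cdot\|$ is the total variation norm. 3. $\sum_{i=1}^t I(P_{n,i}|S_{n,i})\to I(P^*|Q)$ as $n\to\infty$. -/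

import Mathlib

open MeasureTheory Filter Topology
open scoped ENNReal NNReal

noncomputable section

namespace IProj

variable {Ω : Type*} [MeasurableSpace Ω]

/-- The I-divergence `I(P|S) = ∫ ln (dP/dS) dP` of a probability measure `P` from a finite measure
`S` (not necessarily of mass one), with value `+∞` if `P` is not absolutely continuous with respect
to `S`.  For finite `S` the negative part of `ln (dP/dS)` is always `P`-integrable, so failure of
integrability means that the integral is `+∞`. -/
def iDiv (P S : Measure Ω) : EReal :=
  open Classical in
  if P ≪ S ∧ Integrable (llr P S) P then ((∫ ω, llr P S ω ∂P : ℝ) : EReal) else ⊤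

/-- `P` is the I-projection of `S` onto the set `C` of probability measures. -/
def IsIProjection (S : Measure Ω) (C : Set (ProbabilityMeasure Ω)) (P : ProbabilityMeasure Ω) :
    Prop :=
  P ∈ C ∧ iDiv (P : Measure Ω) S < ⊤ ∧ ∀ R ∈ C, iDiv (P : Measure Ω) S ≤ iDiv (R : Measure Ω) S

/-- Total variation distance: the total mass of the variation `|P - R|` of the signed measure
`P - R` (which equals `∫ |dP/dQ - dR/dQ| dQ` if `P` and `R` have densities with respect to `Q`). -/
def tvDist (P R : ProbabilityMeasure Ω) : ℝ :=
  ((P : Measure Ω).toSignedMeasure - (R : Measure Ω).toSignedMeasure).totalVariation.real Set.univ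

/-- A set of probability measures that is closed in total variation. -/
def VariationClosed (C : Set (ProbabilityMeasure Ω)) : Prop :=
  ∀ (R : ℕ → ProbabilityMeasure Ω) (P : ProbabilityMeasure Ω),
    (∀ n, R n ∈ C) → Tendsto (fun n => tvDist (R n) P) atTop (𝓝 0) → P ∈ C

/-- A convex set of probability measures. -/
def ConvexPM (C : Set (ProbabilityMeasure Ω)) : Prop :=
  ∀ P ∈ C, ∀ R ∈ C, ∀ (a b : ℝ≥0) (W : ProbabilityMeasure Ω), a + b = 1 →
    (W : Measure Ω) = a • (P : Measure Ω) + b • (R : Measure Ω) → W ∈ C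

/-- The Radon-Nikodym density `dP/dQ` as an element of `L₁(Q)`. -/
def dens (Q : Measure Ω) [IsProbabilityMeasure Q] (P : ProbabilityMeasure Ω) : Ω →₁[Q] ℝ :=
  (Measure.integrable_toReal_rnDeriv (μ := (P : Measure Ω)) (ν := Q)).toL1 _

/-- The functional `f(x) = ∫ x ln x dQ` if `x ≥ 0` and `∫ x dQ = 1`, and `f(x) = +∞` otherwise.
Since `x ln x` is bounded below, non-integrability means that the integral is `+∞`. -/
def entropy (Q : Measure Ω) (x : Ω →₁[Q] ℝ) : EReal :=
  open Classical in
  if (∀ᵐ ω ∂Q, 0 ≤ x ω) ∧ ∫ ω, x ω ∂Q = 1 ∧ Integrable (fun ω => x ω * Real.log (x ω)) Q then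
    ((∫ ω, x ω * Real.log (x ω) ∂Q : ℝ) : EReal)
  else ⊤

/-- The cone `{α x : α ≥ 0, x = dP/dQ for some P ∈ C}` in `L₁(Q)`. -/
def densCone (Q : Measure Ω) [IsProbabilityMeasure Q] (C : Set (ProbabilityMeasure Ω)) :
    Set (Ω →₁[Q] ℝ) :=
  {x | ∃ P ∈ C, (P : Measure Ω) ≪ Q ∧ ∃ α : ℝ, 0 ≤ α ∧ x = α • dens Q P}

/-- The integral of an extended real valued function is well defined (possibly `+∞`) and
nonnegative. -/
def IntegralNonneg (Q : Measure Ω) (z : Ω → EReal) : Prop :=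
  ∫⁻ ω, (-z ω).toENNReal ∂Q ≠ ⊤ ∧
    ∫⁻ ω, (-z ω).toENNReal ∂Q ≤ ∫⁻ ω, (z ω).toENNReal ∂Q

/-- The conjugate cone of `S ⊆ L₁(Q)`: all extended real valued measurable `y` with
`∫ x y dQ ≥ 0` for every `x ∈ S` in the domain of the functional `entropy`. -/
def conjCone (Q : Measure Ω) (S : Set (Ω →₁[Q] ℝ)) : Set (Ω → EReal) :=
  {y | Measurable y ∧
    ∀ x ∈ S, entropy Q x < ⊤ → IntegralNonneg Q (fun ω => ((x ω : ℝ) : EReal) * y ω)}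

/-- `x` solves the primal problem `inf {f(x) : x ∈ S}`. -/
def IsPrimalSolution (Q : Measure Ω) (S : Set (Ω →₁[Q] ℝ)) (x : Ω →₁[Q] ℝ) : Prop :=
  x ∈ S ∧ ∀ x' ∈ S, entropy Q x ≤ entropy Q x'

/-- `y` solves the dual problem `inf {∫ e^y dQ : y ∈ S^⊕}`. -/
def IsDualSolution (Q : Measure Ω) (S : Set (Ω →₁[Q] ℝ)) (y : Ω → EReal) : Prop :=
  y ∈ conjCone Q S ∧
    ∀ w ∈ conjCone Q S, ∫⁻ ω, (y ω).exp ∂Q ≤ ∫⁻ ω, (w ω).exp ∂Q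

/-- The iterate computed just before step `i` of cycle `n + 1`: the last iterate of cycle `n` for
the first index `i`, and otherwise the iterate of cycle `n + 1` with index `i - 1`. -/
def prevIterate {α : Type*} {t : ℕ} (P : ℕ → Fin t → α) (n : ℕ) (i : Fin t) : α :=
  if i.1 = 0 then P n ⟨t - 1, by have := i.2; omega⟩
  else P (n + 1) ⟨i.1 - 1, by have := i.2; omega⟩

/-- `P`, `S` are the sequences produced by the primal algorithm started from `Q`.  Products and
inverses of densities are taken in `[0, ∞]`, with `0⁻¹ = ∞` and `0 * ∞ = 0`. -/
structure IsPrimalRun (Q : Measure Ω) {t : ℕ} (C : Fin t → Set (ProbabilityMeasure Ω))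
    (P : ℕ → Fin t → ProbabilityMeasure Ω) (S : ℕ → Fin t → Measure Ω) : Prop where
  initP : ∀ i, (P 0 i : Measure Ω) = Q
  initS : ∀ i, S 0 i = Q
  adjust : ∀ n i, S (n + 1) i = Q.withDensity (fun ω =>
    ((prevIterate P n i : ProbabilityMeasure Ω) : Measure Ω).rnDeriv Q ω * ((P n i : Measure Ω).rnDeriv (S n i) ω)⁻¹)
  project : ∀ n i, IsIProjection (S (n + 1) i) (C i) (P (n + 1) i)

/-- The objective `∫ exp (y_{n+1,1} + ⋯ + y_{n+1,i-1} + w + y_{n,i+1} + ⋯ + y_{n,t}) dQ` of step `i`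
of cycle `n + 1` of the dual algorithm. -/
def dualObjective (Q : Measure Ω) {t : ℕ} (y : ℕ → Fin t → Ω → EReal) (n : ℕ) (i : Fin t)
    (w : Ω → EReal) : ℝ≥0∞ :=
  ∫⁻ ω, (∑ j : Fin t,
    if j < i then y (n + 1) j ω else if j = i then w ω else y n j ω).exp ∂Q

/-- `y` is a sequence produced by the dual (cyclic descent) algorithm. -/
structure IsDualRun (Q : Measure Ω) [IsProbabilityMeasure Q] {t : ℕ}
    (C : Fin t → Set (ProbabilityMeasure Ω)) (y : ℕ → Fin t → Ω → EReal) : Prop where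
  init : ∀ i ω, y 0 i ω = 0
  mem : ∀ n i, y (n + 1) i ∈ conjCone Q (densCone Q (C i))
  min : ∀ n i, ∀ w ∈ conjCone Q (densCone Q (C i)),
    dualObjective Q y n i (y (n + 1) i) ≤ dualObjective Q y n i w

/-- Uniform integrability of a family of extended real valued functions:
`sup_k ∫_{|y_k| ≥ K} |y_k| dQ → 0` as `K → ∞`. -/
def EUnifIntegrable {ι : Type*} (Q : Measure Ω) (y : ι → Ω → EReal) : Prop :=
  ∀ ε : ℝ≥0∞, 0 < ε → ∃ K : ℝ≥0, ∀ k,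
    ∫⁻ ω in {ω | (K : ℝ≥0∞) ≤ (y k ω).abs}, (y k ω).abs ∂Q ≤ ε

end IProj

end

/-! The two algorithms are one algorithm in two coordinate systems. Let v minimize ∫ e^v dS over the
cone conjugate to C, and let P be the I-projection of S onto C. Stationarity of v in bounded
directions puts the normalization of e^v S into C, by Hahn-Banach, and stationarity along the ray
through v bounds its divergence from S by -ln ∫ e^v dS. Weak duality gives the opposite bound for P,
so that dP/dS = e^(v + c) with c = I(P|S), and ∫ v dP = 0 (`eq_exp_mul_of_isIProjection`). By
induction every iterate has the density exp Σ_j (v_j + d_j) with respect to Q, where v_j is the most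
recent dual iterate for C_j and d_j the divergence of the matching projection step
(`IsRunPair.stepLink_and_last`).

The basic estimates come from integrating the logarithm of this formula. For an iterate and its
predecessor it shows that the updated d_i grows by at least the divergence between the two
(`IsRunPair.kl_prev`). For R in the intersection it gives I(R|P_{n,i}) ≤ I(R|Q) - Σ_j d_j
(`IsRunPair.kl_iterate`). With R = V the d_j are bounded, hence converge to limits c_j, and by a
Pinsker argument the iterates of one cycle merge in L₁. Put L = Σ_j c_j. No R in the intersection
has I(R|Q) < L, and a member W with I(W|Q) = L satisfies I(W|P_{n,i}) → 0, which yields the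
convergence statements.

The difficulty is the existence of W (`IsRunPair.exists_limit_density`). The entropy of the last
iterate P_{n,t} is Σ_j (∫ v_j dP_{n,t} + d_j), but only ∫ v_j dP_{n,j} = 0 is known. By (C) the v_j
are bounded by a constant outside a set of small Q-measure; where they are bounded, P_{n,t} may be
exchanged for P_{n,j}. The rest of ∫ v_j dP_{n,j} is controlled from one side: (A) bounds ∫ e^(-v_j)
dP_{n,j}, and (B) makes the densities uniformly integrable. So truncated iterates have entropy at
most L + ε (`IsRunPair.exists_truncation`), and uniform convexity of the entropy extracts an L₁
limit from midpoint convex sets containing them (`exists_limit_of_entropy_le`).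

Finally, (C) keeps the logarithms of the iterates bounded in L₁, so the limit density x is positive,
and Fatou's lemma in `IsRunPair.kl_iterate` yields the Csiszár inequality L ≤ ∫ r ln x dQ
(`IsRunPair.isCsiszarDens`). It says that ln x - L lies in the dual cone. Optimality and uniqueness,
primal and dual, then follow from the nonnegativity of `kl` and its equality case. -/

noncomputable section

namespace IProj

variable {Ω : Type*} [MeasurableSpace Ω]

/-! ### The pointwise divergence `a ln (a / b) - a + b` -/

/-- The pointwise divergence `a ln (a / b) - a + b`. -/
def kl (a b : ℝ) : ℝ := a * (Real.log a - Real.log b) - a + b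

/-- The left side is (√a - √b)², and the bound is ln z ≤ z - 1 at z = √b/√a. This Hellinger bound is
the source of nonnegativity, of the equality case and of the Pinsker estimate. -/
lemma sq_sqrt_sub_le_kl {a b : ℝ} (ha : 0 ≤ a) (hb : 0 < b) :
    a + b - 2 * (√a * √b) ≤ kl a b := by
  rcases ha.eq_or_lt with rfl | ha'
  · simp [kl]
  have hsa : 0 < √a := Real.sqrt_pos.2 ha'
  have hsb : 0 < √b := Real.sqrt_pos.2 hb
  have h1 := Real.log_le_sub_one_of_pos (div_pos hsb hsa)
  rw [Real.log_div hsb.ne' hsa.ne', Real.log_sqrt hb.le, Real.log_sqrt ha] at h1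
  have h2 : a * (√b / √a) = √a * √b := by
    rw [mul_div_assoc', div_eq_iff hsa.ne']
    nlinarith [Real.mul_self_sqrt ha]
  have h3 := mul_le_mul_of_nonneg_left h1 ha
  unfold kl
  linarith

lemma kl_nonneg {a b : ℝ} (ha : 0 ≤ a) (hb : 0 < b) : 0 ≤ kl a b := by
  have h := sq_sqrt_sub_le_kl ha hb
  nlinarith [sq_nonneg (√a - √b), Real.mul_self_sqrt ha, Real.mul_self_sqrt hb.le]

lemma eq_of_kl_nonpos {a b : ℝ} (ha : 0 ≤ a) (hb : 0 < b) (h : kl a b ≤ 0) : a = b := by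
  have h1 := sq_sqrt_sub_le_kl ha hb
  have h2 : (√a - √b) ^ 2 ≤ 0 := by
    nlinarith [Real.mul_self_sqrt ha, Real.mul_self_sqrt hb.le]
  have h3 : √a = √b := by nlinarith [sq_nonneg (√a - √b), pow_eq_zero_iff (M₀ := ℝ) two_ne_zero |>.1 (le_antisymm h2 (sq_nonneg _))]
  exact (Real.sqrt_inj ha hb.le).1 h3

/-- Write |a - b| = |√a - √b| (√a + √b) and split the product with weight ε. Integrated against Q
with a free ε, this gives a Pinsker inequality without sharp constants. -/
lemma abs_sub_le_kl {a b ε : ℝ} (ha : 0 ≤ a) (hb : 0 < b) (hε : 0 < ε) :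
    |a - b| ≤ kl a b / ε + ε * (a + b) / 2 := by
  have h1 := sq_sqrt_sub_le_kl ha hb
  have ea := Real.mul_self_sqrt ha
  have eb := Real.mul_self_sqrt hb.le
  have na := Real.sqrt_nonneg a
  have nb := Real.sqrt_nonneg b
  set x := √a
  set y := √b
  have h2 : (x - y) ^ 2 / ε ≤ kl a b / ε := by
    gcongr
    nlinarith
  have h3 : |a - b| = |x - y| * (x + y) := by
    rw [← ea, ← eb, show x * x - y * y = (x - y) * (x + y) by ring, abs_mul,
      abs_of_nonneg (add_nonneg na nb)]
  have h4 : |x - y| * (x + y) ≤ (x - y) ^ 2 / ε + ε * (x + y) ^ 2 / 4 := by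
    have h5 : (x - y) ^ 2 / ε + ε * (x + y) ^ 2 / 4 - |x - y| * (x + y)
        = (|x - y| - ε * (x + y) / 2) ^ 2 / ε := by
      rw [← sq_abs (x - y)]
      field_simp
      ring
    have : 0 ≤ (|x - y| - ε * (x + y) / 2) ^ 2 / ε := by positivity
    linarith
  have h6 : (x + y) ^ 2 ≤ 2 * (a + b) := by nlinarith [sq_nonneg (x - y)]
  have h7 := mul_le_mul_of_nonneg_left h6 hε.le
  linarith

/-- This makes x ln x + 1 nonnegative, which is the form used for monotonicity in the domain and for
Fatou's lemma. -/
lemma neg_one_le_mul_log {a : ℝ} (ha : 0 ≤ a) : -1 ≤ a * Real.log a := by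
  have h := kl_nonneg ha one_pos
  rw [kl, Real.log_one, sub_zero] at h
  rcases le_total 1 a with h1 | h1
  · nlinarith [Real.log_nonneg h1]
  · linarith

/-- The Young inequality `a v ≤ a ln a - a + exp v`. -/
lemma mul_le_mul_log_add_exp {a : ℝ} (v : ℝ) (ha : 0 ≤ a) :
    a * v ≤ a * Real.log a - a + Real.exp v := by
  have h := kl_nonneg ha (Real.exp_pos v)
  rw [kl, Real.log_exp] at h
  linarith

/-! ### Densities -/

/-- `p` is a nonnegative measurable real valued density of `μ` with respect to `Q`. -/
structure HasDens (Q μ : Measure Ω) (p : Ω → ℝ) : Prop where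
  meas : Measurable p
  nonneg : ∀ ω, 0 ≤ p ω
  eq : μ = Q.withDensity (fun ω => ENNReal.ofReal (p ω))

namespace HasDens

variable {Q μ : Measure Ω} {p : Ω → ℝ}

lemma of_ac [SigmaFinite Q] [SigmaFinite μ] (h : μ ≪ Q) :
    HasDens Q μ (fun ω => (μ.rnDeriv Q ω).toReal) where
  meas := (Measure.measurable_rnDeriv μ Q).ennreal_toReal
  nonneg _ := ENNReal.toReal_nonneg
  eq := by
    conv_lhs => rw [← Measure.withDensity_rnDeriv_eq μ Q h]
    refine withDensity_congr_ae ?_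
    filter_upwards [Measure.rnDeriv_lt_top μ Q] with ω hω
    rw [ENNReal.ofReal_toReal hω.ne]

lemma ac (h : HasDens Q μ p) : μ ≪ Q := h.eq ▸ withDensity_absolutelyContinuous _ _

lemma rnDeriv (h : HasDens Q μ p) [SigmaFinite Q] :
    μ.rnDeriv Q =ᵐ[Q] fun ω => ENNReal.ofReal (p ω) := by
  rw [h.eq]
  exact Measure.rnDeriv_withDensity Q h.meas.ennreal_ofReal

lemma toReal_rnDeriv (h : HasDens Q μ p) [SigmaFinite Q] :
    (fun ω => (μ.rnDeriv Q ω).toReal) =ᵐ[Q] p := by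
  filter_upwards [h.rnDeriv] with ω hω
  rw [hω, ENNReal.toReal_ofReal (h.nonneg ω)]

lemma integrable (h : HasDens Q μ p) [IsFiniteMeasure μ] : Integrable p Q := by
  refine ⟨h.meas.aestronglyMeasurable, ?_⟩
  rw [hasFiniteIntegral_iff_ofReal (ae_of_all _ h.nonneg)]
  have : μ Set.univ < ⊤ := measure_lt_top _ _
  rwa [h.eq, withDensity_apply _ MeasurableSet.univ, setLIntegral_univ] at this

lemma lintegral_eq (h : HasDens Q μ p) : ∫⁻ ω, ENNReal.ofReal (p ω) ∂Q = μ Set.univ := by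
  rw [h.eq, withDensity_apply _ MeasurableSet.univ, setLIntegral_univ]

lemma integral_eq (h : HasDens Q μ p) : ∫ ω, p ω ∂Q = μ.real Set.univ := by
  rw [integral_eq_lintegral_of_nonneg_ae (ae_of_all _ h.nonneg) h.meas.aestronglyMeasurable,
    h.lintegral_eq, measureReal_def]

lemma integral_eq_one (h : HasDens Q μ p) [IsProbabilityMeasure μ] : ∫ ω, p ω ∂Q = 1 := by
  rw [h.integral_eq]; simp

lemma integrable_iff (h : HasDens Q μ p) {g : Ω → ℝ} :
    Integrable g μ ↔ Integrable (fun ω => p ω * g ω) Q := by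
  rw [h.eq, integrable_withDensity_iff_integrable_smul' h.meas.ennreal_ofReal
    (ae_of_all _ fun _ => ENNReal.ofReal_lt_top)]
  simp only [ENNReal.toReal_ofReal (h.nonneg _), smul_eq_mul]

lemma integral_comp (h : HasDens Q μ p) (g : Ω → ℝ) :
    ∫ ω, g ω ∂μ = ∫ ω, p ω * g ω ∂Q := by
  rw [h.eq, integral_withDensity_eq_integral_toReal_smul h.meas.ennreal_ofReal
    (ae_of_all _ fun _ => ENNReal.ofReal_lt_top)]
  simp only [ENNReal.toReal_ofReal (h.nonneg _), smul_eq_mul]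

lemma measureReal_eq (h : HasDens Q μ p) {A : Set Ω} (hA : MeasurableSet A) :
    μ.real A = ∫ ω in A, p ω ∂Q := by
  rw [integral_eq_lintegral_of_nonneg_ae (ae_of_all _ h.nonneg) h.meas.aestronglyMeasurable,
    measureReal_def, h.eq, withDensity_apply _ hA]

lemma congr (h : HasDens Q μ p) {p' : Ω → ℝ} (hm : Measurable p') (h0 : ∀ ω, 0 ≤ p' ω)
    (he : p =ᵐ[Q] p') : HasDens Q μ p' :=
  ⟨hm, h0, h.eq.trans (withDensity_congr_ae (he.mono fun ω hω => by simp only [hω]))⟩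

end HasDens

/-- The probability measure with a given density. -/
lemma exists_hasDens {Q : Measure Ω} {p : Ω → ℝ} (hp : Measurable p) (h0 : ∀ ω, 0 ≤ p ω)
    (hi : Integrable p Q) (h1 : ∫ ω, p ω ∂Q = 1) :
    ∃ P : ProbabilityMeasure Ω, HasDens Q P p := by
  have hP : IsProbabilityMeasure (Q.withDensity fun ω => ENNReal.ofReal (p ω)) := by
    constructor
    rw [withDensity_apply _ MeasurableSet.univ, setLIntegral_univ,
      ← ofReal_integral_eq_lintegral_ofReal hi (ae_of_all _ h0), h1, ENNReal.ofReal_one]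
  exact ⟨⟨_, hP⟩, hp, h0, rfl⟩

variable {Q : Measure Ω} [IsProbabilityMeasure Q]

lemma HasDens.coeFn_dens {P : ProbabilityMeasure Ω} {p : Ω → ℝ}
    (h : HasDens Q P p) : dens Q P =ᵐ[Q] p :=
  (Integrable.coeFn_toL1 _).trans h.toReal_rnDeriv

/-! ### Total variation distance -/

omit [IsProbabilityMeasure Q] in
-- The positive and negative parts of f live on disjoint sets, so they are the Jordan decomposition.
lemma totalVariation_withDensityᵥ {f : Ω → ℝ} (hf : Measurable f) (hfi : Integrable f Q) :
    (SignedMeasure.totalVariation (Q.withDensityᵥ f)).real Set.univ = ∫ ω, |f ω| ∂Q := by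
  have h1 := isFiniteMeasure_withDensity_ofReal hfi.2
  have h2 := isFiniteMeasure_withDensity_ofReal hfi.neg.2
  have hs : MeasurableSet {ω | f ω ≤ 0} := measurableSet_le hf measurable_const
  let j : JordanDecomposition Ω :=
    { posPart := Q.withDensity fun ω => ENNReal.ofReal (f ω)
      negPart := Q.withDensity fun ω => ENNReal.ofReal (-f ω)
      posPart_finite := h1
      negPart_finite := h2
      mutuallySingular := by
        refine ⟨{ω | f ω ≤ 0}, hs, ?_, ?_⟩
        · rw [withDensity_apply _ hs]
          exact (setLIntegral_congr_fun hs fun ω hω => ENNReal.ofReal_eq_zero.2 hω).trans (by simp)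
        · rw [withDensity_apply _ hs.compl]
          refine (setLIntegral_congr_fun hs.compl (g := fun _ => 0) fun ω hω =>
            ENNReal.ofReal_eq_zero.2 ?_).trans (by simp)
          have : ¬ f ω ≤ 0 := hω
          linarith }
  have hj : SignedMeasure.toJordanDecomposition (Q.withDensityᵥ f) = j :=
    SignedMeasure.toJordanDecomposition_eq
      (withDensityᵥ_eq_withDensity_pos_part_sub_withDensity_neg_part hfi)
  rw [SignedMeasure.totalVariation, hj, measureReal_def, Measure.add_apply,
    withDensity_apply _ MeasurableSet.univ, withDensity_apply _ MeasurableSet.univ,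
    setLIntegral_univ, setLIntegral_univ,
    ← lintegral_add_left hf.ennreal_ofReal,
    integral_eq_lintegral_of_nonneg_ae (ae_of_all _ fun ω => abs_nonneg (f ω))
      hf.abs.aestronglyMeasurable]
  congr 1
  refine lintegral_congr fun ω => ?_
  rcases le_total 0 (f ω) with h | h
  · simp [abs_of_nonneg h, h]
  · simp [abs_of_nonpos h, h]

omit [IsProbabilityMeasure Q] in
lemma HasDens.toSignedMeasure_eq {μ : Measure Ω} [IsFiniteMeasure μ] {p : Ω → ℝ}
    (h : HasDens Q μ p) : μ.toSignedMeasure = Q.withDensityᵥ p := by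
  ext A hA
  rw [withDensityᵥ_apply h.integrable hA, Measure.toSignedMeasure_apply_measurable hA,
    h.measureReal_eq hA]

omit [IsProbabilityMeasure Q] in
lemma tvDist_eq {P R : ProbabilityMeasure Ω} {p r : Ω → ℝ} (hp : HasDens Q P p)
    (hr : HasDens Q R r) : tvDist P R = ∫ ω, |p ω - r ω| ∂Q := by
  rw [tvDist, hp.toSignedMeasure_eq, hr.toSignedMeasure_eq,
    ← withDensityᵥ_sub hp.integrable hr.integrable]
  exact totalVariation_withDensityᵥ (hp.meas.sub hr.meas) (hp.integrable.sub hr.integrable)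

/-! ### The divergence and the entropy functional in terms of densities -/

omit [IsProbabilityMeasure Q] in
open Classical in
lemma entropy_congr {x : Ω →₁[Q] ℝ} {p : Ω → ℝ} (h : x =ᵐ[Q] p) :
    entropy Q x = if (∀ᵐ ω ∂Q, 0 ≤ p ω) ∧ ∫ ω, p ω ∂Q = 1 ∧
      Integrable (fun ω => p ω * Real.log (p ω)) Q then
        ((∫ ω, p ω * Real.log (p ω) ∂Q : ℝ) : EReal) else ⊤ := by
  have h1 : (∀ᵐ ω ∂Q, 0 ≤ x ω) ↔ (∀ᵐ ω ∂Q, 0 ≤ p ω) :=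
    eventually_congr (h.mono fun ω hω => by rw [hω])
  have h2 : (fun ω => x ω * Real.log (x ω)) =ᵐ[Q] fun ω => p ω * Real.log (p ω) :=
    h.mono fun ω hω => by simp only [hω]
  unfold entropy
  rw [h1, integral_congr_ae h, integrable_congr h2, integral_congr_ae h2]

lemma HasDens.entropy_eq {P : ProbabilityMeasure Ω} {p : Ω → ℝ} (h : HasDens Q P p)
    (hi : Integrable (fun ω => p ω * Real.log (p ω)) Q) :
    entropy Q (dens Q P) = ((∫ ω, p ω * Real.log (p ω) ∂Q : ℝ) : EReal) := by
  rw [entropy_congr h.coeFn_dens, if_pos ⟨ae_of_all _ h.nonneg, h.integral_eq_one, hi⟩]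

lemma HasDens.entropy_lt_top_iff {P : ProbabilityMeasure Ω} {p : Ω → ℝ} (h : HasDens Q P p) :
    entropy Q (dens Q P) < ⊤ ↔ Integrable (fun ω => p ω * Real.log (p ω)) Q := by
  refine ⟨fun h' => ?_, fun hi => by rw [h.entropy_eq hi]; exact EReal.coe_lt_top _⟩
  by_contra hi
  rw [entropy_congr h.coeFn_dens, if_neg fun hh => hi hh.2.2] at h'
  exact lt_irrefl _ h'

omit [IsProbabilityMeasure Q] in
/-- The log likelihood ratio in terms of densities with respect to a common measure. -/
lemma HasDens.llr_eq [SigmaFinite Q] {μ ν : Measure Ω} [IsFiniteMeasure μ] [IsFiniteMeasure ν]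
    {p s : Ω → ℝ} (hp : HasDens Q μ p) (hs : HasDens Q ν s) (hs0 : ∀ᵐ ω ∂Q, 0 < s ω)
    (hac : μ ≪ ν) :
    μ.rnDeriv ν =ᵐ[Q] fun ω => ENNReal.ofReal (p ω / s ω) := by
  filter_upwards [Measure.rnDeriv_mul_rnDeriv (κ := Q) hac, hp.rnDeriv, hs.rnDeriv, hs0]
    with ω h1 h2 h3 h4
  rw [Pi.mul_apply, h2, h3] at h1
  rw [ENNReal.ofReal_div_of_pos h4, ← h1,
    ENNReal.mul_div_cancel_right (by simpa using h4) ENNReal.ofReal_ne_top]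

omit [IsProbabilityMeasure Q] in
lemma HasDens.ac_of_pos {μ ν : Measure Ω} {p s : Ω → ℝ} (hp : HasDens Q μ p)
    (hs : HasDens Q ν s) (hs0 : ∀ᵐ ω ∂Q, 0 < s ω) : μ ≪ ν := by
  refine hp.ac.trans ?_
  rw [hs.eq]
  refine withDensity_absolutelyContinuous' hs.meas.ennreal_ofReal.aemeasurable ?_
  filter_upwards [hs0] with ω hω
  simpa using hω

omit [IsProbabilityMeasure Q] in
-- The factor p makes the identity hold also where p = 0, where the logarithm of the quotient does
-- not split.
lemma HasDens.mul_llr_eq [SigmaFinite Q] {μ ν : Measure Ω} [IsFiniteMeasure μ] [IsFiniteMeasure ν]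
    {p s : Ω → ℝ} (hp : HasDens Q μ p) (hs : HasDens Q ν s) (hs0 : ∀ᵐ ω ∂Q, 0 < s ω) :
    (fun ω => p ω * llr μ ν ω) =ᵐ[Q] fun ω => p ω * (Real.log (p ω) - Real.log (s ω)) := by
  filter_upwards [hp.llr_eq hs hs0 (hp.ac_of_pos hs hs0), hs0] with ω h1 h2
  rcases (hp.nonneg ω).eq_or_lt with h | h
  · simp [← h]
  · rw [llr, h1, ENNReal.toReal_ofReal (by positivity), Real.log_div h.ne' h2.ne']

omit [IsProbabilityMeasure Q] in
lemma HasDens.iDiv_lt_top_iff [SigmaFinite Q] {μ ν : Measure Ω} [IsFiniteMeasure μ]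
    [IsFiniteMeasure ν] {p s : Ω → ℝ} (hp : HasDens Q μ p) (hs : HasDens Q ν s)
    (hs0 : ∀ᵐ ω ∂Q, 0 < s ω) :
    iDiv μ ν < ⊤ ↔ Integrable (fun ω => p ω * (Real.log (p ω) - Real.log (s ω))) Q := by
  rw [← integrable_congr (hp.mul_llr_eq hs hs0), ← hp.integrable_iff, iDiv]
  by_cases hi : Integrable (llr μ ν) μ
  · rw [if_pos ⟨hp.ac_of_pos hs hs0, hi⟩]
    simp [hi]
  · rw [if_neg fun hh => hi hh.2]
    simp [hi]

omit [IsProbabilityMeasure Q] in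
lemma HasDens.iDiv_eq [SigmaFinite Q] {μ ν : Measure Ω} [IsFiniteMeasure μ]
    [IsFiniteMeasure ν] {p s : Ω → ℝ} (hp : HasDens Q μ p) (hs : HasDens Q ν s)
    (hs0 : ∀ᵐ ω ∂Q, 0 < s ω)
    (hi : Integrable (fun ω => p ω * (Real.log (p ω) - Real.log (s ω))) Q) :
    iDiv μ ν = ((∫ ω, p ω * (Real.log (p ω) - Real.log (s ω)) ∂Q : ℝ) : EReal) := by
  have hi' : Integrable (llr μ ν) μ := by
    rwa [hp.integrable_iff, integrable_congr (hp.mul_llr_eq hs hs0)]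
  rw [iDiv, if_pos ⟨hp.ac_of_pos hs hs0, hi'⟩, hp.integral_comp,
    integral_congr_ae (hp.mul_llr_eq hs hs0)]

omit [IsProbabilityMeasure Q] in
lemma ac_of_iDiv_lt_top {μ ν : Measure Ω} (h : iDiv μ ν < ⊤) : μ ≪ ν := by
  by_contra hac
  rw [iDiv, if_neg fun hh => hac hh.1] at h
  exact lt_irrefl _ h

omit [IsProbabilityMeasure Q] in
lemma hasDens_self : HasDens Q Q (fun _ => 1) :=
  ⟨measurable_const, fun _ => zero_le_one, by simp⟩

lemma HasDens.iDiv_self_eq_entropy {P : ProbabilityMeasure Ω} {p : Ω → ℝ} (h : HasDens Q P p) :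
    iDiv (P : Measure Ω) Q = entropy Q (dens Q P) := by
  have h1 : ∀ᵐ ω ∂Q, (0 : ℝ) < (fun _ => 1) ω := ae_of_all _ fun _ => one_pos
  have h2 := h.iDiv_lt_top_iff hasDens_self h1
  simp only [Real.log_one, sub_zero] at h2
  by_cases hi : Integrable (fun ω => p ω * Real.log (p ω)) Q
  · rw [h.entropy_eq hi, h.iDiv_eq hasDens_self h1 (by simpa using hi)]
    simp
  · have h3 := (not_congr h2).2 hi
    have h4 := (not_congr h.entropy_lt_top_iff).2 hi
    rw [not_lt_top_iff] at h3 h4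
    rw [h3, h4]

end IProj

end

noncomputable section

namespace IProj

variable {Ω : Type*} [MeasurableSpace Ω]

variable {Q : Measure Ω} [IsProbabilityMeasure Q]

/-! ### The dual of `L₁` and closed convex sets of densities -/

/-- The restriction to `L₂` of a continuous linear functional on `L₁`. -/
lemma exists_L2_functional (ℓ : StrongDual ℝ (Ω →₁[Q] ℝ)) :
    ∃ k : StrongDual ℝ (Ω →₂[Q] ℝ), ∀ (f : Ω →₂[Q] ℝ) (h : Integrable f Q),
      k f = ℓ (h.toL1 f) := by
  have hint : ∀ f : Ω →₂[Q] ℝ, Integrable f Q := fun f =>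
    (Lp.memLp f).integrable (by norm_num)
  let k₀ : (Ω →₂[Q] ℝ) →ₗ[ℝ] ℝ :=
    { toFun := fun f => ℓ ((hint f).toL1 f)
      map_add' := fun f g => by
        rw [← map_add, ← Integrable.toL1_add]
        congr 1
        exact (Integrable.toL1_eq_toL1_iff _ _ _ _).2 (Lp.coeFn_add f g)
      map_smul' := fun c f => by
        rw [RingHom.id_apply, ← map_smul, ← Integrable.toL1_smul]
        congr 1
        exact (Integrable.toL1_eq_toL1_iff _ _ _ _).2 (Lp.coeFn_smul c f) }
  refine ⟨k₀.mkContinuous ‖ℓ‖ fun f => ?_, fun f h => rfl⟩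
  refine (ℓ.le_opNorm _).trans (mul_le_mul_of_nonneg_left ?_ (norm_nonneg _))
  rw [Integrable.norm_toL1, Lp.norm_def]
  have h1 : eLpNorm f 1 Q ≤ eLpNorm f 2 Q :=
    eLpNorm_le_eLpNorm_of_exponent_le (by norm_num) (Lp.aestronglyMeasurable f)
  rw [eLpNorm_one_eq_lintegral_enorm] at h1
  simp only [edist_zero_right]
  exact ENNReal.toReal_mono (Lp.eLpNorm_ne_top f) h1

/-- Continuous linear functionals on `L₁` of a probability measure are given by bounded
functions. -/
lemma exists_bounded_repr (ℓ : StrongDual ℝ (Ω →₁[Q] ℝ)) :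
    ∃ w : Ω → ℝ, Measurable w ∧ (∃ B, ∀ ω, |w ω| ≤ B) ∧
      ∀ f : Ω →₁[Q] ℝ, ℓ f = ∫ ω, f ω * w ω ∂Q := by
  obtain ⟨k, hk⟩ := exists_L2_functional ℓ
  let v : Ω →₂[Q] ℝ := (InnerProductSpace.toDual ℝ (Ω →₂[Q] ℝ)).symm k
  have hv : ∀ (A : Set Ω) (hA : MeasurableSet A) (c : ℝ),
      ℓ (indicatorConstLp 1 hA (measure_ne_top Q A) c) = ∫ ω in A, c * v ω ∂Q := by
    intro A hA c
    have h1 : k (indicatorConstLp 2 hA (measure_ne_top Q A) c) = ∫ ω in A, c * v ω ∂Q := by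
      rw [← InnerProductSpace.toDual_symm_apply, real_inner_comm,
        L2.inner_indicatorConstLp_eq_inner_setIntegral]
      rw [integral_const_mul]
      simp [v, mul_comm]
    rw [← h1, hk _ ((Lp.memLp _).integrable (by norm_num))]
    congr 1
    refine Lp.ext ?_
    refine indicatorConstLp_coeFn.trans ?_
    exact (indicatorConstLp_coeFn.symm).trans (Integrable.coeFn_toL1 _).symm
  have hvi : Integrable v Q := (Lp.memLp v).integrable (by norm_num)
  -- The averages of v over all measurable sets are bounded by ‖ℓ‖, which forces |v| ≤ ‖ℓ‖ almost
  -- everywhere.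
  have hbound : ∀ (A : Set Ω), MeasurableSet A → |∫ ω in A, v ω ∂Q| ≤ ‖ℓ‖ * Q.real A := by
    intro A hA
    have h1 := hv A hA 1
    simp only [one_mul] at h1
    rw [← h1]
    refine (ℓ.le_opNorm _).trans ?_
    rw [norm_indicatorConstLp one_ne_zero ENNReal.one_ne_top]
    simp
  have hle : ∀ᵐ ω ∂Q, v ω ≤ ‖ℓ‖ := by
    refine ae_le_of_forall_setIntegral_le hvi (integrable_const _) fun A hA _ => ?_
    rw [setIntegral_const, smul_eq_mul, mul_comm]
    exact (le_abs_self _).trans (hbound A hA)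
  have hge : ∀ᵐ ω ∂Q, -‖ℓ‖ ≤ v ω := by
    refine ae_le_of_forall_setIntegral_le (integrable_const _) hvi fun A hA _ => ?_
    rw [setIntegral_const, smul_eq_mul, mul_comm, neg_mul]
    exact (abs_le.1 (hbound A hA)).1
  let v' : Ω → ℝ := (Lp.aestronglyMeasurable v).mk v
  have hv' : v =ᵐ[Q] v' := (Lp.aestronglyMeasurable v).ae_eq_mk
  let w : Ω → ℝ := fun ω => max (-‖ℓ‖) (min ‖ℓ‖ (v' ω))
  have hwm : Measurable w := by
    have : Measurable v' := (Lp.aestronglyMeasurable v).stronglyMeasurable_mk.measurable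
    fun_prop
  have hwb : ∀ ω, |w ω| ≤ ‖ℓ‖ := fun ω => by
    have h0 := norm_nonneg ℓ
    exact abs_le.2 ⟨le_max_left _ _, max_le (by linarith) (min_le_left _ _)⟩
  have hvw : v =ᵐ[Q] w := by
    filter_upwards [hle, hge, hv'] with ω h1 h2 h3
    rw [h3] at h1 h2 ⊢
    simp [w, h1, h2]
  refine ⟨w, hwm, ⟨_, hwb⟩, fun f => ?_⟩
  have hmul : ∀ g : Ω →₁[Q] ℝ, Integrable (fun ω => g ω * w ω) Q := fun g =>
    (L1.integrable_coeFn g).mul_bdd hwm.aestronglyMeasurable (ae_of_all _ hwb)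
  refine Lp.induction ENNReal.one_ne_top
    (motive := fun f : Ω →₁[Q] ℝ => ℓ f = ∫ ω, f ω * w ω ∂Q) ?_ ?_ ?_ f
  · intro c A hA hμA
    rw [Lp.simpleFunc.coe_indicatorConst, hv A hA c, ← integral_indicator hA]
    refine integral_congr_ae ?_
    filter_upwards [indicatorConstLp_coeFn (p := 1) (hs := hA) (hμs := measure_ne_top Q A) (c := c),
      hvw] with ω h1 h2
    rw [h1]
    by_cases hω : ω ∈ A <;> simp [hω, h2]
  · intro f g hf hg _ h1 h2
    rw [map_add, h1, h2, ← integral_add (hmul _) (hmul _)]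
    refine integral_congr_ae ?_
    filter_upwards [Lp.coeFn_add (hf.toLp f) (hg.toLp g)] with ω h
    rw [h, Pi.add_apply, add_mul]
  · refine isClosed_eq ℓ.continuous ?_
    have h1 : Continuous fun g : Ω →₁[Q] ℝ => ∫ ω, g ω * w ω ∂Q := by
      refine continuous_iff_continuousAt.2 fun g₀ => ?_
      refine tendsto_integral_of_L1 _ (hmul g₀).aestronglyMeasurable (Eventually.of_forall hmul) ?_
      have h2 : Tendsto (fun g : Ω →₁[Q] ℝ => ENNReal.ofReal (‖ℓ‖ * ‖g - g₀‖)) (𝓝 g₀) (𝓝 0) := by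
        rw [← ENNReal.ofReal_zero]
        refine ENNReal.tendsto_ofReal ?_
        have : Continuous fun g : Ω →₁[Q] ℝ => ‖ℓ‖ * ‖g - g₀‖ := by fun_prop
        simpa using this.tendsto g₀
      refine tendsto_of_tendsto_of_tendsto_of_le_of_le tendsto_const_nhds h2
        (fun _ => zero_le) fun g => ?_
      have h3 : ∫⁻ ω, ENNReal.ofReal ‖ℓ‖ * ‖(g - g₀ : Ω →₁[Q] ℝ) ω‖ₑ ∂Q
          = ENNReal.ofReal (‖ℓ‖ * ‖g - g₀‖) := by
        rw [lintegral_const_mul' _ _ ENNReal.ofReal_ne_top, ENNReal.ofReal_mul (norm_nonneg _),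
          L1.norm_eq_integral_norm, ofReal_integral_norm_eq_lintegral_enorm (L1.integrable_coeFn _)]
      rw [← h3]
      refine lintegral_mono_ae ?_
      filter_upwards [Lp.coeFn_sub g g₀] with ω h
      rw [h, Pi.sub_apply, ← sub_mul, enorm_mul, mul_comm]
      gcongr
      rw [← ofReal_norm]
      exact ENNReal.ofReal_le_ofReal (hwb ω)
    exact h1

omit [IsProbabilityMeasure Q] in
/-- Mixtures of measures with densities. -/
lemma HasDens.mix {μ ν : Measure Ω} {p r : Ω → ℝ} (hp : HasDens Q μ p) (hr : HasDens Q ν r)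
    (a b : ℝ≥0) : HasDens Q (a • μ + b • ν) (fun ω => a * p ω + b * r ω) where
  meas := (hp.meas.const_mul _).add (hr.meas.const_mul _)
  nonneg ω := by have := hp.nonneg ω; have := hr.nonneg ω; positivity
  eq := by
    have h : (fun ω => ENNReal.ofReal (a * p ω + b * r ω)) =
        (a : ℝ≥0∞) • (fun ω => ENNReal.ofReal (p ω)) + (b : ℝ≥0∞) • fun ω => ENNReal.ofReal (r ω) := by
      ext ω
      have h1 := hp.nonneg ω
      have h2 := hr.nonneg ω
      simp [ENNReal.ofReal_add, ENNReal.ofReal_mul, h1, h2, mul_nonneg]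
    rw [h, withDensity_add_left (hp.meas.ennreal_ofReal.const_smul _),
      withDensity_smul _ hp.meas.ennreal_ofReal, withDensity_smul _ hr.meas.ennreal_ofReal,
      ← hp.eq, ← hr.eq]
    rfl

omit [IsProbabilityMeasure Q] in
lemma ConvexPM.exists_mix {C : Set (ProbabilityMeasure Ω)} (hC : ConvexPM C)
    {P R : ProbabilityMeasure Ω} (hP : P ∈ C) (hR : R ∈ C) {p r : Ω → ℝ} (hp : HasDens Q P p)
    (hr : HasDens Q R r) {a b : ℝ} (ha : 0 ≤ a) (hb : 0 ≤ b) (hab : a + b = 1) :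
    ∃ W ∈ C, HasDens Q (W : Measure Ω) (fun ω => a * p ω + b * r ω) := by
  lift a to ℝ≥0 using ha
  lift b to ℝ≥0 using hb
  have h := hp.mix hr a b
  obtain ⟨W, hW⟩ := exists_hasDens h.meas h.nonneg
    ((hp.integrable.const_mul _).add (hr.integrable.const_mul _)) (by
      rw [integral_add (hp.integrable.const_mul _) (hr.integrable.const_mul _),
        integral_const_mul, integral_const_mul, hp.integral_eq_one, hr.integral_eq_one]
      simpa using hab)
  exact ⟨W, hC P hP R hR a b W (by exact_mod_cast hab) (hW.eq.trans h.eq.symm), hW⟩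

lemma convexOn_mul_log : ConvexOn ℝ (Set.Ici 0) fun x : ℝ => x * Real.log x :=
  Real.strictConvexOn_mul_log.convexOn

omit [IsProbabilityMeasure Q] in
-- Convexity of x ln x bounds the mixture from above and -1 bounds it from below.
lemma integrable_mul_log_mix [IsFiniteMeasure Q] {p r : Ω → ℝ} (hpm : Measurable p)
    (hrm : Measurable r)
    (hp0 : ∀ ω, 0 ≤ p ω) (hr0 : ∀ ω, 0 ≤ r ω)
    (hp : Integrable (fun ω => p ω * Real.log (p ω)) Q)
    (hr : Integrable (fun ω => r ω * Real.log (r ω)) Q) {a b : ℝ} (ha : 0 ≤ a) (hb : 0 ≤ b)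
    (hab : a + b = 1) :
    Integrable (fun ω => (a * p ω + b * r ω) * Real.log (a * p ω + b * r ω)) Q := by
  have hm : Measurable fun ω => (a * p ω + b * r ω) * Real.log (a * p ω + b * r ω) := by fun_prop
  refine Integrable.mono'
    (((hp.abs.const_mul a).add (hr.abs.const_mul b)).add (integrable_const 1))
    hm.aestronglyMeasurable (ae_of_all _ fun ω => ?_)
  have h1 := convexOn_mul_log.2 (hp0 ω) (hr0 ω) ha hb hab
  simp only [smul_eq_mul] at h1
  have h0 : 0 ≤ a * p ω + b * r ω := by have := hp0 ω; have := hr0 ω; positivity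
  have h2 := neg_one_le_mul_log h0
  have h3 := mul_le_mul_of_nonneg_left (le_abs_self (p ω * Real.log (p ω))) ha
  have h4 := mul_le_mul_of_nonneg_left (le_abs_self (r ω * Real.log (r ω))) hb
  have h5 : 0 ≤ a * |p ω * Real.log (p ω)| := by positivity
  have h6 : 0 ≤ b * |r ω * Real.log (r ω)| := by positivity
  rw [Real.norm_eq_abs, abs_le]
  simp only [Pi.add_apply]
  constructor <;> linarith

/-- If no bounded function separates the density `p` from the densities of finite entropy of a
closed convex set of probability measures, then `p` is a density of a member of that set. -/
lemma mem_of_forall_bounded {C : Set (ProbabilityMeasure Ω)} (hC : ConvexPM C)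
    (hcl : VariationClosed C) {P : ProbabilityMeasure Ω} {p : Ω → ℝ} (hp : HasDens Q P p)
    (h : ∀ w : Ω → ℝ, Measurable w → (∃ B, ∀ ω, |w ω| ≤ B) →
      (∀ R ∈ C, ∀ r : Ω → ℝ, HasDens Q (R : Measure Ω) r →
        Integrable (fun ω => r ω * Real.log (r ω)) Q → 0 ≤ ∫ ω, r ω * w ω ∂Q) →
      0 ≤ ∫ ω, p ω * w ω ∂Q) : P ∈ C := by
  let D : Set (Ω →₁[Q] ℝ) := {x | ∃ R ∈ C, ∃ r : Ω → ℝ, HasDens Q (R : Measure Ω) r ∧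
    Integrable (fun ω => r ω * Real.log (r ω)) Q ∧ x =ᵐ[Q] r}
  have hD : Convex ℝ D := by
    rintro x ⟨R, hR, r, hr, hri, hxr⟩ x' ⟨R', hR', r', hr', hri', hxr'⟩ a b ha hb hab
    obtain ⟨W, hW, hWd⟩ := hC.exists_mix hR hR' hr hr' ha hb hab
    refine ⟨W, hW, _, hWd, integrable_mul_log_mix hr.meas hr'.meas hr.nonneg hr'.nonneg hri hri'
      ha hb hab, ?_⟩
    filter_upwards [hxr, hxr', Lp.coeFn_add (a • x) (b • x'), Lp.coeFn_smul a x,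
      Lp.coeFn_smul b x'] with ω h1 h2 h3 h4 h5
    rw [h3, Pi.add_apply, h4, h5, Pi.smul_apply, Pi.smul_apply, h1, h2, smul_eq_mul, smul_eq_mul]
  have hmem : hp.integrable.toL1 p ∈ closure D := by
    by_contra hnot
    obtain ⟨ℓ, u, hu, hlt⟩ :=
      geometric_hahn_banach_point_closed hD.closure isClosed_closure hnot
    obtain ⟨w, hwm, ⟨B, hB⟩, hw⟩ := exists_bounded_repr ℓ
    have hint : ∀ {f : Ω → ℝ}, Integrable f Q → Integrable (fun ω => f ω * w ω) Q := fun hf =>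
      hf.mul_bdd hwm.aestronglyMeasurable (ae_of_all _ hB)
    -- Densities integrate to one, so subtracting the separating level u from w turns affine
    -- separation into a sign condition, which is what the hypothesis tests.
    have hshift : ∀ {μ : Measure Ω} [IsProbabilityMeasure μ] {r : Ω → ℝ}, HasDens Q μ r →
        ∫ ω, r ω * (w ω - u) ∂Q = ∫ ω, r ω * w ω ∂Q - u := by
      intro μ _ r hr
      simp only [mul_sub]
      rw [integral_sub (hint hr.integrable) (hr.integrable.mul_const u), integral_mul_const,
        hr.integral_eq_one, one_mul]
    have h1 : ℓ (hp.integrable.toL1 p) = ∫ ω, p ω * w ω ∂Q := by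
      rw [hw]
      refine integral_congr_ae ?_
      filter_upwards [Integrable.coeFn_toL1 hp.integrable] with ω hω
      rw [hω]
    have h2 := h (fun ω => w ω - u) (hwm.sub_const u) ⟨B + |u|, fun ω =>
      (abs_sub _ _).trans (by linarith [hB ω])⟩ (by
        intro R hR r hr hri
        have h3 := hlt (hr.integrable.toL1 r) (subset_closure
          ⟨R, hR, r, hr, hri, Integrable.coeFn_toL1 _⟩)
        have h4 : ℓ (hr.integrable.toL1 r) = ∫ ω, r ω * w ω ∂Q := by
          rw [hw]
          refine integral_congr_ae ?_
          filter_upwards [Integrable.coeFn_toL1 hr.integrable] with ω hω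
          rw [hω]
        rw [hshift hr]
        linarith)
    rw [hshift hp] at h2
    linarith
  obtain ⟨x, hx, hlim⟩ := mem_closure_iff_seq_limit.1 hmem
  choose R hR r hr _ hxr using hx
  refine hcl R P hR ?_
  have h1 : ∀ n, tvDist (R n) P = ‖x n - hp.integrable.toL1 p‖ := by
    intro n
    rw [tvDist_eq (hr n) hp, L1.norm_eq_integral_norm]
    refine integral_congr_ae ?_
    filter_upwards [hxr n, Integrable.coeFn_toL1 hp.integrable,
      Lp.coeFn_sub (x n) (hp.integrable.toL1 p)] with ω h1 h2 h3
    rw [h3, Pi.sub_apply, h1, h2, Real.norm_eq_abs]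
  simp only [h1]
  exact tendsto_iff_norm_sub_tendsto_zero.1 hlim

end IProj

end

noncomputable section

namespace IProj

variable {Ω : Type*} [MeasurableSpace Ω]

variable {Q : Measure Ω} [IsProbabilityMeasure Q]

/-! ### Well defined nonnegative integrals and conjugate cones -/

omit [IsProbabilityMeasure Q] in
lemma integralNonneg_coe_iff {z : Ω → ℝ} :
    IntegralNonneg Q (fun ω => (z ω : EReal)) ↔ ∫⁻ ω, ENNReal.ofReal (-z ω) ∂Q ≠ ⊤ ∧
      ∫⁻ ω, ENNReal.ofReal (-z ω) ∂Q ≤ ∫⁻ ω, ENNReal.ofReal (z ω) ∂Q := by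
  have h : ∀ a : ℝ, EReal.toENNReal (a : EReal) = ENNReal.ofReal a := fun a => by
    rw [EReal.toENNReal_of_ne_top (EReal.coe_ne_top a), EReal.toReal_coe]
  simp only [IntegralNonneg, ← EReal.coe_neg, h]

omit [IsProbabilityMeasure Q] in
lemma IntegralNonneg.congr {z z' : Ω → EReal} (h : IntegralNonneg Q z) (he : z =ᵐ[Q] z') :
    IntegralNonneg Q z' := by
  have h1 : ∫⁻ ω, (-z ω).toENNReal ∂Q = ∫⁻ ω, (-z' ω).toENNReal ∂Q :=
    lintegral_congr_ae (he.mono fun ω hω => by simp only [hω])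
  have h2 : ∫⁻ ω, (z ω).toENNReal ∂Q = ∫⁻ ω, (z' ω).toENNReal ∂Q :=
    lintegral_congr_ae (he.mono fun ω hω => by simp only [hω])
  unfold IntegralNonneg at h ⊢
  rwa [← h1, ← h2]

omit [IsProbabilityMeasure Q] in
lemma IntegralNonneg.of_integrable {z : Ω → ℝ} (hz : Integrable z Q) (h0 : 0 ≤ ∫ ω, z ω ∂Q) :
    IntegralNonneg Q (fun ω => (z ω : EReal)) := by
  rw [integralNonneg_coe_iff]
  have h1 : ∫⁻ ω, ENNReal.ofReal (-z ω) ∂Q ≠ ⊤ := hz.neg.lintegral_lt_top.ne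
  have h2 : ∫⁻ ω, ENNReal.ofReal (z ω) ∂Q ≠ ⊤ := hz.lintegral_lt_top.ne
  refine ⟨h1, ?_⟩
  rw [integral_eq_lintegral_pos_part_sub_lintegral_neg_part hz] at h0
  exact (ENNReal.toReal_le_toReal h1 h2).1 (by linarith)

omit [IsProbabilityMeasure Q] in
lemma integrable_of_lintegral_parts {z : Ω → ℝ} (hm : AEMeasurable z Q)
    (h1 : ∫⁻ ω, ENNReal.ofReal (-z ω) ∂Q ≠ ⊤) (h2 : ∫⁻ ω, ENNReal.ofReal (z ω) ∂Q ≠ ⊤) :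
    Integrable z Q := by
  refine ⟨hm.aestronglyMeasurable, ?_⟩
  have h3 : ∫⁻ ω, ‖z ω‖ₑ ∂Q ≤
      ∫⁻ ω, ENNReal.ofReal (z ω) ∂Q + ∫⁻ ω, ENNReal.ofReal (-z ω) ∂Q := by
    rw [← lintegral_add_left' hm.ennreal_ofReal]
    refine lintegral_mono fun ω => ?_
    rw [Real.enorm_eq_ofReal_abs]
    rcases le_total 0 (z ω) with h | h
    · rw [abs_of_nonneg h]; exact le_self_add
    · rw [abs_of_nonpos h]; exact le_add_self
  exact h3.trans_lt (ENNReal.add_lt_top.2 ⟨h2.lt_top, h1.lt_top⟩)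

omit [IsProbabilityMeasure Q] in
lemma IntegralNonneg.integral_nonneg {z : Ω → ℝ} (h : IntegralNonneg Q (fun ω => (z ω : EReal)))
    (hz : Integrable z Q) : 0 ≤ ∫ ω, z ω ∂Q := by
  rw [integralNonneg_coe_iff] at h
  rw [integral_eq_lintegral_pos_part_sub_lintegral_neg_part hz]
  have h3 := (ENNReal.toReal_le_toReal h.1 hz.lintegral_lt_top.ne).2 h.2
  linarith

omit [IsProbabilityMeasure Q] in
lemma IntegralNonneg.integrable_of_le {z b : Ω → ℝ}
    (h : IntegralNonneg Q (fun ω => (z ω : EReal))) (hm : AEMeasurable z Q)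
    (hb : Integrable b Q) (hzb : ∀ᵐ ω ∂Q, z ω ≤ b ω) : Integrable z Q := by
  refine integrable_of_lintegral_parts hm (integralNonneg_coe_iff.1 h).1 ?_
  refine ne_top_of_le_ne_top hb.lintegral_lt_top.ne (lintegral_mono_ae ?_)
  filter_upwards [hzb] with ω hω using ENNReal.ofReal_le_ofReal hω

omit [IsProbabilityMeasure Q] in
-- A pairing may have the value +∞. In that case its positive part has infinite integral, and an
-- integrable perturbation changes neither this nor the finiteness of the negative part.
lemma IntegralNonneg.add_integrable {z b : Ω → ℝ} (h : IntegralNonneg Q (fun ω => (z ω : EReal)))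
    (hm : AEMeasurable z Q) (hb : Integrable b Q) (h0 : 0 ≤ ∫ ω, b ω ∂Q) :
    IntegralNonneg Q (fun ω => ((z ω + b ω : ℝ) : EReal)) := by
  by_cases hz : Integrable z Q
  · refine IntegralNonneg.of_integrable (z := fun ω => z ω + b ω) (hz.add hb) ?_
    rw [integral_add hz hb]
    have := h.integral_nonneg hz
    positivity
  · rw [integralNonneg_coe_iff] at h ⊢
    have h2 : ∫⁻ ω, ENNReal.ofReal (z ω) ∂Q = ⊤ := by
      by_contra h2
      exact hz (integrable_of_lintegral_parts hm h.1 h2)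
    have h3 : ∫⁻ ω, ENNReal.ofReal (z ω) ∂Q ≤
        ∫⁻ ω, ENNReal.ofReal (z ω + b ω) ∂Q + ∫⁻ ω, ENNReal.ofReal (-b ω) ∂Q := by
      rw [← lintegral_add_right' _ (show AEMeasurable (fun ω => ENNReal.ofReal (-b ω)) Q from
        hb.aemeasurable.neg.ennreal_ofReal)]
      refine lintegral_mono fun ω => ?_
      refine le_trans (le_of_eq ?_) ENNReal.ofReal_add_le
      congr 1; ring
    have h4 : ∫⁻ ω, ENNReal.ofReal (z ω + b ω) ∂Q = ⊤ := by
      rw [h2, top_le_iff, ENNReal.add_eq_top] at h3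
      exact h3.resolve_right hb.neg.lintegral_lt_top.ne
    have h5 : ∫⁻ ω, ENNReal.ofReal (-(z ω + b ω)) ∂Q ≤
        ∫⁻ ω, ENNReal.ofReal (-z ω) ∂Q + ∫⁻ ω, ENNReal.ofReal (-b ω) ∂Q := by
      rw [← lintegral_add_right' _ (show AEMeasurable (fun ω => ENNReal.ofReal (-b ω)) Q from
        hb.aemeasurable.neg.ennreal_ofReal)]
      refine lintegral_mono fun ω => ?_
      rw [neg_add]
      exact ENNReal.ofReal_add_le
    refine ⟨ne_top_of_le_ne_top ?_ h5, by rw [h4]; exact le_top⟩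
    exact ENNReal.add_ne_top.2 ⟨h.1, hb.neg.lintegral_lt_top.ne⟩

omit [IsProbabilityMeasure Q] in
lemma IntegralNonneg.const_mul {z : Ω → ℝ} (h : IntegralNonneg Q (fun ω => (z ω : EReal)))
    {c : ℝ} (hc : 0 ≤ c) : IntegralNonneg Q (fun ω => ((c * z ω : ℝ) : EReal)) := by
  rw [integralNonneg_coe_iff] at h ⊢
  simp only [← mul_neg, ENNReal.ofReal_mul hc]
  rw [lintegral_const_mul' _ _ ENNReal.ofReal_ne_top, lintegral_const_mul' _ _ ENNReal.ofReal_ne_top]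
  exact ⟨ENNReal.mul_ne_top ENNReal.ofReal_ne_top h.1, mul_le_mul_right h.2 _⟩

/-- On the domain of the entropy, the cone over `C` consists of the densities of members of `C`. -/
lemma mem_densCone_iff {C : Set (ProbabilityMeasure Ω)} {x : Ω →₁[Q] ℝ} (hx : entropy Q x < ⊤) :
    x ∈ densCone Q C ↔ ∃ R ∈ C, (R : Measure Ω) ≪ Q ∧ x = dens Q R := by
  constructor
  · rintro ⟨R, hR, hac, α, -, rfl⟩
    refine ⟨R, hR, hac, ?_⟩
    have h1 : ∫ ω, (α • dens Q R) ω ∂Q = 1 := by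
      by_contra h
      rw [entropy, if_neg fun hh => h hh.2.1] at hx
      exact lt_irrefl _ hx
    have hd := HasDens.of_ac hac
    have h2 : ∫ ω, (α • dens Q R) ω ∂Q = α := by
      have : (fun ω => (α • dens Q R) ω) =ᵐ[Q]
          fun ω => α * ((R : Measure Ω).rnDeriv Q ω).toReal := by
        filter_upwards [Lp.coeFn_smul α (dens Q R), hd.coeFn_dens] with ω h1 h2
        rw [h1, Pi.smul_apply, h2, smul_eq_mul]
      rw [integral_congr_ae this, integral_const_mul, hd.integral_eq_one, mul_one]
    rw [h2.symm.trans h1, one_smul]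
  · rintro ⟨R, hR, hac, rfl⟩
    exact ⟨R, hR, hac, 1, zero_le_one, (one_smul _ _).symm⟩

lemma eq_of_dens_eq {P R : ProbabilityMeasure Ω} (hP : (P : Measure Ω) ≪ Q)
    (hR : (R : Measure Ω) ≪ Q) (h : dens Q P = dens Q R) : P = R := by
  have h1 := (HasDens.of_ac hP).coeFn_dens
  have h2 := (HasDens.of_ac hR).coeFn_dens
  rw [h] at h1
  have h3 := (HasDens.of_ac hP).congr (HasDens.of_ac hR).meas (HasDens.of_ac hR).nonneg
    (h1.symm.trans h2)
  exact Subtype.ext (h3.eq.trans (HasDens.of_ac hR).eq.symm)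

/-- Finite entropy fixes the scalar α at one, and a density determines its measure, so the members
of the different C_i representing x coincide. -/
lemma mem_iInter_densCone_iff {ι : Type*} [Nonempty ι] {C : ι → Set (ProbabilityMeasure Ω)}
    {x : Ω →₁[Q] ℝ} (hx : entropy Q x < ⊤) :
    x ∈ ⋂ i, densCone Q (C i) ↔ ∃ R ∈ ⋂ i, C i, (R : Measure Ω) ≪ Q ∧ x = dens Q R := by
  simp only [Set.mem_iInter, mem_densCone_iff hx]
  constructor
  · intro h
    choose R hR hac hxR using h
    obtain ⟨i₀⟩ := ‹Nonempty ι›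
    refine ⟨R i₀, fun i => ?_, hac i₀, hxR i₀⟩
    rw [eq_of_dens_eq (hac i₀) (hac i) ((hxR i₀).symm.trans (hxR i))]
    exact hR i
  · rintro ⟨R, hR, hac, rfl⟩ i
    exact ⟨R, hR i, hac, rfl⟩

/-- The hypothesis `hS` holds for a single cone and for the intersection of the cones alike, so one
description serves both the dual step and the dual problem. -/
lemma mem_conjCone_iff {S : Set (Ω →₁[Q] ℝ)} {C : Set (ProbabilityMeasure Ω)}
    (hS : ∀ x, entropy Q x < ⊤ → (x ∈ S ↔ ∃ R ∈ C, (R : Measure Ω) ≪ Q ∧ x = dens Q R))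
    {y : Ω → EReal} :
    y ∈ conjCone Q S ↔ Measurable y ∧ ∀ R ∈ C, ∀ r : Ω → ℝ, HasDens Q (R : Measure Ω) r →
      Integrable (fun ω => r ω * Real.log (r ω)) Q →
        IntegralNonneg Q (fun ω => ((r ω : ℝ) : EReal) * y ω) := by
  refine and_congr_right fun _ => ⟨fun h R hR r hr hri => ?_, fun h x hx hxe => ?_⟩
  · have he := hr.entropy_lt_top_iff.2 hri
    refine (h _ ((hS _ he).2 ⟨R, hR, hr.ac, rfl⟩) he).congr ?_
    filter_upwards [hr.coeFn_dens] with ω hω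
    rw [hω]
  · obtain ⟨R, hR, hac, rfl⟩ := (hS x hxe).1 hx
    have hr := HasDens.of_ac hac
    refine (h R hR _ hr (hr.entropy_lt_top_iff.1 hxe)).congr ?_
    filter_upwards [hr.coeFn_dens] with ω hω
    rw [hω]

/-- The pairing of a real valued function with all densities of finite entropy of members of `C`
is well defined and nonnegative. -/
def PairNonneg (Q : Measure Ω) (C : Set (ProbabilityMeasure Ω)) (v : Ω → ℝ) : Prop :=
  ∀ R ∈ C, ∀ r : Ω → ℝ, HasDens Q (R : Measure Ω) r →
    Integrable (fun ω => r ω * Real.log (r ω)) Q →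
      IntegralNonneg Q (fun ω => ((r ω * v ω : ℝ) : EReal))

lemma coe_mem_conjCone_iff {S : Set (Ω →₁[Q] ℝ)} {C : Set (ProbabilityMeasure Ω)}
    (hS : ∀ x, entropy Q x < ⊤ → (x ∈ S ↔ ∃ R ∈ C, (R : Measure Ω) ≪ Q ∧ x = dens Q R))
    {v : Ω → ℝ} (hv : Measurable v) :
    (fun ω => (v ω : EReal)) ∈ conjCone Q S ↔ PairNonneg Q C v := by
  rw [mem_conjCone_iff hS]
  simp only [hv.coe_real_ereal, true_and, PairNonneg, EReal.coe_mul]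

omit [IsProbabilityMeasure Q] in
lemma PairNonneg.zero {C : Set (ProbabilityMeasure Ω)} : PairNonneg Q C (fun _ => 0) := by
  intro R _ r _ _
  simp [IntegralNonneg]

omit [IsProbabilityMeasure Q] in
lemma PairNonneg.const_mul {C : Set (ProbabilityMeasure Ω)} {v : Ω → ℝ} (h : PairNonneg Q C v)
    {c : ℝ} (hc : 0 ≤ c) : PairNonneg Q C (fun ω => c * v ω) := fun R hR r hr hri => by
  have := (h R hR r hr hri).const_mul hc
  simpa only [mul_left_comm] using this

omit [IsProbabilityMeasure Q] in
-- Bounded functions that pair nonnegatively with C are admissible directions at every point of the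
-- conjugate cone; they are the variations used in the dual step.
lemma PairNonneg.add_bounded {C : Set (ProbabilityMeasure Ω)} {v w : Ω → ℝ}
    (h : PairNonneg Q C v) (hv : Measurable v) (hw : Measurable w) {B : ℝ}
    (hB : ∀ ω, |w ω| ≤ B)
    (h0 : ∀ R ∈ C, ∀ r : Ω → ℝ, HasDens Q (R : Measure Ω) r →
        Integrable (fun ω => r ω * Real.log (r ω)) Q → 0 ≤ ∫ ω, r ω * w ω ∂Q) :
    PairNonneg Q C (fun ω => v ω + w ω) := fun R hR r hr hri => by
  have := (h R hR r hr hri).add_integrable (hr.meas.mul hv).aemeasurable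
    (hr.integrable.mul_bdd hw.aestronglyMeasurable (ae_of_all _ hB)) (h0 R hR r hr hri)
  simpa only [mul_add] using this

end IProj

end

noncomputable section

namespace IProj

variable {Ω : Type*} [MeasurableSpace Ω]

variable {Q : Measure Ω} [IsProbabilityMeasure Q]

/-! ### A single step of the dual algorithm -/

omit [IsProbabilityMeasure Q] in
lemma integrable_fun_sub {f g : Ω → ℝ} (hf : Integrable f Q) (hg : Integrable g Q) :
    Integrable (fun ω => f ω - g ω) Q := hf.sub hg

omit [IsProbabilityMeasure Q] in
/-- First order optimality in a bounded direction. -/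
lemma integral_mul_nonneg_of_exp_min {e w : Ω → ℝ} (he : Integrable e Q) (he0 : ∀ᵐ ω ∂Q, 0 ≤ e ω)
    (hw : Measurable w) {B : ℝ} (hB : ∀ ω, |w ω| ≤ B)
    (hmin : ∀ δ : ℝ, 0 < δ → ∫ ω, e ω ∂Q ≤ ∫ ω, e ω * Real.exp (δ * w ω) ∂Q) :
    0 ≤ ∫ ω, e ω * w ω ∂Q := by
  set B' := max B 1
  have hB' : ∀ ω, |w ω| ≤ B' := fun ω => (hB ω).trans (le_max_left _ _)
  have hB1 : 1 ≤ B' := le_max_right _ _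
  have hew : Integrable (fun ω => e ω * w ω) Q :=
    he.mul_bdd hw.aestronglyMeasurable (ae_of_all _ hB)
  set Z := ∫ ω, e ω ∂Q
  have hZ : 0 ≤ Z := integral_nonneg_of_ae he0
  -- The condition δ B' ≤ 1 keeps the exponent in [-1, 1], where |e^u - 1 - u| ≤ u². Dividing by δ
  -- leaves an error of order δ.
  have key : ∀ δ : ℝ, 0 < δ → δ * B' ≤ 1 → -(δ * B' ^ 2 * Z) ≤ ∫ ω, e ω * w ω ∂Q := by
    intro δ hδ hδB
    have habs : ∀ ω, |δ * w ω| ≤ 1 := fun ω => by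
      rw [abs_mul, abs_of_pos hδ]
      exact (mul_le_mul_of_nonneg_left (hB' ω) hδ.le).trans hδB
    have h1 : ∫ ω, e ω * Real.exp (δ * w ω) ∂Q ≤
        ∫ ω, (e ω + δ * (e ω * w ω) + δ ^ 2 * B' ^ 2 * e ω) ∂Q := by
      refine integral_mono_ae ?_
        ((he.add (hew.const_mul δ)).add (he.const_mul (δ ^ 2 * B' ^ 2))) ?_
      · refine he.mul_bdd (c := Real.exp 1) (by fun_prop) (ae_of_all _ fun ω => ?_)
        rw [Real.norm_eq_abs, Real.abs_exp]
        exact Real.exp_le_exp.2 ((le_abs_self _).trans (habs ω))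
      · filter_upwards [he0] with ω hω
        have h2 := (abs_le.1 (Real.abs_exp_sub_one_sub_id_le (habs ω))).2
        have h3 : (δ * w ω) ^ 2 ≤ δ ^ 2 * B' ^ 2 := by
          rw [mul_pow]
          have := sq_le_sq' (neg_le_of_abs_le (hB' ω)) (le_of_abs_le (hB' ω))
          gcongr
        have h4 : Real.exp (δ * w ω) ≤ 1 + δ * w ω + δ ^ 2 * B' ^ 2 := by linarith
        calc e ω * Real.exp (δ * w ω) ≤ e ω * (1 + δ * w ω + δ ^ 2 * B' ^ 2) := by gcongr
          _ = _ := by ring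
    have h1' := (hmin δ hδ).trans h1
    rw [integral_add (he.fun_add (hew.const_mul δ)) (he.const_mul _),
      integral_add he (hew.const_mul δ), integral_const_mul, integral_const_mul] at h1'
    have h5 : 0 ≤ δ * (∫ ω, e ω * w ω ∂Q + δ * B' ^ 2 * Z) := by
      have : δ * (∫ ω, e ω * w ω ∂Q + δ * B' ^ 2 * Z) =
        δ * ∫ ω, e ω * w ω ∂Q + δ ^ 2 * B' ^ 2 * Z := by ring
      linarith
    have := nonneg_of_mul_nonneg_right h5 hδ
    linarith
  have hlim : Tendsto (fun δ : ℝ => -(δ * B' ^ 2 * Z)) (𝓝[>] 0) (𝓝 0) := by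
    have : Continuous fun δ : ℝ => -(δ * B' ^ 2 * Z) := by fun_prop
    have h := this.tendsto 0
    simp only [zero_mul, neg_zero] at h
    exact h.mono_left nhdsWithin_le_nhds
  refine le_of_tendsto hlim ?_
  have h6 : Set.Ioo (0 : ℝ) (1 / B') ∈ 𝓝[>] (0 : ℝ) := Ioo_mem_nhdsGT (by positivity)
  filter_upwards [h6] with δ hδ
  exact key δ hδ.1 ((lt_div_iff₀ (by linarith)).1 hδ.2).le

omit [IsProbabilityMeasure Q] in
/-- First order optimality in the radial direction. -/
lemma integral_mul_nonpos_of_exp_min {s v : Ω → ℝ} (hs : Integrable s Q)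
    (hs0 : ∀ᵐ ω ∂Q, 0 < s ω) (hsm : Measurable s) (hv : Measurable v)
    (he : Integrable (fun ω => Real.exp (v ω) * s ω) Q)
    (hmin : ∀ δ : ℝ, 0 < δ → δ ≤ 1 →
      ∫ ω, Real.exp (v ω) * s ω ∂Q ≤ ∫ ω, Real.exp ((1 - δ) * v ω) * s ω ∂Q) :
    Integrable (fun ω => Real.exp (v ω) * s ω * v ω) Q ∧
      ∫ ω, Real.exp (v ω) * s ω * v ω ∂Q ≤ 0 := by
  set J := ∫ ω, s ω ∂Q - ∫ ω, Real.exp (v ω) * s ω ∂Q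
  let δ : ℕ → ℝ := fun n => 1 / ((n : ℝ) + 1)
  have hδ0 : ∀ n, 0 < δ n := fun n => Nat.one_div_pos_of_nat
  have hδ1 : ∀ n, δ n ≤ 1 := fun n => by
    have : (1 : ℝ) ≤ (n : ℝ) + 1 := by have := n.cast_nonneg (α := ℝ); linarith
    exact (div_le_one (by linarith)).2 this
  have hconv : ∀ (n : ℕ) (ω : Ω), Real.exp ((1 - δ n) * v ω) ≤ (1 - δ n) * Real.exp (v ω) + δ n := by
    intro n ω
    have h := convexOn_exp.2 (Set.mem_univ (v ω)) (Set.mem_univ 0) (sub_nonneg.2 (hδ1 n))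
      (hδ0 n).le (by ring)
    simpa using h
  have hei : ∀ n, Integrable (fun ω => Real.exp ((1 - δ n) * v ω) * s ω) Q := by
    intro n
    refine Integrable.mono' ((he.const_mul (1 - δ n)).add (hs.const_mul (δ n))) (by fun_prop) ?_
    filter_upwards [hs0] with ω hω
    rw [Real.norm_eq_abs, abs_of_nonneg (by positivity)]
    have := mul_le_mul_of_nonneg_right (hconv n ω) hω.le
    simp only [Pi.add_apply]
    linarith
  -- The difference quotient of τ ↦ e^(τ v) s at τ = 1, minus the secant over [0, 1]. Convexity
  -- makes it nonnegative, so Fatou's lemma applies without knowing beforehand that e^v s v is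
  -- integrable. Its limit is b.
  let a : ℕ → Ω → ℝ := fun n ω =>
    (Real.exp (v ω) * s ω - Real.exp ((1 - δ n) * v ω) * s ω) / δ n -
      (Real.exp (v ω) * s ω - s ω)
  let b : Ω → ℝ := fun ω => Real.exp (v ω) * s ω * v ω - (Real.exp (v ω) * s ω - s ω)
  have ham : ∀ n, Measurable (a n) := fun n => by fun_prop
  have hbm : Measurable b := by fun_prop
  have ha0 : ∀ n, ∀ᵐ ω ∂Q, 0 ≤ a n ω := by
    intro n
    filter_upwards [hs0] with ω hω
    have h1 := mul_le_mul_of_nonneg_right (hconv n ω) hω.le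
    have h2 : Real.exp (v ω) * s ω - s ω ≤
        (Real.exp (v ω) * s ω - Real.exp ((1 - δ n) * v ω) * s ω) / δ n := by
      rw [le_div_iff₀ (hδ0 n)]
      linarith
    simp only [a]
    linarith
  have hai : ∀ n, Integrable (a n) Q := fun n =>
    ((he.sub (hei n)).div_const _).sub (he.sub hs)
  have haJ : ∀ n, ∫⁻ ω, ENNReal.ofReal (a n ω) ∂Q ≤ ENNReal.ofReal J := by
    intro n
    rw [← ofReal_integral_eq_lintegral_ofReal (hai n) (ha0 n)]
    refine ENNReal.ofReal_le_ofReal ?_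
    have h1 : ∫ ω, a n ω ∂Q = (∫ ω, Real.exp (v ω) * s ω ∂Q -
        ∫ ω, Real.exp ((1 - δ n) * v ω) * s ω ∂Q) / δ n + J := by
      simp only [a]
      rw [integral_sub ((integrable_fun_sub he (hei n)).div_const _) (integrable_fun_sub he hs), integral_div,
        integral_sub he (hei n), integral_sub he hs]
      ring
    have h2 : (∫ ω, Real.exp (v ω) * s ω ∂Q -
        ∫ ω, Real.exp ((1 - δ n) * v ω) * s ω ∂Q) / δ n ≤ 0 :=
      div_nonpos_of_nonpos_of_nonneg (by linarith [hmin (δ n) (hδ0 n) (hδ1 n)]) (hδ0 n).le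
    linarith
  have hlim : ∀ ω, Tendsto (fun n => a n ω) atTop (𝓝 (b ω)) := by
    intro ω
    have hδ : Tendsto δ atTop (𝓝[≠] 0) := by
      refine tendsto_nhdsWithin_iff.2 ⟨tendsto_one_div_add_atTop_nhds_zero_nat, ?_⟩
      exact Eventually.of_forall fun n => (hδ0 n).ne'
    have hder : HasDerivAt (fun x : ℝ => Real.exp ((1 - x) * v ω)) (-(v ω) * Real.exp (v ω)) 0 := by
      have h1 : HasDerivAt (fun x : ℝ => (1 - x) * v ω) (-(v ω)) 0 := by
        simpa using ((hasDerivAt_id (0 : ℝ)).const_sub 1).mul_const (v ω)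
      have h2 := h1.exp
      simpa [mul_comm] using h2
    have h3 := (hasDerivAt_iff_tendsto_slope.1 hder).comp hδ
    have h4 : Tendsto (fun n => -(slope (fun x : ℝ => Real.exp ((1 - x) * v ω)) 0 (δ n)) * s ω -
        (Real.exp (v ω) * s ω - s ω)) atTop (𝓝 (-(-(v ω) * Real.exp (v ω)) * s ω -
        (Real.exp (v ω) * s ω - s ω))) := (h3.neg.mul_const _).sub_const _
    have h5 : b ω = -(-(v ω) * Real.exp (v ω)) * s ω - (Real.exp (v ω) * s ω - s ω) := by
      simp only [b]; ring
    rw [h5]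
    refine h4.congr fun n => ?_
    simp only [a, slope_def_field, sub_zero, one_mul]
    have := (hδ0 n).ne'
    field_simp
    ring
  have hb0 : ∀ᵐ ω ∂Q, 0 ≤ b ω := by
    filter_upwards [ae_all_iff.2 ha0] with ω hω
    exact ge_of_tendsto' (hlim ω) hω
  have hbJ : ∫⁻ ω, ENNReal.ofReal (b ω) ∂Q ≤ ENNReal.ofReal J := by
    have h1 : ∀ ω, ENNReal.ofReal (b ω) = liminf (fun n => ENNReal.ofReal (a n ω)) atTop := fun ω =>
      (ENNReal.tendsto_ofReal (hlim ω)).liminf_eq.symm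
    simp only [h1]
    refine (lintegral_liminf_le fun n => (ham n).ennreal_ofReal).trans ?_
    refine liminf_le_of_le (by isBoundedDefault) fun c hc => ?_
    obtain ⟨n, hn⟩ := hc.exists
    exact hn.trans (haJ n)
  have hbi : Integrable b Q := by
    refine ⟨hbm.aestronglyMeasurable, ?_⟩
    rw [hasFiniteIntegral_iff_ofReal hb0]
    exact hbJ.trans_lt ENNReal.ofReal_lt_top
  have hJ0 : 0 ≤ J := by
    have h := hmin 1 one_pos le_rfl
    simp only [sub_self, zero_mul, Real.exp_zero, one_mul] at h
    simp only [J]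
    linarith
  have hbI : ∫ ω, b ω ∂Q ≤ J := by
    rw [integral_eq_lintegral_of_nonneg_ae hb0 hbm.aestronglyMeasurable]
    exact ENNReal.toReal_le_of_le_ofReal hJ0 hbJ
  have hfun : (fun ω => Real.exp (v ω) * s ω * v ω) =
      fun ω => b ω + (Real.exp (v ω) * s ω - s ω) := by
    ext ω; simp only [b]; ring
  rw [hfun]
  refine ⟨hbi.add (he.sub hs), ?_⟩
  rw [integral_add hbi (integrable_fun_sub he hs), integral_sub he hs]
  simp only [J] at hbI
  linarith

/-- If `v` minimizes `∫ e ^ v dS` over the conjugate cone of `C` and `P` is the I-projection of `S`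
onto `C`, then `dP/dS = e ^ (v + c)` with `c = I(P|S)`. -/
lemma eq_exp_mul_of_isIProjection {C : Set (ProbabilityMeasure Ω)} (hC : ConvexPM C)
    (hcl : VariationClosed C) {S : Measure Ω} [IsFiniteMeasure S] {s : Ω → ℝ}
    (hs : HasDens Q S s) (hs0 : ∀ᵐ ω ∂Q, 0 < s ω) {P : ProbabilityMeasure Ω} {p : Ω → ℝ}
    (hP : IsIProjection S C P) (hp : HasDens Q (P : Measure Ω) p)
    (hpe : Integrable (fun ω => p ω * Real.log (p ω)) Q) {v : Ω → ℝ} (hv : Measurable v)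
    (hvC : PairNonneg Q C v)
    (hmin : ∀ w : Ω → ℝ, Measurable w → PairNonneg Q C w →
      ∫⁻ ω, ENNReal.ofReal (Real.exp (v ω) * s ω) ∂Q ≤
        ∫⁻ ω, ENNReal.ofReal (Real.exp (w ω) * s ω) ∂Q) :
    ∃ c : ℝ, iDiv P S = c ∧ (p =ᵐ[Q] fun ω => Real.exp (v ω + c) * s ω) ∧
      Integrable (fun ω => p ω * v ω) Q ∧ ∫ ω, p ω * v ω ∂Q = 0 := by
  have hsm := hs.meas
  have hsi : Integrable s Q := hs.integrable
  have hpos : ∀ w : Ω → ℝ, ∀ᵐ ω ∂Q, 0 ≤ Real.exp (w ω) * s ω := fun w => by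
    filter_upwards [hs0] with ω hω
    positivity
  have hint : ∀ w : Ω → ℝ, Measurable w →
      (Integrable (fun ω => Real.exp (w ω) * s ω) Q ↔
        ∫⁻ ω, ENNReal.ofReal (Real.exp (w ω) * s ω) ∂Q < ⊤) := by
    intro w hw
    have hm : AEStronglyMeasurable (fun ω => Real.exp (w ω) * s ω) Q := by fun_prop
    rw [← hasFiniteIntegral_iff_ofReal (hpos w)]
    exact ⟨fun h => h.2, fun h => ⟨hm, h⟩⟩
  set e : Ω → ℝ := fun ω => Real.exp (v ω) * s ω with he_def
  have hem : Measurable e := by fun_prop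
  have he : Integrable e Q := by
    refine (hint v hv).2 ((hmin _ measurable_const PairNonneg.zero).trans_lt ?_)
    simpa using hsi.lintegral_lt_top
  have hmin' : ∀ w : Ω → ℝ, Measurable w → PairNonneg Q C w →
      Integrable (fun ω => Real.exp (w ω) * s ω) Q →
      ∫ ω, e ω ∂Q ≤ ∫ ω, Real.exp (w ω) * s ω ∂Q := by
    intro w hw hwC hwi
    rw [integral_eq_lintegral_of_nonneg_ae (hpos v) he.aestronglyMeasurable,
      integral_eq_lintegral_of_nonneg_ae (hpos w) hwi.aestronglyMeasurable]
    exact ENNReal.toReal_mono ((hint w hw).1 hwi).ne (hmin w hw hwC)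
  have he0 : ∀ᵐ ω ∂Q, 0 < e ω := by
    filter_upwards [hs0] with ω hω
    positivity
  set Z := ∫ ω, e ω ∂Q with hZ_def
  have hZ : 0 < Z := by
    refine (integral_pos_iff_support_of_nonneg_ae (hpos v) he).2 ?_
    have : Q (Function.support e) = 1 := by
      rw [prob_compl_eq_zero_iff₀ (measurableSet_support hem).nullMeasurableSet |>.symm]
      have h2 : ∀ᵐ ω ∂Q, ω ∈ Function.support e := he0.mono fun ω h => h.ne'
      exact h2
    rw [this]
    exact one_pos
  -- the normalized exponential lies in `C`
  have h1min : ∀ w : Ω → ℝ, Measurable w → (∃ B, ∀ ω, |w ω| ≤ B) →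
      (∀ R ∈ C, ∀ r : Ω → ℝ, HasDens Q (R : Measure Ω) r →
        Integrable (fun ω => r ω * Real.log (r ω)) Q → 0 ≤ ∫ ω, r ω * w ω ∂Q) →
      0 ≤ ∫ ω, e ω * w ω ∂Q := by
    rintro w hw ⟨B, hB⟩ hwC
    refine integral_mul_nonneg_of_exp_min he (hpos v) hw hB fun δ hδ => ?_
    have hfun : (fun ω => e ω * Real.exp (δ * w ω)) =
        fun ω => Real.exp (v ω + δ * w ω) * s ω := by
      ext ω; rw [Real.exp_add]; simp only [e]; ring
    rw [hfun]
    have hB' : ∀ ω, |δ * w ω| ≤ δ * B := fun ω => by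
      rw [abs_mul, abs_of_pos hδ]
      exact mul_le_mul_of_nonneg_left (hB ω) hδ.le
    refine hmin' _ (by fun_prop) (hvC.add_bounded hv (hw.const_mul δ) hB' ?_) ?_
    · intro R hR r hr hri
      simp only [mul_left_comm _ δ]
      rw [integral_const_mul]
      exact mul_nonneg hδ.le (hwC R hR r hr hri)
    · rw [← hfun]
      refine he.mul_bdd (c := Real.exp (δ * B)) (by fun_prop) (ae_of_all _ fun ω => ?_)
      rw [Real.norm_eq_abs, Real.abs_exp]
      exact Real.exp_le_exp.2 ((le_abs_self _).trans (hB' ω))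
  obtain ⟨P', hP'⟩ := exists_hasDens (Q := Q) (p := fun ω => max (e ω) 0 / Z)
    (by fun_prop) (fun ω => by positivity)
    ((he.pos_part).div_const Z) (by
      rw [integral_div]
      have : ∫ ω, max (e ω) 0 ∂Q = Z := integral_congr_ae ((hpos v).mono fun ω hω => max_eq_left hω)
      rw [this, div_self hZ.ne'])
  have hp'e : (fun ω => max (e ω) 0 / Z) =ᵐ[Q] fun ω => e ω / Z :=
    he0.mono fun ω hω => by simp only [max_eq_left hω.le]
  have hP'C : P' ∈ C := by
    refine mem_of_forall_bounded hC hcl hP' fun w hw hwB hwC => ?_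
    have h := h1min w hw hwB hwC
    have h2 : ∫ ω, max (e ω) 0 / Z * w ω ∂Q = (∫ ω, e ω * w ω ∂Q) / Z := by
      rw [← integral_div]
      refine integral_congr_ae ?_
      filter_upwards [hp'e] with ω hω
      rw [hω]; ring
    rw [h2]
    positivity
  -- the radial direction
  obtain ⟨hev, hev0⟩ := integral_mul_nonpos_of_exp_min hsi hs0 hsm hv he (fun δ hδ hδ1 => by
    refine hmin' _ (by fun_prop) (hvC.const_mul (sub_nonneg.2 hδ1)) ?_
    refine Integrable.mono' ((he.const_mul (1 - δ)).add (hsi.const_mul δ)) (by fun_prop) ?_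
    filter_upwards [hs0] with ω hω
    rw [Real.norm_eq_abs, abs_of_nonneg (by positivity)]
    have h := convexOn_exp.2 (Set.mem_univ (v ω)) (Set.mem_univ 0) (sub_nonneg.2 hδ1) hδ.le
      (by ring)
    simp only [smul_eq_mul, mul_zero, add_zero, Real.exp_zero, mul_one] at h
    have := mul_le_mul_of_nonneg_right h hω.le
    simp only [Pi.add_apply, e]
    linarith)
  -- the divergence of the normalized exponential
  have hlogp' : (fun ω => max (e ω) 0 / Z * (Real.log (max (e ω) 0 / Z) - Real.log (s ω))) =ᵐ[Q]
      fun ω => (Real.exp (v ω) * s ω * v ω - Real.log Z * e ω) / Z := by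
    filter_upwards [hp'e, hs0, he0] with ω h1 h2 h3
    rw [h1, Real.log_div h3.ne' hZ.ne', show Real.log (e ω) = v ω + Real.log (s ω) by
      simp only [e]; rw [Real.log_mul (Real.exp_pos _).ne' h2.ne', Real.log_exp]]
    simp only [e]
    ring
  have hlogi : Integrable (fun ω => (Real.exp (v ω) * s ω * v ω - Real.log Z * e ω) / Z) Q :=
    (hev.sub (he.const_mul _)).div_const Z
  -- The divergence equals (∫ e v dQ)/Z - ln Z, and the radial inequality makes the first term
  -- nonpositive.
  have hdiv' : iDiv P' S ≤ ((-Real.log Z : ℝ) : EReal) := by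
    rw [hP'.iDiv_eq hs hs0 ((integrable_congr hlogp').2 hlogi), integral_congr_ae hlogp',
      integral_div, integral_sub hev (he.const_mul _), integral_const_mul, EReal.coe_le_coe_iff,
      div_le_iff₀ hZ]
    simp only [← hZ_def]
    linarith
  -- weak duality
  have hpl := (hp.iDiv_lt_top_iff hs hs0).1 hP.2.1
  have hdiv := hp.iDiv_eq hs hs0 hpl
  set c := ∫ ω, p ω * (Real.log (p ω) - Real.log (s ω)) ∂Q with hc_def
  have hcZ : c ≤ -Real.log Z := by
    have := (hP.2.2 P' hP'C).trans hdiv'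
    rwa [hdiv, EReal.coe_le_coe_iff] at this
  have hkl : ∀ (d : ℝ), ∀ᵐ ω ∂Q, kl (p ω) (Real.exp (v ω + d) * s ω) =
      p ω * (Real.log (p ω) - Real.log (s ω)) - p ω * v ω - d * p ω - p ω +
        Real.exp d * e ω := by
    intro d
    filter_upwards [hs0] with ω hω
    rw [kl, Real.log_mul (Real.exp_pos _).ne' hω.ne', Real.log_exp, Real.exp_add]
    simp only [e]
    ring
  have hkl0 : ∀ (d : ℝ), ∀ᵐ ω ∂Q, 0 ≤ kl (p ω) (Real.exp (v ω + d) * s ω) := by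
    intro d
    filter_upwards [hs0] with ω hω
    exact kl_nonneg (hp.nonneg ω) (by positivity)
  have hpi : Integrable p Q := hp.integrable
  have hpvN := hvC P hP.1 p hp hpe
  -- The negative part of p v is integrable by membership in the conjugate cone. The upper bound
  -- needed is Young's inequality, that is `kl` ≥ 0 with d = 0.
  have hpv : Integrable (fun ω => p ω * v ω) Q := by
    refine hpvN.integrable_of_le (hp.meas.mul hv).aemeasurable ((hpl.sub hpi).add he) ?_
    filter_upwards [hkl 0, hkl0 0] with ω h1 h2
    simp only [Pi.add_apply, Pi.sub_apply]
    rw [h1, Real.exp_zero] at h2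
    linarith
  have hpv0 : 0 ≤ ∫ ω, p ω * v ω ∂Q := hpvN.integral_nonneg hpv
  have hA : Integrable (fun ω => p ω * (Real.log (p ω) - Real.log (s ω)) - p ω * v ω) Q :=
    hpl.sub hpv
  have hB : Integrable (fun ω => p ω * (Real.log (p ω) - Real.log (s ω)) - p ω * v ω - c * p ω) Q :=
    hA.sub (hpi.const_mul c)
  have hD : Integrable (fun ω =>
      p ω * (Real.log (p ω) - Real.log (s ω)) - p ω * v ω - c * p ω - p ω) Q := hB.sub hpi
  have hE : Integrable (fun ω => p ω * (Real.log (p ω) - Real.log (s ω)) - p ω * v ω - c * p ω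
      - p ω + Real.exp c * e ω) Q := hD.add (he.const_mul _)
  have hI : ∫ ω, kl (p ω) (Real.exp (v ω + c) * s ω) ∂Q =
      - ∫ ω, p ω * v ω ∂Q - 1 + Real.exp c * Z := by
    rw [integral_congr_ae (hkl c), integral_add hD (he.const_mul _), integral_sub hB hpi,
      integral_sub hA (hpi.const_mul c), integral_sub hpl hpv, integral_const_mul,
      integral_const_mul, hp.integral_eq_one, ← hc_def]
    ring
  have hcZ' : Real.exp c * Z ≤ 1 := by
    have h : Real.exp c ≤ Z⁻¹ := by
      have := Real.exp_le_exp.2 hcZ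
      rwa [Real.exp_neg, Real.exp_log hZ] at this
    calc Real.exp c * Z ≤ Z⁻¹ * Z := by gcongr
      _ = 1 := inv_mul_cancel₀ hZ.ne'
  have hI0 : 0 ≤ ∫ ω, kl (p ω) (Real.exp (v ω + c) * s ω) ∂Q := integral_nonneg_of_ae (hkl0 c)
  -- In `hI` one has -∫ p v ≤ 0 and e^c Z ≤ 1, so a nonnegative integral is at most zero. This
  -- forces p = e^(v + c) s, and also ∫ p v = 0.
  have hI1 : ∫ ω, kl (p ω) (Real.exp (v ω + c) * s ω) ∂Q = 0 := by linarith
  have hzero := (integral_eq_zero_iff_of_nonneg_ae (hkl0 c) (hE.congr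
    ((hkl c).mono fun ω h => h.symm))).1 hI1
  refine ⟨c, hdiv, ?_, hpv, by linarith⟩
  filter_upwards [hzero, hs0] with ω h1 h2
  exact eq_of_kl_nonpos (hp.nonneg ω) (by positivity) h1.le

end IProj

end

noncomputable section

namespace IProj

variable {Ω : Type*} [MeasurableSpace Ω]

variable {Q : Measure Ω} [IsProbabilityMeasure Q] {t : ℕ} {C : Fin t → Set (ProbabilityMeasure Ω)}
  {P : ℕ → Fin t → ProbabilityMeasure Ω} {S : ℕ → Fin t → Measure Ω}
  {y : ℕ → Fin t → Ω → EReal}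

/-! ### The relation between the primal and the dual algorithm -/

lemma ereal_coe_sum {ι : Type*} (s : Finset ι) (f : ι → ℝ) :
    ∑ j ∈ s, ((f j : ℝ) : EReal) = ((∑ j ∈ s, f j : ℝ) : EReal) := by
  classical
  induction s using Finset.induction_on with
  | empty => simp
  | insert a s ha ih => rw [Finset.sum_insert ha, Finset.sum_insert ha, ih, EReal.coe_add]

/-- The density of the `i`-th primal iterate of cycle `n`. -/
def primalDens (Q : Measure Ω) (P : ℕ → Fin t → ProbabilityMeasure Ω) (n : ℕ) (i : Fin t)
    (ω : Ω) : ℝ := ((P n i : Measure Ω).rnDeriv Q ω).toReal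

/-- The real valued version of the dual iterates. -/
def dualPot (y : ℕ → Fin t → Ω → EReal) (n : ℕ) (i : Fin t) (ω : Ω) : ℝ := (y n i ω).toReal

/-- The divergence of the projection step `(n, i)`. -/
def stepDiv (P : ℕ → Fin t → ProbabilityMeasure Ω) (S : ℕ → Fin t → Measure Ω) (n : ℕ)
    (i : Fin t) : ℝ := (iDiv (P n i : Measure Ω) (S n i)).toReal

/-- The logarithm of `dP_{n,i}/dS_{n,i}` expressed through the dual iterate. -/
def stepPot (P : ℕ → Fin t → ProbabilityMeasure Ω) (S : ℕ → Fin t → Measure Ω)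
    (y : ℕ → Fin t → Ω → EReal) (n : ℕ) (i : Fin t) (ω : Ω) : ℝ :=
  dualPot y n i ω + stepDiv P S n i

/-- The facts about step `(n, i)` that tie the primal to the dual algorithm. -/
structure StepLink (Q : Measure Ω) (P : ℕ → Fin t → ProbabilityMeasure Ω)
    (S : ℕ → Fin t → Measure Ω) (y : ℕ → Fin t → Ω → EReal) (n : ℕ) (i : Fin t) : Prop where
  dens : HasDens Q (P n i : Measure Ω) (primalDens Q P n i)
  adjusted : ∃ s : Ω → ℝ, HasDens Q (S n i) s ∧ (∀ ω, 0 < s ω) ∧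
    primalDens Q P n i =ᵐ[Q] fun ω => Real.exp (stepPot P S y n i ω) * s ω
  div : iDiv (P n i : Measure Ω) (S n i) = (stepDiv P S n i : EReal)
  int_mul : Integrable (fun ω => primalDens Q P n i ω * dualPot y n i ω) Q
  integral_mul : ∫ ω, primalDens Q P n i ω * dualPot y n i ω ∂Q = 0
  entropy : Integrable (fun ω => primalDens Q P n i ω * Real.log (primalDens Q P n i ω)) Q

/-- The standing assumptions on a pair of a primal and a dual run. -/
structure IsRunPair (Q : Measure Ω) [IsProbabilityMeasure Q]
    (C : Fin t → Set (ProbabilityMeasure Ω)) (P : ℕ → Fin t → ProbabilityMeasure Ω)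
    (S : ℕ → Fin t → Measure Ω) (y : ℕ → Fin t → Ω → EReal) : Prop where
  closed : ∀ i, VariationClosed (C i)
  convex : ∀ i, ConvexPM (C i)
  primal : IsPrimalRun Q C P S
  dual : IsDualRun Q C y
  finite : ∀ n i, S n i Set.univ < ⊤
  logInt : ∀ n i, Integrable (fun ω => Real.log ((S n i).rnDeriv Q ω).toReal) (P n i : Measure Ω)
  potFinite : ∀ n i, ∀ᵐ ω ∂Q, y n i ω = ((dualPot y n i ω : ℝ) : EReal)

namespace IsRunPair

variable (h : IsRunPair Q C P S y)
include h

lemma measurable_pot (n : ℕ) (i : Fin t) : Measurable (dualPot y n i) := by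
  refine Measurable.ereal_toReal ?_
  cases n with
  | zero =>
    rw [show y 0 i = fun _ => 0 from funext (h.dual.init i)]
    exact measurable_const
  | succ n => exact (h.dual.mem n i).1

lemma measurable_stepPot (n : ℕ) (i : Fin t) : Measurable (stepPot P S y n i) :=
  (h.measurable_pot n i).add_const _

lemma pairNonneg (n : ℕ) (i : Fin t) : PairNonneg Q (C i) (dualPot y n i) := by
  cases n with
  | zero =>
    have : dualPot y 0 i = fun _ => 0 := funext fun ω => by simp [dualPot, h.dual.init i ω]
    rw [this]
    exact PairNonneg.zero
  | succ n =>
    intro R hR r hr hri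
    refine (((mem_conjCone_iff fun x hx => mem_densCone_iff hx).1 (h.dual.mem n i)).2
      R hR r hr hri).congr ?_
    filter_upwards [h.potFinite (n + 1) i] with ω hω
    rw [hω, EReal.coe_mul]

lemma stepDiv_zero (i : Fin t) : stepDiv P S 0 i = 0 := by
  rw [stepDiv, h.primal.initP, h.primal.initS, hasDens_self.iDiv_eq hasDens_self
    (ae_of_all _ fun _ => one_pos) (by simp)]
  simp

lemma stepPot_zero (i : Fin t) (ω : Ω) : stepPot P S y 0 i ω = 0 := by
  rw [stepPot, h.stepDiv_zero, dualPot, h.dual.init]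
  simp

lemma primalDens_zero (i : Fin t) : primalDens Q P 0 i =ᵐ[Q] fun _ => 1 := by
  unfold primalDens
  rw [h.primal.initP]
  filter_upwards [Measure.rnDeriv_self Q] with ω hω
  simp [hω]

lemma stepLink_zero (i : Fin t) : StepLink Q P S y 0 i := by
  have hd : HasDens Q (P 0 i : Measure Ω) (primalDens Q P 0 i) :=
    HasDens.of_ac (by rw [h.primal.initP])
  have hp := h.primalDens_zero i
  have hv : ∀ ω, dualPot y 0 i ω = 0 := fun ω => by simp [dualPot, h.dual.init]
  refine ⟨hd, ⟨fun _ => 1, ?_, fun _ => one_pos, ?_⟩, ?_, ?_, ?_, ?_⟩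
  · rw [h.primal.initS]; exact hasDens_self
  · filter_upwards [hp] with ω hω
    rw [hω, h.stepPot_zero, Real.exp_zero, one_mul]
  · rw [h.stepDiv_zero, h.primal.initP, h.primal.initS, hasDens_self.iDiv_eq hasDens_self
      (ae_of_all _ fun _ => one_pos) (by simp)]
    simp
  · simp [hv]
  · simp [hv]
  · refine (integrable_const (0 : ℝ)).congr ?_
    filter_upwards [hp] with ω hω
    simp [hω]

/-- The value of the dual objective on real valued functions. -/
lemma dualObjective_eq (n : ℕ) (i : Fin t) {w : Ω → EReal} {w' : Ω → ℝ}
    (hw : ∀ᵐ ω ∂Q, w ω = (w' ω : EReal)) :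
    dualObjective Q y n i w = ∫⁻ ω, ENNReal.ofReal (Real.exp (w' ω + ∑ j : Fin t,
      if j < i then dualPot y (n + 1) j ω else if j = i then 0 else dualPot y n j ω)) ∂Q := by
  refine lintegral_congr_ae ?_
  filter_upwards [hw, ae_all_iff.2 (h.potFinite n), ae_all_iff.2 (h.potFinite (n + 1))]
    with ω h1 h2 h3
  have h4 : ∀ j : Fin t, (if j < i then y (n + 1) j ω else if j = i then w ω else y n j ω) =
      (((if j < i then dualPot y (n + 1) j ω else if j = i then 0 else dualPot y n j ω) +
        (if j = i then w' ω else 0) : ℝ) : EReal) := by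
    intro j
    rcases lt_trichotomy j i with hj | hj | hj
    · simp [hj, hj.ne, h3 j]
    · subst hj; simp [h1]
    · simp [hj.not_gt, hj.ne', h2 j]
  simp only [h4]
  rw [ereal_coe_sum, EReal.exp_coe, Finset.sum_add_distrib, add_comm]
  simp

/-- The adjustment divides by dP_{n,i}/dS_{n,i}, which is the exponential of the old potential of
index i, so S_{n+1,i} has the density e^G with index i left out. Up to the constant factor e^K this
is the weight in the dual objective. Both steps therefore refer to the same measure, and
`eq_exp_mul_of_isIProjection` applies. -/
lemma stepLink_succ (n : ℕ) (i : Fin t) {q : Ω → ℝ}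
    (hq : HasDens Q ((prevIterate P n i : ProbabilityMeasure Ω) : Measure Ω) q)
    (hqe : q =ᵐ[Q] fun ω => Real.exp (∑ j : Fin t,
      if j < i then stepPot P S y (n + 1) j ω else stepPot P S y n j ω))
    (hlink : StepLink Q P S y n i) :
    StepLink Q P S y (n + 1) i ∧ primalDens Q P (n + 1) i =ᵐ[Q] fun ω => Real.exp (∑ j : Fin t,
      if j ≤ i then stepPot P S y (n + 1) j ω else stepPot P S y n j ω) := by
  let G : Ω → ℝ := fun ω => ∑ j : Fin t,
    if j < i then stepPot P S y (n + 1) j ω else if j = i then 0 else stepPot P S y n j ω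
  let G' : Ω → ℝ := fun ω => ∑ j : Fin t,
    if j < i then dualPot y (n + 1) j ω else if j = i then 0 else dualPot y n j ω
  let K : ℝ := ∑ j : Fin t,
    if j < i then stepDiv P S (n + 1) j else if j = i then 0 else stepDiv P S n j
  have hGK : ∀ ω, G ω = G' ω + K := by
    intro ω
    simp only [G, G', K]
    rw [← Finset.sum_add_distrib]
    refine Finset.sum_congr rfl fun j _ => ?_
    split_ifs <;> simp [stepPot]
  have hGm : Measurable G := by
    refine Finset.measurable_fun_sum _ fun j _ => ?_
    split_ifs
    · exact h.measurable_stepPot _ _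
    · exact measurable_const
    · exact h.measurable_stepPot _ _
  have hGq : ∀ ω, (∑ j : Fin t,
      if j < i then stepPot P S y (n + 1) j ω else stepPot P S y n j ω) =
      G ω + stepPot P S y n i ω := by
    intro ω
    have h1 : stepPot P S y n i ω =
        ∑ j : Fin t, if j = i then stepPot P S y n j ω else 0 := by simp
    rw [h1]
    simp only [G]
    rw [← Finset.sum_add_distrib]
    refine Finset.sum_congr rfl fun j _ => ?_
    rcases lt_trichotomy j i with hj | hj | hj
    · simp [hj, hj.ne]
    · simp [hj]
    · simp [hj.not_gt, hj.ne']
  have hGp : ∀ ω, (∑ j : Fin t,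
      if j ≤ i then stepPot P S y (n + 1) j ω else stepPot P S y n j ω) =
      stepPot P S y (n + 1) i ω + G ω := by
    intro ω
    have h1 : stepPot P S y (n + 1) i ω =
        ∑ j : Fin t, if j = i then stepPot P S y (n + 1) j ω else 0 := by simp
    rw [h1]
    simp only [G]
    rw [← Finset.sum_add_distrib]
    refine Finset.sum_congr rfl fun j _ => ?_
    rcases lt_trichotomy j i with hj | hj | hj
    · simp [hj, hj.ne, hj.le]
    · simp [hj]
    · simp [hj.not_gt, hj.ne', hj.not_ge]
  -- the adjusted measure
  let s : Ω → ℝ := fun ω => Real.exp (G ω)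
  have hsS : HasDens Q (S (n + 1) i) s := by
    refine ⟨hGm.exp, fun ω => (Real.exp_pos _).le, ?_⟩
    rw [h.primal.adjust]
    refine withDensity_congr_ae ?_
    obtain ⟨s', hs', hs'0, hps'⟩ := hlink.adjusted
    have : IsFiniteMeasure (S n i) := ⟨h.finite n i⟩
    filter_upwards [hq.rnDeriv, hqe, hps', hlink.dens.llr_eq hs' (ae_of_all _ hs'0)
      (hlink.dens.ac_of_pos hs' (ae_of_all _ hs'0))] with ω h1 h2 h3 h4
    rw [h1, h4, h2, h3, mul_div_assoc, div_self (hs'0 ω).ne', mul_one,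
      ← ENNReal.ofReal_inv_of_pos (Real.exp_pos _), ← ENNReal.ofReal_mul (Real.exp_pos _).le,
      hGq, ← Real.exp_neg, ← Real.exp_add]
    congr 2
    ring
  have hs0 : ∀ ω, 0 < s ω := fun ω => Real.exp_pos _
  have : IsFiniteMeasure (S (n + 1) i) := ⟨h.finite (n + 1) i⟩
  have hproj := h.primal.project n i
  have hp : HasDens Q (P (n + 1) i : Measure Ω) (primalDens Q P (n + 1) i) :=
    HasDens.of_ac ((ac_of_iDiv_lt_top hproj.2.1).trans hsS.ac)
  -- Here p ln p = p (ln p - ln s) + p ln s; the first term is integrable because the divergence is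
  -- finite, the second by (B).
  have hpe : Integrable
      (fun ω => primalDens Q P (n + 1) i ω * Real.log (primalDens Q P (n + 1) i ω)) Q := by
    have h1 := (hp.iDiv_lt_top_iff hsS (ae_of_all _ hs0)).1 hproj.2.1
    have h2 := hp.integrable_iff.1 (h.logInt (n + 1) i)
    refine (h1.add h2).congr ?_
    filter_upwards [hsS.toReal_rnDeriv] with ω hω
    simp only [Pi.add_apply, hω]
    ring
  obtain ⟨c, hc, hpeq, hint, hint0⟩ := eq_exp_mul_of_isIProjection (h.convex i) (h.closed i) hsS
    (ae_of_all _ hs0) hproj hp hpe (h.measurable_pot (n + 1) i) (h.pairNonneg (n + 1) i) (by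
      intro w hw hwC
      have h1 := h.dual.min n i (fun ω => (w ω : EReal))
        ((coe_mem_conjCone_iff (fun x hx => mem_densCone_iff hx) hw).2 hwC)
      rw [h.dualObjective_eq n i (h.potFinite (n + 1) i),
        h.dualObjective_eq n i (ae_of_all _ fun ω => rfl)] at h1
      have h2 : ∀ u : Ω → ℝ, ∫⁻ ω, ENNReal.ofReal (Real.exp (u ω) * s ω) ∂Q =
          ENNReal.ofReal (Real.exp K) *
            ∫⁻ ω, ENNReal.ofReal (Real.exp (u ω + G' ω)) ∂Q := by
        intro u
        rw [← lintegral_const_mul' _ _ ENNReal.ofReal_ne_top]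
        refine lintegral_congr fun ω => ?_
        rw [← ENNReal.ofReal_mul (Real.exp_pos _).le, ← Real.exp_add, ← Real.exp_add, hGK]
        congr 2
        ring
      rw [h2, h2]
      gcongr)
  have hcs : stepDiv P S (n + 1) i = c := by rw [stepDiv, hc, EReal.toReal_coe]
  refine ⟨⟨hp, ⟨s, hsS, hs0, ?_⟩, by rw [hcs, hc], hint, hint0, hpe⟩, ?_⟩
  · simpa only [stepPot, hcs] using hpeq
  · filter_upwards [hpeq] with ω hω
    rw [hω, hGp, stepPot, hcs, Real.exp_add _ (G ω)]

/-- An induction over cycles contains an induction over the indices of a cycle. The formula for the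
last iterate starts the next cycle; it is separate from the mixed formula because cycle 0 has no
predecessor. -/
lemma stepLink_and_last (n : ℕ) (ht : 0 < t) : (∀ i, StepLink Q P S y n i) ∧
    (primalDens Q P n ⟨t - 1, by omega⟩ =ᵐ[Q] fun ω =>
      Real.exp (∑ j : Fin t, stepPot P S y n j ω)) ∧
    (∀ m i, n = m + 1 → primalDens Q P n i =ᵐ[Q] fun ω => Real.exp (∑ j : Fin t,
      if j ≤ i then stepPot P S y (m + 1) j ω else stepPot P S y m j ω)) := by
  induction n with
  | zero =>
    refine ⟨h.stepLink_zero, ?_, fun m i hm => by omega⟩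
    filter_upwards [h.primalDens_zero ⟨t - 1, by omega⟩] with ω hω
    simp [hω, h.stepPot_zero]
  | succ n ih =>
    obtain ⟨ih1, ih2, -⟩ := ih
    have key : ∀ k (hk : k < t), StepLink Q P S y (n + 1) ⟨k, hk⟩ ∧
        primalDens Q P (n + 1) ⟨k, hk⟩ =ᵐ[Q] fun ω => Real.exp (∑ j : Fin t,
          if j ≤ ⟨k, hk⟩ then stepPot P S y (n + 1) j ω else stepPot P S y n j ω) := by
      intro k
      induction k with
      | zero =>
        intro hk
        refine h.stepLink_succ n ⟨0, hk⟩ (q := primalDens Q P n ⟨t - 1, by omega⟩) ?_ ?_ (ih1 _)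
        · simpa [prevIterate] using (ih1 ⟨t - 1, by omega⟩).dens
        · filter_upwards [ih2] with ω hω
          rw [hω]
          congr 1
      | succ k ihk =>
        intro hk
        obtain ⟨h1, h2⟩ := ihk (by omega)
        refine h.stepLink_succ n ⟨k + 1, hk⟩ (q := primalDens Q P (n + 1) ⟨k, by omega⟩) ?_ ?_
          (ih1 _)
        · simpa [prevIterate] using h1.dens
        · filter_upwards [h2] with ω hω
          rw [hω]
          congr 1
          refine Finset.sum_congr rfl fun j _ => ?_
          congr 1
          simp [Fin.lt_def, Fin.le_def]
    refine ⟨fun i => (key i.1 i.2).1, ?_, fun m i hm => ?_⟩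
    · filter_upwards [(key (t - 1) (by omega)).2] with ω hω
      rw [hω]
      congr 1
      refine Finset.sum_congr rfl fun j _ => ?_
      rw [if_pos]
      have := j.2
      simp only [Fin.le_def]
      omega
    · obtain rfl : n = m := by omega
      exact (key i.1 i.2).2

end IsRunPair

end IProj

end

noncomputable section

namespace IProj

variable {Ω : Type*} [MeasurableSpace Ω]

variable {Q : Measure Ω} [IsProbabilityMeasure Q]

/-! ### Divergence estimates along the run -/

omit [IsProbabilityMeasure Q] in
/-- If finitely many functions have well defined nonnegative integrals and their sum is bounded
above by an integrable function, then all of them are integrable. -/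
lemma integrable_of_sum_le {ι : Type*} [Fintype ι] {z : ι → Ω → ℝ} {b : Ω → ℝ}
    (hz : ∀ j, IntegralNonneg Q (fun ω => (z j ω : EReal))) (hm : ∀ j, Measurable (z j))
    (hb : Integrable b Q) (hzb : ∀ᵐ ω ∂Q, ∑ j, z j ω ≤ b ω) (j : ι) : Integrable (z j) Q := by
  classical
  have hneg : ∀ j, Integrable (fun ω => max (-z j ω) 0) Q := by
    intro j
    refine ⟨((hm j).neg.max measurable_const).aestronglyMeasurable, ?_⟩
    rw [hasFiniteIntegral_iff_ofReal (f := fun ω => max (-z j ω) 0)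
      (ae_of_all _ fun ω => le_max_right _ _)]
    refine lt_of_le_of_lt (le_of_eq ?_) (integralNonneg_coe_iff.1 (hz j)).1.lt_top
    refine lintegral_congr fun ω => ?_
    rcases le_total (-z j ω) 0 with h | h
    · rw [max_eq_right h, ENNReal.ofReal_of_nonpos h, ENNReal.ofReal_zero]
    · rw [max_eq_left h]
  refine (hz j).integrable_of_le (hm j).aemeasurable
    (hb.add (integrable_finsetSum Finset.univ fun k _ => hneg k)) ?_
  filter_upwards [hzb] with ω hω
  -- Each function is the full sum minus the others, so only the negative parts of the others enter
  -- its upper bound.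
  have h1 : z j ω = ∑ k, z k ω + ∑ k ∈ Finset.univ.erase j, -z k ω := by
    rw [Finset.sum_neg_distrib, ← Finset.add_sum_erase _ _ (Finset.mem_univ j)]
    ring
  have h2 : ∑ k ∈ Finset.univ.erase j, -z k ω ≤ ∑ k, max (-z k ω) 0 :=
    (Finset.sum_le_sum fun k _ => le_max_left _ _).trans
      (Finset.sum_le_sum_of_subset_of_nonneg (Finset.erase_subset _ _)
        fun k _ _ => le_max_right _ _)
  simp only [Pi.add_apply]
  linarith

omit [IsProbabilityMeasure Q] in
lemma integral_abs_sub_le_of_kl {p q : Ω → ℝ} (hp : Integrable p Q) (hq : Integrable q Q)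
    (hp0 : ∀ ω, 0 ≤ p ω) (hq0 : ∀ᵐ ω ∂Q, 0 < q ω) (hp1 : ∫ ω, p ω ∂Q = 1)
    (hq1 : ∫ ω, q ω ∂Q = 1) (hkl : Integrable (fun ω => kl (p ω) (q ω)) Q) {ε : ℝ} (hε : 0 < ε) :
    ∫ ω, |p ω - q ω| ∂Q ≤ (∫ ω, kl (p ω) (q ω) ∂Q) / ε + ε := by
  have h : ∫ ω, |p ω - q ω| ∂Q ≤ ∫ ω, (kl (p ω) (q ω) / ε + ε / 2 * (p ω + q ω)) ∂Q := by
    refine integral_mono_ae (hp.sub hq).abs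
      ((hkl.div_const ε).add ((hp.add hq).const_mul (ε / 2))) ?_
    filter_upwards [hq0] with ω hω
    have := abs_sub_le_kl (hp0 ω) hω hε
    linarith
  rw [integral_add (hkl.div_const ε) ((hp.fun_add hq).const_mul (ε / 2)), integral_div,
    integral_const_mul, integral_add hp hq, hp1, hq1] at h
  linarith

omit [IsProbabilityMeasure Q] in
/-- A qualitative Pinsker inequality. -/
lemma tendsto_integral_abs_sub_of_kl {p q : ℕ → Ω → ℝ} (hp : ∀ n, Integrable (p n) Q)
    (hq : ∀ n, Integrable (q n) Q) (hp0 : ∀ n ω, 0 ≤ p n ω) (hq0 : ∀ n, ∀ᵐ ω ∂Q, 0 < q n ω)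
    (hp1 : ∀ n, ∫ ω, p n ω ∂Q = 1) (hq1 : ∀ n, ∫ ω, q n ω ∂Q = 1)
    (hkl : ∀ n, Integrable (fun ω => kl (p n ω) (q n ω)) Q)
    (hlim : Tendsto (fun n => ∫ ω, kl (p n ω) (q n ω) ∂Q) atTop (𝓝 0)) :
    Tendsto (fun n => ∫ ω, |p n ω - q n ω| ∂Q) atTop (𝓝 0) := by
  have h0 : ∀ n, 0 ≤ ∫ ω, |p n ω - q n ω| ∂Q := fun n => integral_nonneg fun ω => abs_nonneg _
  rw [Metric.tendsto_atTop] at hlim ⊢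
  intro ε hε
  -- With weight ε/3 in the preceding lemma, an integral of `kl` below (ε/3)² contributes at most
  -- ε/3, as does the weight itself.
  obtain ⟨N, hN⟩ := hlim (ε / 3 * (ε / 3)) (by positivity)
  refine ⟨N, fun n hn => ?_⟩
  have h1 := integral_abs_sub_le_of_kl (hp n) (hq n) (hp0 n) (hq0 n) (hp1 n) (hq1 n) (hkl n)
    (show 0 < ε / 3 by positivity)
  have h2 := hN n hn
  rw [Real.dist_eq, sub_zero] at h2 ⊢
  have h3 : (∫ ω, kl (p n ω) (q n ω) ∂Q) / (ε / 3) ≤ ε / 3 := by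
    rw [div_le_iff₀ (by positivity)]
    exact (le_abs_self _).trans h2.le
  rw [abs_of_nonneg (h0 n)]
  linarith

variable {t : ℕ} {C : Fin t → Set (ProbabilityMeasure Ω)}
  {P : ℕ → Fin t → ProbabilityMeasure Ω} {S : ℕ → Fin t → Measure Ω}
  {y : ℕ → Fin t → Ω → EReal}

/-- The sum of the divergences of the `t` most recent projections after step `(n + 1, i)`. -/
def mixDiv (P : ℕ → Fin t → ProbabilityMeasure Ω) (S : ℕ → Fin t → Measure Ω) (n : ℕ)
    (i : Fin t) : ℝ := ∑ j : Fin t, if j ≤ i then stepDiv P S (n + 1) j else stepDiv P S n j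

namespace IsRunPair

variable (h : IsRunPair Q C P S y)
include h

lemma link (n : ℕ) (i : Fin t) : StepLink Q P S y n i :=
  (h.stepLink_and_last n (i.pos)).1 i

lemma primalDens_succ (n : ℕ) (i : Fin t) : primalDens Q P (n + 1) i =ᵐ[Q] fun ω =>
    Real.exp (∑ j : Fin t, if j ≤ i then stepPot P S y (n + 1) j ω else stepPot P S y n j ω) :=
  (h.stepLink_and_last (n + 1) (i.pos)).2.2 n i rfl

lemma primalDens_last (n : ℕ) (ht : 0 < t) : primalDens Q P n ⟨t - 1, by omega⟩ =ᵐ[Q] fun ω =>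
    Real.exp (∑ j : Fin t, stepPot P S y n j ω) :=
  (h.stepLink_and_last n ht).2.1

lemma primalDens_pos (n : ℕ) (i : Fin t) : ∀ᵐ ω ∂Q, 0 < primalDens Q P n i ω := by
  cases n with
  | zero => filter_upwards [h.primalDens_zero i] with ω hω; rw [hω]; exact one_pos
  | succ n => filter_upwards [h.primalDens_succ n i] with ω hω; rw [hω]; exact Real.exp_pos _

/-- The density of the iterate preceding step `(n + 1, i)`. -/
lemma prev (n : ℕ) (i : Fin t) : ∃ (m : ℕ) (k : Fin t),
    prevIterate (primalDens Q P) n i = primalDens Q P m k ∧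
    primalDens Q P m k =ᵐ[Q] fun ω => Real.exp (∑ j : Fin t,
      if j < i then stepPot P S y (n + 1) j ω else stepPot P S y n j ω) := by
  by_cases hi : i.1 = 0
  · refine ⟨n, ⟨t - 1, by have := i.2; omega⟩, by rw [prevIterate, if_pos hi], ?_⟩
    filter_upwards [h.primalDens_last n (i.pos)] with ω hω
    rw [hω]
    congr 1
    refine Finset.sum_congr rfl fun j _ => ?_
    rw [if_neg]
    simp [Fin.lt_def, hi]
  · refine ⟨n + 1, ⟨i.1 - 1, by have := i.2; omega⟩, by rw [prevIterate, if_neg hi], ?_⟩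
    filter_upwards [h.primalDens_succ n ⟨i.1 - 1, by have := i.2; omega⟩] with ω hω
    rw [hω]
    congr 1
    refine Finset.sum_congr rfl fun j _ => ?_
    have : j ≤ (⟨i.1 - 1, by have := i.2; omega⟩ : Fin t) ↔ j < i := by
      simp only [Fin.le_def, Fin.lt_def]
      omega
    simp only [this]

/-- The logarithms of the two iterates differ only in the potential of index i. Against P_{n+1,i}
the new v_i integrates to zero and the old one to something nonnegative, since P_{n+1,i} lies in
C_i; what remains is the difference of the constants. -/
lemma kl_prev (n : ℕ) (i : Fin t) :
    Integrable (fun ω => kl (primalDens Q P (n + 1) i ω)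
      (prevIterate (primalDens Q P) n i ω)) Q ∧
    ∫ ω, kl (primalDens Q P (n + 1) i ω) (prevIterate (primalDens Q P) n i ω) ∂Q ≤
      stepDiv P S (n + 1) i - stepDiv P S n i := by
  obtain ⟨m, k, hmk, hprev⟩ := h.prev n i
  rw [hmk]
  have hl := h.link (n + 1) i
  have hpI : Integrable (primalDens Q P (n + 1) i) Q := hl.dens.integrable
  have hqI : Integrable (primalDens Q P m k) Q := (h.link m k).dens.integrable
  set p := primalDens Q P (n + 1) i with hp_def
  set q := primalDens Q P m k
  set d := stepDiv P S (n + 1) i - stepDiv P S n i with hd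
  have hkl : ∀ᵐ ω ∂Q, kl (p ω) (q ω) =
      p ω * dualPot y (n + 1) i ω - p ω * dualPot y n i ω + d * p ω - p ω + q ω := by
    filter_upwards [h.primalDens_succ n i, hprev] with ω h1 h2
    rw [kl, show Real.log (p ω) = _ by rw [hp_def, h1, Real.log_exp],
      show Real.log (q ω) = _ by rw [h2, Real.log_exp], ← Finset.sum_sub_distrib]
    have h3 : ∑ j : Fin t,
        ((if j ≤ i then stepPot P S y (n + 1) j ω else stepPot P S y n j ω) -
          if j < i then stepPot P S y (n + 1) j ω else stepPot P S y n j ω) =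
        stepPot P S y (n + 1) i ω - stepPot P S y n i ω := by
      rw [Finset.sum_eq_single i]
      · simp
      · intro j _ hj
        rcases lt_or_gt_of_ne hj with h' | h'
        · simp [h', h'.le]
        · simp [h'.not_gt, h'.not_ge]
      · simp
    rw [h3]
    simp only [stepPot, hd]
    ring
  have hkl0 : ∀ᵐ ω ∂Q, 0 ≤ kl (p ω) (q ω) := by
    filter_upwards [h.primalDens_pos m k] with ω hω
    exact kl_nonneg (hl.dens.nonneg ω) hω
  have hN := h.pairNonneg n i _ (h.primal.project n i).1 p hl.dens hl.entropy
  have hpv : Integrable (fun ω => p ω * dualPot y n i ω) Q := by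
    refine hN.integrable_of_le (hl.dens.meas.mul (h.measurable_pot n i)).aemeasurable
      (((hl.int_mul.add (hpI.const_mul d)).sub hpI).add hqI) ?_
    filter_upwards [hkl, hkl0] with ω h1 h2
    simp only [Pi.add_apply, Pi.sub_apply]
    linarith
  have h0 := hN.integral_nonneg hpv
  have i1 := integrable_fun_sub hl.int_mul hpv
  have i2 := i1.fun_add (hpI.const_mul d)
  have i3 := integrable_fun_sub i2 hpI
  refine ⟨(i3.fun_add hqI).congr (hkl.mono fun ω h => h.symm), ?_⟩
  rw [integral_congr_ae hkl, integral_add i3 hqI, integral_sub i2 hpI,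
    integral_add i1 (hpI.const_mul d), integral_sub hl.int_mul hpv, hl.integral_mul,
    integral_const_mul, hl.dens.integral_eq_one, (h.link m k).dens.integral_eq_one]
  linarith

lemma stepDiv_mono (i : Fin t) : Monotone fun n => stepDiv P S n i := by
  refine monotone_nat_of_le_succ fun n => ?_
  obtain ⟨m, k, hmk, -⟩ := h.prev n i
  have h1 := (h.kl_prev n i).2
  have h2 : 0 ≤ ∫ ω, kl (primalDens Q P (n + 1) i ω) (prevIterate (primalDens Q P) n i ω) ∂Q := by
    rw [hmk]
    refine integral_nonneg_of_ae ?_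
    filter_upwards [h.primalDens_pos m k] with ω hω
    exact kl_nonneg ((h.link (n + 1) i).dens.nonneg ω) hω
  linarith

lemma stepDiv_nonneg (n : ℕ) (i : Fin t) : 0 ≤ stepDiv P S n i := by
  have := h.stepDiv_mono i (Nat.zero_le n)
  simpa [h.stepDiv_zero i] using this

/-- The divergence of a member of the intersection from the iterates. -/
lemma kl_iterate {R : ProbabilityMeasure Ω} (hR : R ∈ ⋂ i, C i) {r : Ω → ℝ}
    (hr : HasDens Q (R : Measure Ω) r) (hri : Integrable (fun ω => r ω * Real.log (r ω)) Q)
    (n : ℕ) (i : Fin t) :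
    Integrable (fun ω => kl (r ω) (primalDens Q P (n + 1) i ω)) Q ∧
    ∫ ω, kl (r ω) (primalDens Q P (n + 1) i ω) ∂Q ≤
      ∫ ω, r ω * Real.log (r ω) ∂Q - mixDiv P S n i := by
  have hpI : Integrable (primalDens Q P (n + 1) i) Q := (h.link (n + 1) i).dens.integrable
  have hrI : Integrable r Q := hr.integrable
  set p := primalDens Q P (n + 1) i with hp_def
  set K := mixDiv P S n i with hK
  let z : Fin t → Ω → ℝ := fun j ω =>
    r ω * if j ≤ i then dualPot y (n + 1) j ω else dualPot y n j ω
  have hzm : ∀ j, Measurable (z j) := by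
    intro j
    refine hr.meas.mul ?_
    split_ifs
    · exact h.measurable_pot _ _
    · exact h.measurable_pot _ _
  have hzN : ∀ j, IntegralNonneg Q (fun ω => (z j ω : EReal)) := by
    intro j
    simp only [z]
    by_cases hj : j ≤ i
    · simp only [hj, if_true]
      exact h.pairNonneg (n + 1) j R (Set.mem_iInter.1 hR j) r hr hri
    · simp only [hj, if_false]
      exact h.pairNonneg n j R (Set.mem_iInter.1 hR j) r hr hri
  -- The logarithm of the iterate splits into one potential per constraint set plus the constant
  -- `mixDiv`. As R lies in every C_j, each potential pairs nonnegatively with r.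
  have hkl : ∀ᵐ ω ∂Q, kl (r ω) (p ω) =
      r ω * Real.log (r ω) - ∑ j, z j ω - K * r ω - r ω + p ω := by
    filter_upwards [h.primalDens_succ n i] with ω h1
    rw [kl, show Real.log (p ω) = _ by rw [hp_def, h1, Real.log_exp]]
    have h2 : (∑ j : Fin t, if j ≤ i then stepPot P S y (n + 1) j ω else stepPot P S y n j ω) =
        (∑ j : Fin t, if j ≤ i then dualPot y (n + 1) j ω else dualPot y n j ω) + K := by
      rw [hK, mixDiv, ← Finset.sum_add_distrib]
      refine Finset.sum_congr rfl fun j _ => ?_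
      split_ifs <;> rfl
    rw [h2]
    simp only [z]
    rw [← Finset.mul_sum]
    ring
  have hkl0 : ∀ᵐ ω ∂Q, 0 ≤ kl (r ω) (p ω) := by
    filter_upwards [h.primalDens_pos (n + 1) i] with ω hω
    exact kl_nonneg (hr.nonneg ω) hω
  -- Nonnegativity of `kl` bounds the sum of the pairings from above; finiteness of all negative
  -- parts passes this on to each pairing.
  have hzi : ∀ j, Integrable (z j) Q := by
    refine integrable_of_sum_le hzN hzm (((hri.sub (hrI.const_mul K)).sub hrI).add hpI) ?_
    filter_upwards [hkl, hkl0] with ω h1 h2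
    simp only [Pi.add_apply, Pi.sub_apply]
    linarith
  have hzI : Integrable (fun ω => ∑ j, z j ω) Q := integrable_finsetSum _ fun j _ => hzi j
  have hz0 : 0 ≤ ∫ ω, ∑ j, z j ω ∂Q := by
    rw [integral_finsetSum _ fun j _ => hzi j]
    exact Finset.sum_nonneg fun j _ => (hzN j).integral_nonneg (hzi j)
  have i1 := integrable_fun_sub hri hzI
  have i2 := integrable_fun_sub i1 (hrI.const_mul K)
  have i3 := integrable_fun_sub i2 hrI
  refine ⟨(i3.fun_add hpI).congr (hkl.mono fun ω h => h.symm), ?_⟩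
  rw [integral_congr_ae hkl, integral_add i3 hpI, integral_sub i2 hrI,
    integral_sub i1 (hrI.const_mul K), integral_sub hri hzI, integral_const_mul,
    hr.integral_eq_one, (h.link (n + 1) i).dens.integral_eq_one]
  linarith

lemma mixDiv_le {R : ProbabilityMeasure Ω} (hR : R ∈ ⋂ i, C i) {r : Ω → ℝ}
    (hr : HasDens Q (R : Measure Ω) r) (hri : Integrable (fun ω => r ω * Real.log (r ω)) Q)
    (n : ℕ) (i : Fin t) : mixDiv P S n i ≤ ∫ ω, r ω * Real.log (r ω) ∂Q := by
  have h1 := (h.kl_iterate hR hr hri n i).2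
  have h2 : 0 ≤ ∫ ω, kl (r ω) (primalDens Q P (n + 1) i ω) ∂Q := by
    refine integral_nonneg_of_ae ?_
    filter_upwards [h.primalDens_pos (n + 1) i] with ω hω
    exact kl_nonneg (hr.nonneg ω) hω
  linarith

lemma stepDiv_le {R : ProbabilityMeasure Ω} (hR : R ∈ ⋂ i, C i) {r : Ω → ℝ}
    (hr : HasDens Q (R : Measure Ω) r) (hri : Integrable (fun ω => r ω * Real.log (r ω)) Q)
    (n : ℕ) (i : Fin t) : stepDiv P S n i ≤ ∫ ω, r ω * Real.log (r ω) ∂Q := by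
  refine (h.stepDiv_mono i n.le_succ).trans (le_trans ?_ (h.mixDiv_le hR hr hri n i))
  have h1 : ∀ j ∈ Finset.univ, 0 ≤ if j ≤ i then stepDiv P S (n + 1) j else stepDiv P S n j := by
    intro j _
    split_ifs
    · exact h.stepDiv_nonneg _ _
    · exact h.stepDiv_nonneg _ _
  have h2 := Finset.single_le_sum h1 (Finset.mem_univ i)
  simpa [mixDiv] using h2

/-- Convergence of the step divergences. -/
lemma exists_limit {R : ProbabilityMeasure Ω} (hR : R ∈ ⋂ i, C i) {r : Ω → ℝ}
    (hr : HasDens Q (R : Measure Ω) r) (hri : Integrable (fun ω => r ω * Real.log (r ω)) Q) :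
    ∃ c : Fin t → ℝ, (∀ i, Tendsto (fun n => stepDiv P S n i) atTop (𝓝 (c i))) ∧
      ∀ n i, stepDiv P S n i ≤ c i := by
  have hbdd : ∀ i, BddAbove (Set.range fun n => stepDiv P S n i) := fun i =>
    ⟨_, by rintro _ ⟨n, rfl⟩; exact h.stepDiv_le hR hr hri n i⟩
  exact ⟨fun i => ⨆ n, stepDiv P S n i, fun i => tendsto_atTop_ciSup (h.stepDiv_mono i) (hbdd i),
    fun n i => le_ciSup (hbdd i) n⟩

omit h in
lemma tendsto_mixDiv {c : Fin t → ℝ}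
    (hc : ∀ i, Tendsto (fun n => stepDiv P S n i) atTop (𝓝 (c i))) (i : Fin t) :
    Tendsto (fun n => mixDiv P S n i) atTop (𝓝 (∑ j, c j)) := by
  refine tendsto_finsetSum _ fun j _ => ?_
  split_ifs
  · exact (hc j).comp (tendsto_add_atTop_nat 1)
  · exact hc j

/-- Consecutive iterates approach each other in `L₁`. -/
lemma tendsto_sub_prev {c : Fin t → ℝ}
    (hc : ∀ i, Tendsto (fun n => stepDiv P S n i) atTop (𝓝 (c i))) (i : Fin t) :
    Tendsto (fun n => ∫ ω, |primalDens Q P (n + 1) i ω -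
      prevIterate (primalDens Q P) n i ω| ∂Q) atTop (𝓝 0) := by
  have hprev : ∀ n, Integrable (prevIterate (primalDens Q P) n i) Q ∧
      (∀ᵐ ω ∂Q, 0 < prevIterate (primalDens Q P) n i ω) ∧
      ∫ ω, prevIterate (primalDens Q P) n i ω ∂Q = 1 := by
    intro n
    obtain ⟨m, k, hmk, -⟩ := h.prev n i
    rw [hmk]
    exact ⟨(h.link m k).dens.integrable, h.primalDens_pos m k, (h.link m k).dens.integral_eq_one⟩
  refine tendsto_integral_abs_sub_of_kl (fun n => (h.link (n + 1) i).dens.integrable)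
    (fun n => (hprev n).1) (fun n => (h.link (n + 1) i).dens.nonneg) (fun n => (hprev n).2.1)
    (fun n => (h.link (n + 1) i).dens.integral_eq_one) (fun n => (hprev n).2.2)
    (fun n => (h.kl_prev n i).1) ?_
  have h1 : Tendsto (fun n => stepDiv P S (n + 1) i - stepDiv P S n i) atTop (𝓝 0) := by
    simpa using ((hc i).comp (tendsto_add_atTop_nat 1)).sub (hc i)
  refine squeeze_zero (fun n => integral_nonneg_of_ae ?_) (fun n => (h.kl_prev n i).2) h1
  filter_upwards [(hprev n).2.1] with ω hω
  exact kl_nonneg ((h.link (n + 1) i).dens.nonneg ω) hω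

/-- The iterates of one cycle approach each other in `L₁`. -/
lemma tendsto_sub_last {c : Fin t → ℝ}
    (hc : ∀ i, Tendsto (fun n => stepDiv P S n i) atTop (𝓝 (c i))) (ht : 0 < t) (i : Fin t) :
    Tendsto (fun n => ∫ ω, |primalDens Q P n i ω -
      primalDens Q P n ⟨t - 1, by omega⟩ ω| ∂Q) atTop (𝓝 0) := by
  have hI : ∀ n i, Integrable (primalDens Q P n i) Q := fun n i => (h.link n i).dens.integrable
  have htri : ∀ n i j k, ∫ ω, |primalDens Q P n i ω - primalDens Q P n k ω| ∂Q ≤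
      ∫ ω, |primalDens Q P n i ω - primalDens Q P n j ω| ∂Q +
      ∫ ω, |primalDens Q P n k ω - primalDens Q P n j ω| ∂Q := by
    intro n i j k
    rw [← integral_add (integrable_fun_sub (hI n i) (hI n j)).abs
      (integrable_fun_sub (hI n k) (hI n j)).abs]
    refine integral_mono ((hI n i).sub (hI n k)).abs
      (((hI n i).sub (hI n j)).abs.add ((hI n k).sub (hI n j)).abs) fun ω => ?_
    beta_reduce
    rw [abs_sub_comm (primalDens Q P n k ω)]
    exact abs_sub_le _ _ _
  have h0 : ∀ n i k, 0 ≤ ∫ ω, |primalDens Q P n i ω - primalDens Q P n k ω| ∂Q :=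
    fun n i k => integral_nonneg fun ω => abs_nonneg _
  have hfirst : ∀ k (hk : k < t), Tendsto (fun n => ∫ ω, |primalDens Q P n ⟨k, hk⟩ ω -
      primalDens Q P n ⟨0, ht⟩ ω| ∂Q) atTop (𝓝 0) := by
    intro k
    induction k with
    | zero => intro hk; simp
    | succ k ih =>
      intro hk
      -- The shift is needed because `prevIterate` with argument n refers to step k + 1 of cycle n +
      -- 1; for a nonzero index the predecessor lies in that same cycle.
      refine (tendsto_add_atTop_iff_nat 1).1 ?_
      have h1 := ((ih (by omega)).comp (tendsto_add_atTop_nat 1)).add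
        (h.tendsto_sub_prev hc ⟨k + 1, hk⟩)
      rw [add_zero] at h1
      refine squeeze_zero (fun n => h0 _ _ _) (fun n => ?_) h1
      have h2 := htri (n + 1) ⟨k + 1, hk⟩ ⟨k, by omega⟩ ⟨0, ht⟩
      simp only [Function.comp_apply, prevIterate, Nat.succ_ne_zero, if_false,
        Nat.add_sub_cancel]
      simp only [abs_sub_comm (primalDens Q P (n + 1) ⟨0, ht⟩ _)] at h2
      linarith
  have h1 := (hfirst i.1 i.2).add (hfirst (t - 1) (by omega))
  rw [add_zero] at h1
  exact squeeze_zero (fun n => h0 _ _ _) (fun n => htri n i ⟨0, ht⟩ ⟨t - 1, by omega⟩) h1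

/-- Since p = e^(v + d) s, the product p e^(-v) is e^d s. Through this identity (A) becomes a bound
on an exponential moment of -v under P_{n,i}. -/
lemma integral_mul_exp_neg (n : ℕ) (i : Fin t) :
    Integrable (fun ω => primalDens Q P n i ω * Real.exp (-dualPot y n i ω)) Q ∧
    ∫ ω, primalDens Q P n i ω * Real.exp (-dualPot y n i ω) ∂Q =
      Real.exp (stepDiv P S n i) * (S n i).real Set.univ := by
  obtain ⟨s, hs, -, hps⟩ := (h.link n i).adjusted
  have : IsFiniteMeasure (S n i) := ⟨h.finite n i⟩
  have h1 : (fun ω => primalDens Q P n i ω * Real.exp (-dualPot y n i ω)) =ᵐ[Q]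
      fun ω => Real.exp (stepDiv P S n i) * s ω := by
    filter_upwards [hps] with ω hω
    rw [hω, stepPot, Real.exp_add, Real.exp_neg]
    have := (Real.exp_pos (dualPot y n i ω)).ne'
    field_simp
  exact ⟨(hs.integrable.const_mul _).congr h1.symm, by
    rw [integral_congr_ae h1, integral_const_mul, hs.integral_eq]⟩

/-- The chain rule for the densities of P_{n,i} and S_{n,i}. With (B) and bounded step divergences
it bounds the entropies of all iterates. -/
lemma entropy_eq (n : ℕ) (i : Fin t) :
    ∫ ω, primalDens Q P n i ω * Real.log (primalDens Q P n i ω) ∂Q =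
      stepDiv P S n i + ∫ ω, Real.log ((S n i).rnDeriv Q ω).toReal ∂(P n i : Measure Ω) := by
  obtain ⟨s, hs, hs0, hps⟩ := (h.link n i).adjusted
  have : IsFiniteMeasure (S n i) := ⟨h.finite n i⟩
  have hl := h.link n i
  have hsl : (fun ω => primalDens Q P n i ω * Real.log ((S n i).rnDeriv Q ω).toReal) =ᵐ[Q]
      fun ω => primalDens Q P n i ω * Real.log (s ω) := by
    filter_upwards [hs.toReal_rnDeriv] with ω hω
    rw [hω]
  have hsI := (integrable_congr hsl).1 (hl.dens.integrable_iff.1 (h.logInt n i))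
  have hdI : Integrable (fun ω => primalDens Q P n i ω *
      (Real.log (primalDens Q P n i ω) - Real.log (s ω))) Q := by
    simp only [mul_sub]
    exact hl.entropy.sub hsI
  have h2 := hl.dens.iDiv_eq hs (ae_of_all _ hs0) hdI
  rw [hl.div, EReal.coe_eq_coe_iff] at h2
  rw [hl.dens.integral_comp, integral_congr_ae hsl, h2, ← integral_add hdI hsI]
  refine integral_congr_ae (ae_of_all _ fun ω => ?_)
  ring

end IsRunPair

end IProj

end

noncomputable section

namespace IProj

variable {Ω : Type*} [MeasurableSpace Ω]

variable {Q : Measure Ω} [IsProbabilityMeasure Q]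

/-! ### Limits of nearly minimizing sequences -/

omit [IsProbabilityMeasure Q] in
/-- Fatou's lemma for integrals of nonnegative real valued functions. -/
lemma integrable_of_tendsto_of_integral_le {g : ℕ → Ω → ℝ} {g' : Ω → ℝ} {c : ℕ → ℝ} {c' : ℝ}
    (hg : ∀ n, Integrable (g n) Q) (hg0 : ∀ n, ∀ᵐ ω ∂Q, 0 ≤ g n ω)
    (hgc : ∀ n, ∫ ω, g n ω ∂Q ≤ c n) (hc : Tendsto c atTop (𝓝 c'))
    (hlim : ∀ᵐ ω ∂Q, Tendsto (fun n => g n ω) atTop (𝓝 (g' ω))) :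
    Integrable g' Q ∧ ∫ ω, g' ω ∂Q ≤ c' := by
  have hm : AEStronglyMeasurable g' Q :=
    aestronglyMeasurable_of_tendsto_ae atTop (fun n => (hg n).aestronglyMeasurable) hlim
  have h0 : ∀ᵐ ω ∂Q, 0 ≤ g' ω := by
    filter_upwards [hlim, ae_all_iff.2 hg0] with ω h1 h2
    exact ge_of_tendsto' h1 h2
  have hle : ∫⁻ ω, ENNReal.ofReal (g' ω) ∂Q ≤ ENNReal.ofReal c' := by
    have h1 : ∫⁻ ω, ENNReal.ofReal (g' ω) ∂Q =
        ∫⁻ ω, liminf (fun n => ENNReal.ofReal (g n ω)) atTop ∂Q := by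
      refine lintegral_congr_ae ?_
      filter_upwards [hlim] with ω hω
      exact (ENNReal.tendsto_ofReal hω).liminf_eq.symm
    rw [h1]
    refine (lintegral_liminf_le' fun n => (hg n).aemeasurable.ennreal_ofReal).trans ?_
    rw [← (ENNReal.tendsto_ofReal hc).liminf_eq]
    refine liminf_le_liminf (Eventually.of_forall fun n => ?_)
    rw [← ofReal_integral_eq_lintegral_ofReal (hg n) (hg0 n)]
    exact ENNReal.ofReal_le_ofReal (hgc n)
  have hc0 : 0 ≤ c' := ge_of_tendsto' hc fun n => (integral_nonneg_of_ae (hg0 n)).trans (hgc n)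
  refine ⟨⟨hm, ?_⟩, ?_⟩
  · rw [hasFiniteIntegral_iff_ofReal h0]
    exact hle.trans_lt ENNReal.ofReal_lt_top
  · rw [integral_eq_lintegral_of_nonneg_ae h0 hm]
    exact ENNReal.toReal_le_of_le_ofReal hc0 hle

omit [IsProbabilityMeasure Q] in
lemma exists_subseq_tendsto_ae {r : ℕ → Ω → ℝ} {x : Ω → ℝ} (hr : ∀ n, Integrable (r n) Q)
    (hx : Integrable x Q) (h : Tendsto (fun n => ∫ ω, |r n ω - x ω| ∂Q) atTop (𝓝 0)) :
    ∃ ns : ℕ → ℕ, StrictMono ns ∧ ∀ᵐ ω ∂Q, Tendsto (fun k => r (ns k) ω) atTop (𝓝 (x ω)) := by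
  refine TendstoInMeasure.exists_seq_tendsto_ae (μ := Q) ?_
  refine tendstoInMeasure_of_tendsto_eLpNorm one_ne_zero
    (fun n => (hr n).aestronglyMeasurable) hx.aestronglyMeasurable ?_
  have h1 : ∀ n, eLpNorm (r n - x) 1 Q = ENNReal.ofReal (∫ ω, |r n ω - x ω| ∂Q) := by
    intro n
    rw [eLpNorm_one_eq_lintegral_enorm, ← ofReal_integral_norm_eq_lintegral_enorm ((hr n).sub hx)]
    rfl
  simp only [h1]
  rw [← ENNReal.ofReal_zero]
  exact ENNReal.tendsto_ofReal h

/-- The midpoint convexity gap equals `kl a m + kl b m` with m the midpoint, and `abs_sub_le_kl`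
bounds both distances to m. This is the uniform convexity that turns near minimizers into a Cauchy
sequence. -/
lemma abs_sub_le_entropy_gap {a b ε : ℝ} (ha : 0 ≤ a) (hb : 0 ≤ b) (hε : 0 < ε) :
    |a - b| ≤ (a * Real.log a + b * Real.log b -
      2 * ((2⁻¹ * a + 2⁻¹ * b) * Real.log (2⁻¹ * a + 2⁻¹ * b))) / ε + ε * (a + b) := by
  rcases (add_nonneg ha hb).eq_or_lt with h | h
  · have h1 : a = 0 := by linarith
    have h2 : b = 0 := by linarith
    simp [h1, h2]
  · set m := 2⁻¹ * a + 2⁻¹ * b with hm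
    have hm0 : 0 < m := by rw [hm]; linarith
    have h1 := abs_sub_le_kl ha hm0 hε
    have h2 := abs_sub_le_kl hb hm0 hε
    have h3 : kl a m + kl b m = a * Real.log a + b * Real.log b - 2 * (m * Real.log m) := by
      unfold kl
      have : 2 * m = a + b := by rw [hm]; ring
      linear_combination (1 - Real.log m) * this
    have h4 : |a - b| ≤ |a - m| + |b - m| := by
      rw [abs_sub_comm b m]
      exact abs_sub_le _ _ _
    rw [← h3, add_div]
    have : 2 * m = a + b := by rw [hm]; ring
    have h5 : ε * (a + m) / 2 + ε * (b + m) / 2 = ε * (a + b) := by linear_combination ε / 2 * this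
    linarith

/-- A decreasing sequence of midpoint convex sets of nonnegative functions on which the entropy
is bounded contains an `L₁`-convergent sequence whose limit satisfies the limiting entropy bound. -/
lemma exists_limit_of_entropy_le {E : ℕ → Set (Ω → ℝ)} {L B : ℝ} (hE : Antitone E)
    (hne : ∀ k, (E k).Nonempty)
    (hmid : ∀ k, ∀ r ∈ E k, ∀ r' ∈ E k, (fun ω => 2⁻¹ * r ω + 2⁻¹ * r' ω) ∈ E k)
    (h0 : ∀ k, ∀ r ∈ E k, ∀ ω, 0 ≤ r ω)
    (hi : ∀ k, ∀ r ∈ E k, Integrable r Q) (hB : ∀ k, ∀ r ∈ E k, ∫ ω, r ω ∂Q ≤ B)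
    (hent : ∀ k, ∀ r ∈ E k, Integrable (fun ω => r ω * Real.log (r ω)) Q)
    (hL : ∀ k : ℕ, ∀ r ∈ E k, ∫ ω, r ω * Real.log (r ω) ∂Q ≤ L + 1 / ((k : ℝ) + 1)) :
    ∃ (r : ℕ → Ω → ℝ) (x : Ω → ℝ), (∀ k, r k ∈ E k) ∧ Measurable x ∧ (∀ ω, 0 ≤ x ω) ∧
      Integrable x Q ∧ Tendsto (fun k => ∫ ω, |r k ω - x ω| ∂Q) atTop (𝓝 0) ∧
      Integrable (fun ω => x ω * Real.log (x ω)) Q ∧ ∫ ω, x ω * Real.log (x ω) ∂Q ≤ L := by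
  let f : (Ω → ℝ) → ℝ := fun r => ∫ ω, r ω * Real.log (r ω) ∂Q
  have hfb : ∀ k, ∀ r ∈ E k, -1 ≤ f r := by
    intro k r hr
    have h1 : ∫ _, (-1 : ℝ) ∂Q ≤ f r :=
      integral_mono (integrable_const _) (hent k r hr) fun ω => neg_one_le_mul_log (h0 k r hr ω)
    simpa using h1
  have hbdd : ∀ k, BddBelow (f '' E k) := fun k => ⟨-1, by
    rintro _ ⟨r, hr, rfl⟩; exact hfb k r hr⟩
  let m : ℕ → ℝ := fun k => sInf (f '' E k)
  have hm : Monotone m := fun k l hkl =>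
    csInf_le_csInf (hbdd k) ((hne l).image f) (Set.image_mono (hE hkl))
  have hmle : ∀ k, ∀ r ∈ E k, m k ≤ f r := fun k r hr => csInf_le (hbdd k) ⟨r, hr, rfl⟩
  have hδ0 : ∀ k : ℕ, 0 < 1 / ((k : ℝ) + 1) := fun k => Nat.one_div_pos_of_nat
  have hex : ∀ k : ℕ, ∃ r ∈ E k, f r < m k + 1 / ((k : ℝ) + 1) := by
    intro k
    obtain ⟨_, ⟨r, hr, rfl⟩, hlt⟩ := exists_lt_of_csInf_lt ((hne k).image f)
      (show sInf (f '' E k) < m k + 1 / ((k : ℝ) + 1) from lt_add_of_pos_right _ (hδ0 k))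
    exact ⟨r, hr, hlt⟩
  choose r hr hrm using hex
  have hmbdd : BddAbove (Set.range m) := ⟨L + 1, by
    rintro _ ⟨k, rfl⟩
    obtain ⟨r', hr'⟩ := hne k
    refine (hmle k r' hr').trans ((hL k r' hr').trans ?_)
    have : 1 / ((k : ℝ) + 1) ≤ 1 := by
      rw [div_le_one (by positivity)]
      have := k.cast_nonneg (α := ℝ)
      linarith
    linarith⟩
  have hmlim := tendsto_atTop_ciSup hm hmbdd
  set μ := ⨆ k, m k
  have hmμ : ∀ k, m k ≤ μ := fun k => le_ciSup hmbdd k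
  have hri : ∀ k, Integrable (r k) Q := fun k => hi k _ (hr k)
  have hB0 : 0 ≤ B := (integral_nonneg (h0 0 _ (hr 0))).trans (hB 0 _ (hr 0))
  have hdist : ∀ k l : ℕ, k ≤ l → ∀ ε : ℝ, 0 < ε → ∫ ω, |r k ω - r l ω| ∂Q ≤
      ((μ - m k) + 2 * (1 / ((k : ℝ) + 1))) / ε + ε * (2 * B) := by
    intro k l hkl ε hε
    have hl : r l ∈ E k := hE hkl (hr l)
    have hmidk := hmid k _ (hr k) _ hl
    have hgapi : Integrable (fun ω => r k ω * Real.log (r k ω) + r l ω * Real.log (r l ω) -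
        2 * ((2⁻¹ * r k ω + 2⁻¹ * r l ω) * Real.log (2⁻¹ * r k ω + 2⁻¹ * r l ω))) Q :=
      ((hent k _ (hr k)).add (hent k _ hl)).sub ((hent k _ hmidk).const_mul 2)
    have h1 : ∫ ω, |r k ω - r l ω| ∂Q ≤ ∫ ω, ((r k ω * Real.log (r k ω) +
        r l ω * Real.log (r l ω) - 2 * ((2⁻¹ * r k ω + 2⁻¹ * r l ω) *
          Real.log (2⁻¹ * r k ω + 2⁻¹ * r l ω))) / ε + ε * (r k ω + r l ω)) ∂Q :=
      integral_mono ((hri k).sub (hri l)).abs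
        ((hgapi.div_const ε).add (((hri k).add (hri l)).const_mul ε))
        fun ω => abs_sub_le_entropy_gap (h0 k _ (hr k) ω) (h0 k _ hl ω) hε
    rw [integral_add (hgapi.div_const ε) (((hri k).fun_add (hri l)).const_mul ε), integral_div,
      integral_const_mul, integral_add (hri k) (hri l),
      integral_sub ((hent k _ (hr k)).fun_add (hent k _ hl)) ((hent k _ hmidk).const_mul 2),
      integral_add (hent k _ (hr k)) (hent k _ hl), integral_const_mul] at h1
    -- The midpoint lies in E k, so its entropy is at least m k, while the endpoints exceed m k and
    -- m l ≤ μ by at most 1/(k + 1) each.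
    have h2 : f (r k) + f (r l) - 2 * f (fun ω => 2⁻¹ * r k ω + 2⁻¹ * r l ω) ≤
        (μ - m k) + 2 * (1 / ((k : ℝ) + 1)) := by
      have h3 := hmle k _ hmidk
      have h4 := (hrm k).le
      have h5 := (hrm l).le
      have h6 := hmμ l
      have h7 : 1 / ((l : ℝ) + 1) ≤ 1 / ((k : ℝ) + 1) := Nat.one_div_le_one_div hkl
      linarith
    have h8 : (f (r k) + f (r l) - 2 * f (fun ω => 2⁻¹ * r k ω + 2⁻¹ * r l ω)) / ε ≤
        ((μ - m k) + 2 * (1 / ((k : ℝ) + 1))) / ε := by gcongr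
    have h9 : ε * (∫ ω, r k ω ∂Q + ∫ ω, r l ω ∂Q) ≤ ε * (2 * B) := by
      have := hB k _ (hr k)
      have := hB k _ hl
      gcongr
      linarith
    exact h1.trans (add_le_add h8 h9)
  have hgap : Tendsto (fun k : ℕ => (μ - m k) + 2 * (1 / ((k : ℝ) + 1))) atTop (𝓝 0) := by
    have h1 := (tendsto_const_nhds (x := μ)).sub hmlim
    have h2 := (tendsto_one_div_add_atTop_nhds_zero_nat (𝕜 := ℝ)).const_mul 2
    simpa using h1.add h2
  let X : ℕ → Ω →₁[Q] ℝ := fun k => (hri k).toL1 (r k)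
  have hXd : ∀ k l, dist (X k) (X l) = ∫ ω, |r k ω - r l ω| ∂Q := by
    intro k l
    rw [dist_eq_norm, ← Integrable.toL1_sub, L1.norm_eq_integral_norm]
    refine integral_congr_ae ?_
    filter_upwards [Integrable.coeFn_toL1 ((hri k).sub (hri l))] with ω hω
    rw [hω]
    rfl
  have hcauchy : CauchySeq X := by
    refine Metric.cauchySeq_iff'.2 fun ε hε => ?_
    -- δ is the free weight in `hdist`: it makes δ · 2B at most ε/2, and N is then taken so large
    -- that the gap is below δ ε/2.
    set δ := ε / (4 * B + 2) with hδ
    have hδp : 0 < δ := by positivity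
    obtain ⟨N, hN⟩ := (hgap.eventually (gt_mem_nhds (show 0 < δ * (ε / 2) by positivity))).exists
    refine ⟨N, fun n hn => ?_⟩
    rw [dist_comm, hXd]
    refine (hdist N n hn δ hδp).trans_lt ?_
    have h1 : ((μ - m N) + 2 * (1 / ((N : ℝ) + 1))) / δ < ε / 2 := by
      rw [div_lt_iff₀ hδp]
      linarith
    have h2 : δ * (2 * B) ≤ ε / 2 := by
      rw [hδ, div_mul_eq_mul_div, div_le_iff₀ (by positivity)]
      nlinarith
    linarith
  obtain ⟨X', hX'⟩ := cauchySeq_tendsto_of_complete hcauchy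
  have hX'd : ∀ k, dist (X k) X' = ∫ ω, |r k ω - X' ω| ∂Q := by
    intro k
    rw [dist_eq_norm, L1.norm_eq_integral_norm]
    refine integral_congr_ae ?_
    filter_upwards [Integrable.coeFn_toL1 (hri k), Lp.coeFn_sub (X k) X'] with ω h1 h2
    rw [h2, Pi.sub_apply, h1]
    rfl
  have hlim : Tendsto (fun k => ∫ ω, |r k ω - X' ω| ∂Q) atTop (𝓝 0) := by
    simp only [← hX'd]
    exact tendsto_iff_dist_tendsto_zero.1 hX'
  obtain ⟨ns, hns, hae⟩ := exists_subseq_tendsto_ae hri (L1.integrable_coeFn X') hlim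
  let x : Ω → ℝ := fun ω => max ((Lp.aestronglyMeasurable X').mk X' ω) 0
  have hxm : Measurable x :=
    (Lp.aestronglyMeasurable X').stronglyMeasurable_mk.measurable.max measurable_const
  have hxX : X' =ᵐ[Q] x := by
    filter_upwards [hae, (Lp.aestronglyMeasurable X').ae_eq_mk] with ω h1 h2
    have h3 : 0 ≤ X' ω := ge_of_tendsto' h1 fun k => h0 _ _ (hr _) ω
    simp only [x]
    rw [← h2, max_eq_left h3]
  have hxlim : ∀ᵐ ω ∂Q, Tendsto (fun k => r (ns k) ω * Real.log (r (ns k) ω) + 1) atTop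
      (𝓝 (x ω * Real.log (x ω) + 1)) := by
    filter_upwards [hae, hxX] with ω h1 h2
    rw [h2] at h1
    exact ((Real.continuous_mul_log.tendsto _).comp h1).add_const 1
  have hfat := integrable_of_tendsto_of_integral_le (Q := Q)
    (g := fun k ω => r (ns k) ω * Real.log (r (ns k) ω) + 1)
    (g' := fun ω => x ω * Real.log (x ω) + 1)
    (c := fun k => L + 1 / ((ns k : ℝ) + 1) + 1) (c' := L + 0 + 1)
    (fun k => (hent _ _ (hr _)).add (integrable_const 1))
    (fun k => ae_of_all _ fun ω => by linarith [neg_one_le_mul_log (h0 _ _ (hr (ns k)) ω)])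
    (fun k => by
      rw [integral_add (hent _ _ (hr _)) (integrable_const 1)]
      simpa using hL _ _ (hr (ns k)))
    ((((tendsto_one_div_add_atTop_nhds_zero_nat (𝕜 := ℝ)).comp hns.tendsto_atTop).const_add
      L).add_const 1) hxlim
  have hxe : Integrable (fun ω => x ω * Real.log (x ω)) Q := by
    simpa using integrable_fun_sub hfat.1 (integrable_const 1)
  refine ⟨r, x, hr, hxm, fun ω => le_max_right _ _, (L1.integrable_coeFn X').congr hxX, ?_, hxe, ?_⟩
  · refine hlim.congr fun k => integral_congr_ae ?_
    filter_upwards [hxX] with ω hω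
    rw [hω]
  · have h1 := hfat.2
    rw [integral_add hxe (integrable_const 1)] at h1
    simp at h1
    linarith

end IProj

end

noncomputable section

namespace IProj

variable {Ω : Type*} [MeasurableSpace Ω]

variable {Q : Measure Ω} [IsProbabilityMeasure Q] {t : ℕ} {C : Fin t → Set (ProbabilityMeasure Ω)}
  {P : ℕ → Fin t → ProbabilityMeasure Ω} {S : ℕ → Fin t → Measure Ω}
  {y : ℕ → Fin t → Ω → EReal}

/-! ### Truncation -/

/-- Young's inequality with the constant N is integrated over A. Adding 1 makes p ln p nonnegative,
so its integral over A is at most that over Ω. -/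
lemma setIntegral_le_of_entropy_le {p : Ω → ℝ} {M : ℝ} (hp : Integrable p Q) (hp0 : ∀ ω, 0 ≤ p ω)
    (hpe : Integrable (fun ω => p ω * Real.log (p ω)) Q)
    (hM : ∫ ω, p ω * Real.log (p ω) ∂Q ≤ M) {A : Set Ω} {N : ℝ} :
    N * ∫ ω in A, p ω ∂Q ≤ M + 1 + Real.exp N * Q.real A := by
  have h1 : ∫ ω in A, N * p ω ∂Q ≤ ∫ ω in A, ((p ω * Real.log (p ω) + 1) + Real.exp N) ∂Q := by
    refine integral_mono (hp.const_mul N).integrableOn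
      ((hpe.add (integrable_const 1)).add (integrable_const _)).integrableOn fun ω => ?_
    have h1 := mul_le_mul_log_add_exp N (hp0 ω)
    have h2 := hp0 ω
    simp only
    linarith
  have hi1 : Integrable (fun ω => p ω * Real.log (p ω) + 1) Q := hpe.add (integrable_const 1)
  have h2 : ∫ ω in A, (p ω * Real.log (p ω) + 1) ∂Q ≤ ∫ ω, (p ω * Real.log (p ω) + 1) ∂Q :=
    setIntegral_le_integral hi1 (ae_of_all _ fun ω => by
      have := neg_one_le_mul_log (hp0 ω)
      simp only [Pi.zero_apply]
      linarith)
  rw [integral_const_mul, integral_add hi1.integrableOn (integrable_const _),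
    integral_const, smul_eq_mul, measureReal_restrict_apply_univ] at h1
  rw [integral_add hpe (integrable_const _), integral_const] at h2
  simp only [probReal_univ, smul_eq_mul, mul_one] at h2
  linarith

/-- Uniform integrability of densities with bounded entropy. -/
lemma exists_measureReal_le_setIntegral_le (M : ℝ) {ε : ℝ} (hε : 0 < ε) :
    ∃ η : ℝ, 0 < η ∧ ∀ p : Ω → ℝ, Integrable p Q → (∀ ω, 0 ≤ p ω) →
      Integrable (fun ω => p ω * Real.log (p ω)) Q → ∫ ω, p ω * Real.log (p ω) ∂Q ≤ M →
      ∀ A, Q.real A ≤ η → ∫ ω in A, p ω ∂Q ≤ ε := by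
  -- For Q(A) ≤ e^(-N) the exponential term is at most 1, whence N ∫_A p ≤ |M| + 2 = N ε.
  set N := (|M| + 2) / ε with hN
  have hN0 : 0 < N := by positivity
  refine ⟨Real.exp (-N), Real.exp_pos _, fun p hp hp0 hpe hM A hQA => ?_⟩
  have h1 := setIntegral_le_of_entropy_le hp hp0 hpe hM (A := A) (N := N)
  have h2 : Real.exp N * Q.real A ≤ 1 := by
    refine (mul_le_mul_of_nonneg_left hQA (Real.exp_pos N).le).trans_eq ?_
    rw [← Real.exp_add, add_neg_cancel, Real.exp_zero]
  have h3 : N * ε = |M| + 2 := by rw [hN]; field_simp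
  have h4 := le_abs_self M
  exact le_of_mul_le_mul_left (by linarith) hN0

/-! ### Truncated iterates and the limit density. -/

namespace IsRunPair

variable (h : IsRunPair Q C P S y)
include h

/-- Because ∫ p v = 0, the integral of p v over A is that of -p v over the complement, where -v ≤ R
+ e^(-R) e^(-v). The last term is the price of replacing p by q on A, where |v| ≤ K. -/
lemma setIntegral_mul_pot_le (n : ℕ) (i : Fin t) {A : Set Ω} (hA : MeasurableSet A) {K : ℝ}
    (hK0 : 0 ≤ K) (hK : ∀ ω ∈ A, |dualPot y n i ω| ≤ K) {q : Ω → ℝ} (hq : Integrable q Q) (R : ℝ) :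
    ∫ ω in A, q ω * dualPot y n i ω ∂Q ≤ R * ∫ ω in Aᶜ, primalDens Q P n i ω ∂Q +
      Real.exp (-R) * (Real.exp (stepDiv P S n i) * (S n i).real Set.univ) +
      K * ∫ ω, |primalDens Q P n i ω - q ω| ∂Q := by
  have hl := h.link n i
  have hpI : Integrable (primalDens Q P n i) Q := hl.dens.integrable
  have hpm := hl.int_mul
  obtain ⟨hexpI, hexp⟩ := h.integral_mul_exp_neg n i
  have hvm := h.measurable_pot n i
  have h0 := hl.int_mul
  have h1 := hl.integral_mul
  rw [← integral_add_compl hA h0] at h1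
  have h2 : ∫ ω in Aᶜ, -(primalDens Q P n i ω * dualPot y n i ω) ∂Q ≤
      ∫ ω in Aᶜ, (R * primalDens Q P n i ω +
        Real.exp (-R) * (primalDens Q P n i ω * Real.exp (-dualPot y n i ω))) ∂Q := by
    refine integral_mono h0.neg.integrableOn
      ((hpI.const_mul R).add (hexpI.const_mul (Real.exp (-R)))).integrableOn fun ω => ?_
    have h3 : -dualPot y n i ω - R + 1 ≤ Real.exp (-dualPot y n i ω - R) := Real.add_one_le_exp _
    rw [sub_eq_add_neg, Real.exp_add] at h3
    have h4 := mul_le_mul_of_nonneg_left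
      (show -dualPot y n i ω ≤ R + Real.exp (-dualPot y n i ω) * Real.exp (-R) by linarith)
      (hl.dens.nonneg ω)
    simp only
    linarith
  rw [integral_neg, integral_add (hpI.const_mul R).integrableOn
    (hexpI.const_mul (Real.exp (-R))).integrableOn, integral_const_mul, integral_const_mul] at h2
  have h3 : ∫ ω in Aᶜ, primalDens Q P n i ω * Real.exp (-dualPot y n i ω) ∂Q ≤
      ∫ ω, primalDens Q P n i ω * Real.exp (-dualPot y n i ω) ∂Q :=
    setIntegral_le_integral hexpI (ae_of_all _ fun ω =>
      mul_nonneg (hl.dens.nonneg ω) (Real.exp_pos _).le)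
  rw [hexp] at h3
  have h3' := mul_le_mul_of_nonneg_left h3 (Real.exp_pos (-R)).le
  have hqv : IntegrableOn (fun ω => q ω * dualPot y n i ω) A Q :=
    Integrable.mul_bdd (c := K) hq.integrableOn hvm.aestronglyMeasurable
      ((ae_restrict_iff' hA).2 (ae_of_all _ fun ω hω => hK ω hω))
  have h5 : ∫ ω in A, q ω * dualPot y n i ω ∂Q ≤ ∫ ω in A,
      (primalDens Q P n i ω * dualPot y n i ω + K * |primalDens Q P n i ω - q ω|) ∂Q := by
    refine setIntegral_mono_on hqv
      (h0.add ((hpI.sub hq).abs.const_mul K)).integrableOn hA fun ω hω => ?_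
    have h6 : (q ω - primalDens Q P n i ω) * dualPot y n i ω ≤
        |q ω - primalDens Q P n i ω| * K := by
      refine (le_abs_self _).trans ?_
      rw [abs_mul]
      exact mul_le_mul_of_nonneg_left (hK ω hω) (abs_nonneg _)
    rw [abs_sub_comm] at h6
    linarith
  rw [integral_add h0.integrableOn ((integrable_fun_sub hpI hq).abs.const_mul K).integrableOn,
    integral_const_mul] at h5
  have h6 : ∫ ω in A, |primalDens Q P n i ω - q ω| ∂Q ≤ ∫ ω, |primalDens Q P n i ω - q ω| ∂Q :=
    setIntegral_le_integral (hpI.sub hq).abs (ae_of_all _ fun ω => abs_nonneg _)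
  have h7 := mul_le_mul_of_nonneg_left h6 hK0
  linarith

/-- On a large set, the last iterate of a late cycle has entropy close to the limit of the
divergences. -/
lemma exists_truncation {M₁ M₂ : ℝ} (hA : ∀ n i, (S n i).real Set.univ ≤ M₁)
    (hB : ∀ n i, ∫ ω, Real.log ((S n i).rnDeriv Q ω).toReal ∂(P n i : Measure Ω) ≤ M₂)
    (hUI : ∀ η : ℝ, 0 < η → ∃ K : ℝ, 0 ≤ K ∧ ∀ n,
      Q.real {ω | ∀ i, |dualPot y n i ω| ≤ K}ᶜ ≤ η)
    {c : Fin t → ℝ} (hc : ∀ i, Tendsto (fun n => stepDiv P S n i) atTop (𝓝 (c i)))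
    (hcle : ∀ n i, stepDiv P S n i ≤ c i) (ht : 0 < t) {ε : ℝ} (hε : 0 < ε) :
    ∃ N, ∀ n ≥ N, ∃ A, MeasurableSet A ∧
      ∫ ω in Aᶜ, primalDens Q P n ⟨t - 1, by omega⟩ ω ∂Q ≤ ε ∧
      ∫ ω in A, primalDens Q P n ⟨t - 1, by omega⟩ ω *
        Real.log (primalDens Q P n ⟨t - 1, by omega⟩ ω) ∂Q ≤ ∑ i, c i + ε := by
  have hc0 : ∀ i, 0 ≤ c i := fun i => (h.stepDiv_nonneg 0 i).trans (hcle 0 i)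
  have hent : ∀ n i, ∫ ω, primalDens Q P n i ω * Real.log (primalDens Q P n i ω) ∂Q ≤
      ∑ j, c j + M₂ := by
    intro n i
    rw [h.entropy_eq]
    have h1 := Finset.single_le_sum (f := c) (fun j _ => hc0 j) (Finset.mem_univ i)
    linarith [hcle n i, hB n i]
  have hM₁ : 0 ≤ M₁ := measureReal_nonneg.trans (hA 0 ⟨0, ht⟩)
  set M' := Real.exp (∑ j, c j) * M₁ with hM'
  have hM'0 : 0 ≤ M' := by positivity
  have hexp : ∀ n i, Real.exp (stepDiv P S n i) * (S n i).real Set.univ ≤ M' := by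
    intro n i
    have h1 := Finset.single_le_sum (f := c) (fun j _ => hc0 j) (Finset.mem_univ i)
    have h2 := hA n i
    have h3 := (hcle n i).trans h1
    rw [hM']
    gcongr
  -- Each of the t summands of the entropy carries three errors of size δ: R times the mass outside
  -- A, the exponential moment times e^(-R), and K times an L₁ distance. The constants are chosen in
  -- the order R, η, K, N, each depending on the earlier ones.
  set δ := ε / (3 * t) with hδ
  have ht0 : (0 : ℝ) < t := by exact_mod_cast ht
  have hδ0 : 0 < δ := by positivity
  obtain ⟨R, hR0, hR⟩ : ∃ R : ℝ, 0 < R ∧ Real.exp (-R) * M' ≤ δ := by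
    have h1 : Tendsto (fun R : ℝ => Real.exp (-R) * M') atTop (𝓝 (0 * M')) :=
      (Real.tendsto_exp_neg_atTop_nhds_zero).mul_const M'
    rw [zero_mul] at h1
    obtain ⟨R, hR⟩ := ((h1.eventually (ge_mem_nhds hδ0)).and (eventually_gt_atTop 0)).exists
    exact ⟨R, hR.2, hR.1⟩
  obtain ⟨η, hη0, hη⟩ := exists_measureReal_le_setIntegral_le (Q := Q) (∑ j, c j + M₂)
    (show 0 < min ε (δ / R) by positivity)
  obtain ⟨K, hK0, hK⟩ := hUI η hη0
  have hev : ∀ᶠ n in atTop, ∀ i, K * ∫ ω, |primalDens Q P n i ω -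
      primalDens Q P n ⟨t - 1, by omega⟩ ω| ∂Q ≤ δ := by
    refine eventually_all.2 fun i => ?_
    have h1 := (h.tendsto_sub_last hc ht i).const_mul K
    rw [mul_zero] at h1
    exact h1.eventually (ge_mem_nhds hδ0)
  obtain ⟨N, hN⟩ := eventually_atTop.1 hev
  refine ⟨N, fun n hn => ?_⟩
  set A := {ω | ∀ i, |dualPot y n i ω| ≤ K} with hAdef
  have hAm : MeasurableSet A := by
    rw [hAdef, Set.ofPred_forall]
    exact MeasurableSet.iInter fun i => measurableSet_le (h.measurable_pot n i).abs
      measurable_const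
  have hsmall : ∀ i, ∫ ω in Aᶜ, primalDens Q P n i ω ∂Q ≤ min ε (δ / R) := fun i =>
    hη _ (h.link n i).dens.integrable (h.link n i).dens.nonneg (h.link n i).entropy (hent n i) _
      (hK n)
  refine ⟨A, hAm, (hsmall _).trans (min_le_left _ _), ?_⟩
  have hq := (h.link n ⟨t - 1, by omega⟩).dens
  have hlast := h.primalDens_last n ht
  have hdist := hN n hn
  set q := primalDens Q P n ⟨t - 1, by omega⟩ with hqdef
  have hqv : ∀ i, IntegrableOn (fun ω => q ω * dualPot y n i ω) A Q := fun i =>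
    Integrable.mul_bdd (c := K) hq.integrable.integrableOn
      (h.measurable_pot n i).aestronglyMeasurable
      ((ae_restrict_iff' hAm).2 (ae_of_all _ fun ω hω => hω i))
  -- On A every potential is bounded, so the logarithm of q may be split into t separately
  -- integrable terms.
  have hlog : ∫ ω in A, q ω * Real.log (q ω) ∂Q =
      ∑ i, (∫ ω in A, q ω * dualPot y n i ω ∂Q + stepDiv P S n i * ∫ ω in A, q ω ∂Q) := by
    have h1 : ∫ ω in A, q ω * Real.log (q ω) ∂Q =
        ∫ ω in A, ∑ i, (q ω * dualPot y n i ω + stepDiv P S n i * q ω) ∂Q := by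
      refine integral_congr_ae (ae_restrict_of_ae ?_)
      filter_upwards [hlast] with ω hω
      nth_rewrite 2 [hω]
      rw [Real.log_exp, Finset.mul_sum]
      exact Finset.sum_congr rfl fun i _ => by rw [stepPot]; ring
    rw [h1, integral_finsetSum _ fun i _ =>
      (hqv i).fun_add (hq.integrable.integrableOn.const_mul (stepDiv P S n i))]
    refine Finset.sum_congr rfl fun i _ => ?_
    rw [integral_add (hqv i) (hq.integrable.integrableOn.const_mul (stepDiv P S n i)),
      integral_const_mul]
  have hqA : ∫ ω in A, q ω ∂Q ≤ 1 := by
    rw [← hq.integral_eq_one]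
    exact setIntegral_le_integral hq.integrable (ae_of_all _ hq.nonneg)
  have hqA0 : 0 ≤ ∫ ω in A, q ω ∂Q := integral_nonneg hq.nonneg
  have hterm : ∀ i, ∫ ω in A, q ω * dualPot y n i ω ∂Q + stepDiv P S n i * ∫ ω in A, q ω ∂Q ≤
      c i + 3 * δ := by
    intro i
    have h1 := h.setIntegral_mul_pot_le n i hAm hK0 (fun ω hω => hω i) hq.integrable R
    have h2 := mul_le_mul_of_nonneg_left ((hsmall i).trans (min_le_right _ _)) hR0.le
    rw [mul_div_cancel₀ _ hR0.ne'] at h2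
    have h3 := mul_le_mul_of_nonneg_left (hexp n i) (Real.exp_pos (-R)).le
    have h4 := mul_le_mul (hcle n i) hqA hqA0 (hc0 i)
    have h5 := hdist i
    linarith
  rw [hlog]
  refine (Finset.sum_le_sum fun i _ => hterm i).trans_eq ?_
  rw [Finset.sum_add_distrib, Finset.sum_const, Finset.card_univ, Fintype.card_fin, nsmul_eq_mul,
    hδ]
  field_simp

/-- The density of the I-projection of `Q` onto the intersection. -/
lemma exists_limit_density {M₁ M₂ : ℝ} (hA : ∀ n i, (S n i).real Set.univ ≤ M₁)
    (hB : ∀ n i, ∫ ω, Real.log ((S n i).rnDeriv Q ω).toReal ∂(P n i : Measure Ω) ≤ M₂)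
    (hUI : ∀ η : ℝ, 0 < η → ∃ K : ℝ, 0 ≤ K ∧ ∀ n,
      Q.real {ω | ∀ i, |dualPot y n i ω| ≤ K}ᶜ ≤ η)
    {c : Fin t → ℝ} (hc : ∀ i, Tendsto (fun n => stepDiv P S n i) atTop (𝓝 (c i)))
    (hcle : ∀ n i, stepDiv P S n i ≤ c i) (ht : 0 < t) :
    ∃ W ∈ ⋂ i, C i, ∃ x : Ω → ℝ, HasDens Q (W : Measure Ω) x ∧
      Integrable (fun ω => x ω * Real.log (x ω)) Q ∧
      ∫ ω, x ω * Real.log (x ω) ∂Q = ∑ i, c i := by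
  -- Mass below one is admitted because only truncated iterates are known to have entropy near Σ c.
  -- L₁ closeness to each C_i is carried along, so that the limit recovers mass one and lies in
  -- every closed C_i.
  let E : ℕ → Set (Ω → ℝ) := fun k => {r | Measurable r ∧ (∀ ω, 0 ≤ r ω) ∧ Integrable r Q ∧
    ∫ ω, r ω ∂Q ≤ 1 ∧ Integrable (fun ω => r ω * Real.log (r ω)) Q ∧
    ∫ ω, r ω * Real.log (r ω) ∂Q ≤ ∑ i, c i + 1 / ((k : ℝ) + 1) ∧
    ∀ i, ∃ R ∈ C i, ∃ r', HasDens Q (R : Measure Ω) r' ∧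
      ∫ ω, |r ω - r' ω| ∂Q ≤ 1 / ((k : ℝ) + 1)}
  have hE : Antitone E := by
    intro k l hkl r hr
    obtain ⟨h1, h2, h3, h4, h5, h6, h7⟩ := hr
    have h8 : 1 / ((l : ℝ) + 1) ≤ 1 / ((k : ℝ) + 1) := Nat.one_div_le_one_div hkl
    refine ⟨h1, h2, h3, h4, h5, by linarith, fun i => ?_⟩
    obtain ⟨R, hR, r', hr', hd⟩ := h7 i
    exact ⟨R, hR, r', hr', hd.trans h8⟩
  have hne : ∀ k, (E k).Nonempty := by
    intro k
    have hε : 0 < 1 / ((k : ℝ) + 1) / 2 := by positivity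
    obtain ⟨N, hN⟩ := h.exists_truncation hA hB hUI hc hcle ht hε
    have hev : ∀ᶠ n in atTop, ∀ i, ∫ ω, |primalDens Q P n i ω -
        primalDens Q P n ⟨t - 1, by omega⟩ ω| ∂Q ≤ 1 / ((k : ℝ) + 1) / 2 :=
      eventually_all.2 fun i => (h.tendsto_sub_last hc ht i).eventually (ge_mem_nhds hε)
    -- Cycle 0 is excluded because P_{0,i} = Q need not belong to C_i.
    obtain ⟨n, hn, hnN, hn1⟩ :=
      (hev.and ((eventually_ge_atTop N).and (eventually_ge_atTop 1))).exists
    obtain ⟨A, hAm, h1, h2⟩ := hN n hnN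
    have hq := (h.link n ⟨t - 1, by omega⟩).dens
    have hqe := (h.link n ⟨t - 1, by omega⟩).entropy
    set q := primalDens Q P n ⟨t - 1, by omega⟩ with hqdef
    have hlog : (fun ω => A.indicator q ω * Real.log (A.indicator q ω)) =
        A.indicator fun ω => q ω * Real.log (q ω) := by
      ext ω
      by_cases hω : ω ∈ A <;> simp [hω]
    refine ⟨A.indicator q, hq.meas.indicator hAm, fun ω => Set.indicator_nonneg
      (fun ω _ => hq.nonneg ω) ω, hq.integrable.indicator hAm, ?_, ?_, ?_, fun i => ?_⟩
    · rw [integral_indicator hAm, ← hq.integral_eq_one]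
      exact setIntegral_le_integral hq.integrable (ae_of_all _ hq.nonneg)
    · rw [hlog]
      exact hqe.indicator hAm
    · rw [hlog, integral_indicator hAm]
      linarith
    · obtain ⟨m, rfl⟩ : ∃ m, n = m + 1 := ⟨n - 1, by omega⟩
      refine ⟨P (m + 1) i, (h.primal.project m i).1, primalDens Q P (m + 1) i,
        (h.link (m + 1) i).dens, ?_⟩
      have hp := (h.link (m + 1) i).dens.integrable
      have h3 : ∫ ω, |A.indicator q ω - primalDens Q P (m + 1) i ω| ∂Q ≤
          ∫ ω, (Aᶜ.indicator q ω + |primalDens Q P (m + 1) i ω - q ω|) ∂Q := by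
        refine integral_mono ((hq.integrable.indicator hAm).sub hp).abs
          ((hq.integrable.indicator hAm.compl).add (hp.sub hq.integrable).abs) fun ω => ?_
        have h4 := hq.nonneg ω
        have h5 := (h.link (m + 1) i).dens.nonneg ω
        by_cases hω : ω ∈ A
        · simp only [hω, Set.indicator_of_mem, Set.mem_compl_iff, not_true_eq_false,
            not_false_eq_true, Set.indicator_of_notMem, zero_add]
          rw [abs_sub_comm]
        · simp only [hω, Set.indicator_of_mem, Set.mem_compl_iff, not_false_eq_true,
            Set.indicator_of_notMem, zero_sub, abs_neg, abs_of_nonneg h5]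
          have := le_abs_self (primalDens Q P (m + 1) i ω - q ω)
          linarith
      rw [integral_add (hq.integrable.indicator hAm.compl)
        (integrable_fun_sub hp hq.integrable).abs, integral_indicator hAm.compl] at h3
      linarith [hn i]
  have hmid : ∀ k, ∀ r ∈ E k, ∀ r' ∈ E k, (fun ω => 2⁻¹ * r ω + 2⁻¹ * r' ω) ∈ E k := by
    rintro k r ⟨h1, h2, h3, h4, h5, h6, h7⟩ r' ⟨h1', h2', h3', h4', h5', h6', h7'⟩
    have hent := integrable_mul_log_mix h1 h1' h2 h2' h5 h5' (a := 2⁻¹) (b := 2⁻¹) (by norm_num)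
      (by norm_num) (by norm_num)
    refine ⟨(h1.const_mul _).add (h1'.const_mul _), fun ω => ?_,
      (h3.const_mul _).add (h3'.const_mul _), ?_, hent, ?_, fun i => ?_⟩
    · have := h2 ω
      have := h2' ω
      positivity
    · rw [integral_add (h3.const_mul _) (h3'.const_mul _), integral_const_mul, integral_const_mul]
      linarith
    · have h8 : ∫ ω, (2⁻¹ * r ω + 2⁻¹ * r' ω) * Real.log (2⁻¹ * r ω + 2⁻¹ * r' ω) ∂Q ≤
          ∫ ω, (2⁻¹ * (r ω * Real.log (r ω)) + 2⁻¹ * (r' ω * Real.log (r' ω))) ∂Q :=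
        integral_mono hent ((h5.const_mul _).add (h5'.const_mul _)) fun ω =>
          convexOn_mul_log.2 (h2 ω) (h2' ω) (by norm_num) (by norm_num) (by norm_num)
      rw [integral_add (h5.const_mul _) (h5'.const_mul _), integral_const_mul,
        integral_const_mul] at h8
      linarith
    · obtain ⟨R, hR, s, hs, hd⟩ := h7 i
      obtain ⟨R', hR', s', hs', hd'⟩ := h7' i
      obtain ⟨W, hW, hWd⟩ := (h.convex i).exists_mix hR hR' hs hs' (a := 2⁻¹) (b := 2⁻¹)
        (by norm_num) (by norm_num) (by norm_num)
      refine ⟨W, hW, _, hWd, ?_⟩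
      have hi := (integrable_fun_sub h3 hs.integrable).abs
      have hi' := (integrable_fun_sub h3' hs'.integrable).abs
      have h8 : ∫ ω, |2⁻¹ * r ω + 2⁻¹ * r' ω - (2⁻¹ * s ω + 2⁻¹ * s' ω)| ∂Q ≤
          ∫ ω, (2⁻¹ * |r ω - s ω| + 2⁻¹ * |r' ω - s' ω|) ∂Q := by
        refine integral_mono (((h3.const_mul _).add (h3'.const_mul _)).sub hWd.integrable).abs
          ((hi.const_mul _).add (hi'.const_mul _)) fun ω => ?_
        have h9 := abs_add_le (2⁻¹ * (r ω - s ω)) (2⁻¹ * (r' ω - s' ω))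
        rw [abs_mul, abs_mul, abs_of_pos (by norm_num : (0 : ℝ) < 2⁻¹)] at h9
        refine le_trans (le_of_eq ?_) h9
        congr 1
        ring
      rw [integral_add (hi.const_mul _) (hi'.const_mul _), integral_const_mul,
        integral_const_mul] at h8
      refine h8.trans ?_
      linarith
  obtain ⟨r, x, hr, hxm, hx0, hxI, hlim, hxe, hxL⟩ := exists_limit_of_entropy_le (Q := Q)
    (L := ∑ i, c i) (B := 1) hE hne hmid (fun k r hr => hr.2.1) (fun k r hr => hr.2.2.1)
    (fun k r hr => hr.2.2.2.1) (fun k r hr => hr.2.2.2.2.1) fun k r hr => hr.2.2.2.2.2.1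
  have happ : ∀ i, ∃ (R : ℕ → ProbabilityMeasure Ω) (r' : ℕ → Ω → ℝ), (∀ k, R k ∈ C i) ∧
      (∀ k, HasDens Q (R k : Measure Ω) (r' k)) ∧
      Tendsto (fun k => ∫ ω, |r' k ω - x ω| ∂Q) atTop (𝓝 0) := by
    intro i
    have h1 := fun k => (hr k).2.2.2.2.2.2 i
    choose R hR r' hr' hd using h1
    refine ⟨R, r', hR, hr', squeeze_zero (fun k => integral_nonneg fun ω => abs_nonneg _)
      (g := fun k : ℕ => 1 / ((k : ℝ) + 1) + ∫ ω, |r k ω - x ω| ∂Q) (fun k => ?_) ?_⟩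
    · have hrI := (hr k).2.2.1
      have h2 : ∫ ω, |r' k ω - x ω| ∂Q ≤ ∫ ω, (|r k ω - r' k ω| + |r k ω - x ω|) ∂Q := by
        refine integral_mono ((hr' k).integrable.sub hxI).abs
          ((hrI.sub (hr' k).integrable).abs.add (hrI.sub hxI).abs) fun ω => ?_
        simp only
        rw [abs_sub_comm (r k ω) (r' k ω)]
        exact abs_sub_le _ _ _
      rw [integral_add (integrable_fun_sub hrI (hr' k).integrable).abs
        (integrable_fun_sub hrI hxI).abs] at h2
      linarith [hd k]
    · simpa using (tendsto_one_div_add_atTop_nhds_zero_nat (𝕜 := ℝ)).add hlim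
  have hx1 : ∫ ω, x ω ∂Q = 1 := by
    obtain ⟨R, r', -, hr', hd⟩ := happ ⟨0, ht⟩
    have h1 : ∀ k, |1 - ∫ ω, x ω ∂Q| ≤ ∫ ω, |r' k ω - x ω| ∂Q := by
      intro k
      rw [← (hr' k).integral_eq_one, ← integral_sub (hr' k).integrable hxI]
      exact abs_integral_le_integral_abs
    have h2 := ge_of_tendsto' hd h1
    have h3 := abs_nonpos_iff.1 h2
    linarith
  obtain ⟨W, hW⟩ := exists_hasDens hxm hx0 hxI hx1
  have hWC : W ∈ ⋂ i, C i := by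
    refine Set.mem_iInter.2 fun i => ?_
    obtain ⟨R, r', hR, hr', hd⟩ := happ i
    refine h.closed i R W hR ?_
    simpa only [tvDist_eq (hr' _) hW] using hd
  refine ⟨W, hWC, x, hW, hxe, le_antisymm hxL ?_⟩
  -- The reverse inequality: `mixDiv` tends to Σ c and never exceeds the entropy of a member of the
  -- intersection.
  exact le_of_tendsto' (tendsto_mixDiv hc ⟨0, ht⟩) fun n => h.mixDiv_le hWC hW hxe n _

end IsRunPair

end IProj

end

noncomputable section

namespace IProj

variable {Ω : Type*} [MeasurableSpace Ω]

variable {Q : Measure Ω} [IsProbabilityMeasure Q]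

/-! ### Optimality from the Csiszár inequality -/

/-- The density `x` of a member of `D` has entropy `L`, is positive and satisfies the Csiszár
inequality `L ≤ ∫ r ln x` for all densities `r` of finite entropy of members of `D`. -/
structure IsCsiszarDens (Q : Measure Ω) (D : Set (ProbabilityMeasure Ω))
    (W : ProbabilityMeasure Ω) (x : Ω → ℝ) (L : ℝ) : Prop where
  mem : W ∈ D
  dens : HasDens Q (W : Measure Ω) x
  pos : ∀ᵐ ω ∂Q, 0 < x ω
  entropy : Integrable (fun ω => x ω * Real.log (x ω)) Q
  integral_eq : ∫ ω, x ω * Real.log (x ω) ∂Q = L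
  int_mul : ∀ R ∈ D, ∀ r, HasDens Q (R : Measure Ω) r →
    Integrable (fun ω => r ω * Real.log (r ω)) Q → Integrable (fun ω => r ω * Real.log (x ω)) Q
  le_integral : ∀ R ∈ D, ∀ r, HasDens Q (R : Measure Ω) r →
    Integrable (fun ω => r ω * Real.log (r ω)) Q → L ≤ ∫ ω, r ω * Real.log (x ω) ∂Q

namespace IsCsiszarDens

variable {D : Set (ProbabilityMeasure Ω)} {W : ProbabilityMeasure Ω} {x : Ω → ℝ} {L : ℝ}
  (h : IsCsiszarDens Q D W x L)
include h

lemma entropy_dens : IProj.entropy Q (IProj.dens Q W) = (L : EReal) := by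
  rw [h.dens.entropy_eq h.entropy, h.integral_eq]

omit [IsProbabilityMeasure Q] in
-- The Csiszár inequality rewritten in Pythagorean form, I(R|W) ≤ I(R|Q) - L. Minimality of W
-- follows from `kl` ≥ 0, uniqueness from its equality case.
lemma integral_kl_le {R : ProbabilityMeasure Ω} (hR : R ∈ D) {r : Ω → ℝ}
    (hr : HasDens Q (R : Measure Ω) r) (hri : Integrable (fun ω => r ω * Real.log (r ω)) Q) :
    Integrable (fun ω => kl (r ω) (x ω)) Q ∧
      ∫ ω, kl (r ω) (x ω) ∂Q ≤ ∫ ω, r ω * Real.log (r ω) ∂Q - L := by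
  have h1 := h.int_mul R hR r hr hri
  have h2 := h.le_integral R hR r hr hri
  have h3 : (fun ω => kl (r ω) (x ω)) =
      fun ω => r ω * Real.log (r ω) - r ω * Real.log (x ω) - r ω + x ω := by
    ext ω
    rw [kl, mul_sub]
  have hxI : Integrable x Q := h.dens.integrable
  have hrI : Integrable r Q := hr.integrable
  rw [h3]
  refine ⟨(((hri.sub h1).sub hrI).add hxI), ?_⟩
  rw [integral_add (integrable_fun_sub (integrable_fun_sub hri h1) hrI) hxI,
    integral_sub (integrable_fun_sub hri h1) hrI, integral_sub hri h1, hr.integral_eq_one,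
    h.dens.integral_eq_one]
  linarith

omit [IsProbabilityMeasure Q] in
lemma le_entropy {R : ProbabilityMeasure Ω} (hR : R ∈ D) {r : Ω → ℝ}
    (hr : HasDens Q (R : Measure Ω) r) (hri : Integrable (fun ω => r ω * Real.log (r ω)) Q) :
    L ≤ ∫ ω, r ω * Real.log (r ω) ∂Q := by
  have h1 := (h.integral_kl_le hR hr hri).2
  have h2 : 0 ≤ ∫ ω, kl (r ω) (x ω) ∂Q := integral_nonneg_of_ae (by
    filter_upwards [h.pos] with ω hω using kl_nonneg (hr.nonneg ω) hω)
  linarith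

omit [IsProbabilityMeasure Q] in
lemma ae_eq_of_entropy_le {R : ProbabilityMeasure Ω} (hR : R ∈ D) {r : Ω → ℝ}
    (hr : HasDens Q (R : Measure Ω) r) (hri : Integrable (fun ω => r ω * Real.log (r ω)) Q)
    (hle : ∫ ω, r ω * Real.log (r ω) ∂Q ≤ L) : r =ᵐ[Q] x := by
  obtain ⟨h1, h2⟩ := h.integral_kl_le hR hr hri
  have h0 : 0 ≤ᵐ[Q] fun ω => kl (r ω) (x ω) := by
    filter_upwards [h.pos] with ω hω using kl_nonneg (hr.nonneg ω) hω
  have h3 := (integral_eq_zero_iff_of_nonneg_ae h0 h1).1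
    (le_antisymm (by linarith) (integral_nonneg_of_ae h0))
  filter_upwards [h3, h.pos] with ω h4 h5
  exact eq_of_kl_nonpos (hr.nonneg ω) h5 h4.le

variable {K : Set (Ω →₁[Q] ℝ)}
  (hK : ∀ x, IProj.entropy Q x < ⊤ → (x ∈ K ↔ ∃ R ∈ D, (R : Measure Ω) ≪ Q ∧ x = IProj.dens Q R))
include hK

lemma isPrimalSolution : IsPrimalSolution Q K (IProj.dens Q W) := by
  refine ⟨(hK _ (h.entropy_dens ▸ EReal.coe_lt_top _)).2 ⟨W, h.mem, h.dens.ac, rfl⟩,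
    fun x' hx' => ?_⟩
  rcases eq_top_or_lt_top (IProj.entropy Q x') with htop | hlt
  · rw [htop]; exact le_top
  · obtain ⟨R, hR, hac, rfl⟩ := (hK x' hlt).1 hx'
    have hr := HasDens.of_ac hac
    have hri := hr.entropy_lt_top_iff.1 hlt
    rw [h.entropy_dens, hr.entropy_eq hri]
    exact EReal.coe_le_coe_iff.2 (h.le_entropy hR hr hri)

lemma primal_unique {x' : Ω →₁[Q] ℝ} (hx' : IsPrimalSolution Q K x') : x' = IProj.dens Q W := by
  have hle := hx'.2 _ (h.isPrimalSolution hK).1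
  have hlt : IProj.entropy Q x' < ⊤ := hle.trans_lt (h.entropy_dens ▸ EReal.coe_lt_top _)
  obtain ⟨R, hR, hac, rfl⟩ := (hK x' hlt).1 hx'.1
  have hr := HasDens.of_ac hac
  have hri := hr.entropy_lt_top_iff.1 hlt
  rw [h.entropy_dens, hr.entropy_eq hri, EReal.coe_le_coe_iff] at hle
  have hrx := h.ae_eq_of_entropy_le hR hr hri hle
  exact Lp.ext (hr.coeFn_dens.trans (hrx.trans h.dens.coeFn_dens.symm))

omit hK in
lemma isIProjection : IsIProjection Q D W := by
  refine ⟨h.mem, ?_, fun R hR => ?_⟩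
  · rw [h.dens.iDiv_self_eq_entropy, h.entropy_dens]
    exact EReal.coe_lt_top _
  · rcases eq_top_or_lt_top (iDiv (R : Measure Ω) Q) with htop | hlt
    · rw [htop]; exact le_top
    · have hr := HasDens.of_ac (ac_of_iDiv_lt_top hlt)
      rw [hr.iDiv_self_eq_entropy] at hlt ⊢
      have hri := hr.entropy_lt_top_iff.1 hlt
      rw [h.dens.iDiv_self_eq_entropy, h.entropy_dens, hr.entropy_eq hri]
      exact EReal.coe_le_coe_iff.2 (h.le_entropy hR hr hri)

omit hK [IsProbabilityMeasure Q] in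
lemma exp_dual : (fun ω => ((Real.log (x ω) - L : ℝ) : EReal).exp) =ᵐ[Q]
    fun ω => ENNReal.ofReal (x ω) * ENNReal.ofReal (Real.exp (-L)) := by
  filter_upwards [h.pos] with ω hω
  rw [EReal.exp_coe, sub_eq_add_neg, Real.exp_add, Real.exp_log hω, ENNReal.ofReal_mul hω.le]

omit hK [IsProbabilityMeasure Q] in
lemma lintegral_exp_dual :
    ∫⁻ ω, ((Real.log (x ω) - L : ℝ) : EReal).exp ∂Q = ENNReal.ofReal (Real.exp (-L)) := by
  rw [lintegral_congr_ae h.exp_dual, lintegral_mul_const' _ _ ENNReal.ofReal_ne_top,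
    h.dens.lintegral_eq, measure_univ, one_mul]

omit hK [IsProbabilityMeasure Q] in
lemma ofReal_eq_exp_dual_div : ∀ᵐ ω ∂Q, ENNReal.ofReal (x ω) =
    ((Real.log (x ω) - L : ℝ) : EReal).exp /
      ∫⁻ ω', ((Real.log (x ω') - L : ℝ) : EReal).exp ∂Q := by
  rw [h.lintegral_exp_dual]
  filter_upwards [h.exp_dual] with ω hω
  rw [hω, ENNReal.mul_div_cancel_right _ ENNReal.ofReal_ne_top]
  simpa using Real.exp_pos (-L)

/-- As r has integral one, the Csiszár inequality is the statement ∫ r (ln x - L) dQ ≥ 0. -/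
lemma dual_mem : (fun ω => ((Real.log (x ω) - L : ℝ) : EReal)) ∈ conjCone Q K := by
  refine (coe_mem_conjCone_iff hK (h.dens.meas.log.sub_const L)).2 ?_
  intro R hR r hr hri
  have h1 := h.int_mul R hR r hr hri
  have h2 := h.le_integral R hR r hr hri
  have hrI : Integrable r Q := hr.integrable
  simp only [mul_sub]
  refine IntegralNonneg.of_integrable (z := fun ω => r ω * Real.log (x ω) - r ω * L)
    (h1.sub (hrI.mul_const L)) ?_
  rw [integral_sub h1 (hrI.mul_const L), integral_mul_const, hr.integral_eq_one]
  linarith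

/-- Since x pairs nonnegatively with w, integrating kl(x, e^(w + L)) ≥ 0 gives 1 ≤ e^L ∫ e^w dQ.
Equality forces x = e^(w + L). -/
lemma dual_le {w : Ω → EReal} (hw : w ∈ conjCone Q K) :
    ENNReal.ofReal (Real.exp (-L)) ≤ ∫⁻ ω, (w ω).exp ∂Q ∧
    (∫⁻ ω, (w ω).exp ∂Q ≤ ENNReal.ofReal (Real.exp (-L)) →
      w =ᵐ[Q] fun ω => ((Real.log (x ω) - L : ℝ) : EReal)) := by
  rcases eq_or_ne (∫⁻ ω, (w ω).exp ∂Q) ⊤ with htop | hfin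
  · rw [htop]
    exact ⟨le_top, fun hle => absurd (hle.trans_lt ENNReal.ofReal_lt_top) (lt_irrefl _)⟩
  obtain ⟨hwm, hwn⟩ := (mem_conjCone_iff hK).1 hw
  have hxw := hwn W h.mem x h.dens h.entropy
  set v : Ω → ℝ := fun ω => (w ω).toReal with hv
  have hvm : Measurable v := hwm.ereal_toReal
  have hxI : Integrable x Q := h.dens.integrable
  have hxm : Measurable x := h.dens.meas
  -- A finite integral of e^w excludes +∞. The value -∞ is excluded by the finite negative part of x
  -- w, and this uses x > 0.
  have hwv : ∀ᵐ ω ∂Q, w ω = (v ω : EReal) := by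
    have h1 : ∀ᵐ ω ∂Q, (w ω).exp < ⊤ := ae_lt_top' (by fun_prop) hfin
    have h2 : ∀ᵐ ω ∂Q, (-(((x ω : ℝ) : EReal) * w ω)).toENNReal < ⊤ :=
      ae_lt_top' (by fun_prop) hxw.1
    filter_upwards [h1, h2, h.pos] with ω h3 h4 h5
    refine (EReal.coe_toReal ?_ ?_).symm
    · exact (EReal.exp_lt_top_iff.1 h3).ne
    · intro hbot
      rw [hbot, EReal.coe_mul_bot_of_pos h5] at h4
      simp at h4
  have hexp : ∫⁻ ω, (w ω).exp ∂Q = ∫⁻ ω, ENNReal.ofReal (Real.exp (v ω)) ∂Q := by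
    refine lintegral_congr_ae ?_
    filter_upwards [hwv] with ω hω
    rw [hω, EReal.exp_coe]
  rw [hexp] at hfin ⊢
  have hei : Integrable (fun ω => Real.exp (v ω)) Q := by
    refine ⟨by fun_prop, ?_⟩
    rw [hasFiniteIntegral_iff_ofReal (ae_of_all _ fun ω => (Real.exp_pos _).le)]
    exact hfin.lt_top
  have hxv : IntegralNonneg Q (fun ω => ((x ω * v ω : ℝ) : EReal)) := by
    refine hxw.congr ?_
    filter_upwards [hwv] with ω hω
    rw [hω, EReal.coe_mul]
  have hxvi : Integrable (fun ω => x ω * v ω) Q :=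
    hxv.integrable_of_le (hxm.mul hvm).aemeasurable ((h.entropy.sub hxI).add hei)
      (ae_of_all _ fun ω => mul_le_mul_log_add_exp _ (h.dens.nonneg ω))
  have hxv0 := hxv.integral_nonneg hxvi
  have hkl : (fun ω => kl (x ω) (Real.exp (v ω + L))) = fun ω =>
      x ω * Real.log (x ω) - x ω * v ω - x ω * (L + 1) + Real.exp (v ω) * Real.exp L := by
    ext ω
    rw [kl, Real.log_exp, Real.exp_add]
    ring
  have hA : Integrable (fun ω => x ω * Real.log (x ω) - x ω * v ω) Q :=
    h.entropy.sub hxvi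
  have hB : Integrable (fun ω => x ω * Real.log (x ω) - x ω * v ω - x ω * (L + 1)) Q :=
    hA.sub (hxI.mul_const _)
  have hklI : Integrable (fun ω => kl (x ω) (Real.exp (v ω + L))) Q := by
    rw [hkl]
    exact hB.add (hei.mul_const _)
  have hint : ∫ ω, kl (x ω) (Real.exp (v ω + L)) ∂Q =
      (∫ ω, Real.exp (v ω) ∂Q) * Real.exp L - 1 - ∫ ω, x ω * v ω ∂Q := by
    rw [hkl, integral_add hB (hei.mul_const _), integral_sub hA (hxI.mul_const _),
      integral_sub h.entropy hxvi, integral_mul_const, integral_mul_const,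
      h.dens.integral_eq_one, h.integral_eq]
    ring
  have hkl0 : 0 ≤ᵐ[Q] fun ω => kl (x ω) (Real.exp (v ω + L)) :=
    ae_of_all _ fun ω => kl_nonneg (h.dens.nonneg ω) (Real.exp_pos _)
  have hkli := integral_nonneg_of_ae hkl0
  have hexpL : Real.exp (-L) * Real.exp L = 1 := by rw [← Real.exp_add]; simp
  have hJ : ∫⁻ ω, ENNReal.ofReal (Real.exp (v ω)) ∂Q =
      ENNReal.ofReal (∫ ω, Real.exp (v ω) ∂Q) :=
    (ofReal_integral_eq_lintegral_ofReal hei (ae_of_all _ fun ω => (Real.exp_pos _).le)).symm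
  rw [hJ]
  refine ⟨ENNReal.ofReal_le_ofReal (le_of_mul_le_mul_right (by linarith) (Real.exp_pos L)),
    fun hle => ?_⟩
  rw [ENNReal.ofReal_le_ofReal_iff (Real.exp_pos _).le] at hle
  have h1 := mul_le_mul_of_nonneg_right hle (Real.exp_pos L).le
  have h2 := (integral_eq_zero_iff_of_nonneg_ae hkl0 hklI).1 (le_antisymm (by linarith) hkli)
  filter_upwards [hwv, h2] with ω h3 h4
  have h5 := eq_of_kl_nonpos (h.dens.nonneg ω) (Real.exp_pos _) h4.le
  rw [h3, h5, Real.log_exp, add_sub_cancel_right]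

lemma isDualSolution : IsDualSolution Q K fun ω => ((Real.log (x ω) - L : ℝ) : EReal) := by
  refine ⟨h.dual_mem hK, fun w hw => ?_⟩
  rw [h.lintegral_exp_dual]
  exact (h.dual_le hK hw).1

lemma dual_unique {w : Ω → EReal} (hw : IsDualSolution Q K w) :
    w =ᵐ[Q] fun ω => ((Real.log (x ω) - L : ℝ) : EReal) := by
  refine (h.dual_le hK hw.1).2 ?_
  rw [← h.lintegral_exp_dual]
  exact hw.2 _ (h.dual_mem hK)

end IsCsiszarDens

end IProj

end

noncomputable section

namespace IProj

variable {Ω : Type*} [MeasurableSpace Ω]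

variable {Q : Measure Ω} [IsProbabilityMeasure Q] {t : ℕ} {C : Fin t → Set (ProbabilityMeasure Ω)}
  {P : ℕ → Fin t → ProbabilityMeasure Ω} {S : ℕ → Fin t → Measure Ω}
  {y : ℕ → Fin t → Ω → EReal}

/-! ### Uniform integrability of the dual iterates -/

lemma EReal_abs_eq_add (a : EReal) : a.abs = a.toENNReal + (-a).toENNReal := by
  induction a with
  | bot => simp
  | top => simp
  | coe a =>
    rw [EReal.abs_def, ← EReal.coe_neg, EReal.toENNReal_of_ne_top (EReal.coe_ne_top a),
      EReal.toENNReal_of_ne_top (EReal.coe_ne_top (-a)), EReal.toReal_coe, EReal.toReal_coe]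
    rcases le_total 0 a with h | h
    · rw [abs_of_nonneg h, ENNReal.ofReal_of_nonpos (neg_nonpos.2 h), add_zero]
    · rw [abs_of_nonpos h, ENNReal.ofReal_of_nonpos h, zero_add]

lemma measurable_EReal_abs : Measurable EReal.abs := by
  rw [funext EReal_abs_eq_add]
  fun_prop

/-- Above the level K the integral is at most 1, below it at most K. Condition (C) acts through this
common L₁ bound and the a.e. finiteness it implies. -/
lemma EUnifIntegrable.exists_lintegral_le {ι : Type*} {z : ι → Ω → EReal}
    (h : EUnifIntegrable Q z) (hm : ∀ k, Measurable (z k)) :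
    ∃ B : ℝ≥0, ∀ k, ∫⁻ ω, (z k ω).abs ∂Q ≤ B := by
  obtain ⟨K, hK⟩ := h 1 one_pos
  refine ⟨1 + K, fun k => ?_⟩
  have hA : MeasurableSet {ω | (K : ℝ≥0∞) ≤ (z k ω).abs} :=
    measurableSet_le measurable_const (measurable_EReal_abs.comp (hm k))
  rw [← lintegral_add_compl _ hA]
  push_cast
  refine add_le_add (hK k) ?_
  have h1 : ∫⁻ ω in {ω | (K : ℝ≥0∞) ≤ (z k ω).abs}ᶜ, (z k ω).abs ∂Q ≤
      ∫⁻ _ in {ω | (K : ℝ≥0∞) ≤ (z k ω).abs}ᶜ, (K : ℝ≥0∞) ∂Q :=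
    setLIntegral_mono measurable_const fun ω hω => le_of_not_ge hω
  refine h1.trans ?_
  rw [setLIntegral_const]
  exact mul_le_of_le_one_right' prob_le_one

lemma EUnifIntegrable.exists_integral_le {ι : Type*} {z : ι → Ω → EReal}
    (h : EUnifIntegrable Q z) (hm : ∀ k, Measurable (z k)) :
    ∃ B : ℝ, 0 ≤ B ∧ ∀ k, (∀ᵐ ω ∂Q, z k ω = (((z k ω).toReal : ℝ) : EReal)) ∧
      Integrable (fun ω => (z k ω).toReal) Q ∧ ∫ ω, |(z k ω).toReal| ∂Q ≤ B := by
  obtain ⟨B, hB⟩ := h.exists_lintegral_le hm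
  refine ⟨B, B.2, fun k => ?_⟩
  have hfin : ∀ᵐ ω ∂Q, z k ω = (((z k ω).toReal : ℝ) : EReal) := by
    filter_upwards [ae_lt_top (measurable_EReal_abs.comp (hm k))
      ((hB k).trans_lt ENNReal.coe_lt_top).ne] with ω hω
    refine (EReal.coe_toReal ?_ ?_).symm
    · intro htop; simp [htop] at hω
    · intro hbot; simp [hbot] at hω
  have habs : ∫⁻ ω, ENNReal.ofReal |(z k ω).toReal| ∂Q ≤ B := by
    refine le_trans (le_of_eq (lintegral_congr_ae ?_)) (hB k)
    filter_upwards [hfin] with ω hω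
    conv_rhs => rw [hω]
    rw [EReal.abs_def]
  have hmeas : Measurable fun ω => (z k ω).toReal := (hm k).ereal_toReal
  have hi : Integrable (fun ω => (z k ω).toReal) Q := by
    refine ⟨hmeas.aestronglyMeasurable, ?_⟩
    rw [hasFiniteIntegral_iff_norm]
    exact habs.trans_lt ENNReal.coe_lt_top
  refine ⟨hfin, hi, ?_⟩
  rw [integral_eq_lintegral_of_nonneg_ae (ae_of_all _ fun ω => abs_nonneg _)
    hmeas.abs.aestronglyMeasurable]
  exact ENNReal.toReal_le_of_le_ofReal B.2 (by simpa using habs)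

lemma exists_measureReal_compl_le {v : ℕ → Fin t → Ω → ℝ} {B : ℝ}
    (hv : ∀ n i, Integrable (v n i) Q) (hB : ∀ n i, ∫ ω, |v n i ω| ∂Q ≤ B) (hB0 : 0 ≤ B)
    {η : ℝ} (hη : 0 < η) :
    ∃ K : ℝ, 0 ≤ K ∧ ∀ n, Q.real {ω | ∀ i, |v n i ω| ≤ K}ᶜ ≤ η := by
  -- Markov's inequality and a union bound over the t indices give t B/K ≤ η; the summand 1 keeps K
  -- positive.
  set K := (t * B + 1) / η with hK
  have hK0 : 0 < K := by positivity
  refine ⟨K, hK0.le, fun n => ?_⟩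
  have h1 : ({ω | ∀ i, |v n i ω| ≤ K}ᶜ : Set Ω) ⊆ ⋃ i, {ω | K ≤ |v n i ω|} := by
    intro ω hω
    simp only [Set.mem_compl_iff, Set.mem_ofPred_eq, not_forall, not_le] at hω
    obtain ⟨i, hi⟩ := hω
    exact Set.mem_iUnion.2 ⟨i, hi.le⟩
  have h2 : ∀ i, Q.real {ω | K ≤ |v n i ω|} ≤ B / K := by
    intro i
    rw [le_div_iff₀ hK0, mul_comm]
    exact (mul_meas_ge_le_integral_of_nonneg (ae_of_all _ fun ω => abs_nonneg _)
      (hv n i).abs K).trans (hB n i)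
  calc Q.real {ω | ∀ i, |v n i ω| ≤ K}ᶜ ≤ Q.real (⋃ i, {ω | K ≤ |v n i ω|}) :=
        measureReal_mono h1
    _ ≤ ∑ i, Q.real {ω | K ≤ |v n i ω|} := measureReal_iUnion_fintype_le _
    _ ≤ ∑ _i : Fin t, B / K := Finset.sum_le_sum fun i _ => h2 i
    _ = t * B / K := by
      rw [Finset.sum_const, Finset.card_univ, Fintype.card_fin, nsmul_eq_mul, mul_div_assoc]
    _ ≤ η := by
      rw [div_le_iff₀ hK0, hK, mul_div_cancel₀ _ hη.ne']
      linarith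

/-! ### Convergence to the limit density and its Csiszár inequality. -/

namespace IsRunPair

variable (h : IsRunPair Q C P S y)
include h

/-- The divergences of the limit from the iterates tend to zero. -/
lemma tendsto_kl {W : ProbabilityMeasure Ω} (hW : W ∈ ⋂ i, C i) {x : Ω → ℝ}
    (hx : HasDens Q (W : Measure Ω) x) (hxe : Integrable (fun ω => x ω * Real.log (x ω)) Q)
    {c : Fin t → ℝ} (hc : ∀ i, Tendsto (fun n => stepDiv P S n i) atTop (𝓝 (c i)))
    (hxL : ∫ ω, x ω * Real.log (x ω) ∂Q = ∑ i, c i) (i : Fin t) :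
    Tendsto (fun n => ∫ ω, kl (x ω) (primalDens Q P (n + 1) i ω) ∂Q) atTop (𝓝 0) := by
  refine squeeze_zero (fun n => integral_nonneg_of_ae ?_)
    (fun n => (h.kl_iterate hW hx hxe n i).2) ?_
  · filter_upwards [h.primalDens_pos (n + 1) i] with ω hω using kl_nonneg (hx.nonneg ω) hω
  · have h1 := (tendsto_mixDiv hc i).const_sub (∑ i, c i)
    rw [sub_self] at h1
    rwa [hxL]

lemma tendsto_abs_sub {W : ProbabilityMeasure Ω} (hW : W ∈ ⋂ i, C i) {x : Ω → ℝ}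
    (hx : HasDens Q (W : Measure Ω) x) (hxe : Integrable (fun ω => x ω * Real.log (x ω)) Q)
    {c : Fin t → ℝ} (hc : ∀ i, Tendsto (fun n => stepDiv P S n i) atTop (𝓝 (c i)))
    (hxL : ∫ ω, x ω * Real.log (x ω) ∂Q = ∑ i, c i) (i : Fin t) :
    Tendsto (fun n => ∫ ω, |primalDens Q P n i ω - x ω| ∂Q) atTop (𝓝 0) := by
  rw [← tendsto_add_atTop_iff_nat 1]
  simp only [abs_sub_comm _ (x _)]
  exact tendsto_integral_abs_sub_of_kl (p := fun _ => x) (fun _ => hx.integrable)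
    (fun n => (h.link (n + 1) i).dens.integrable) (fun _ => hx.nonneg)
    (fun n => h.primalDens_pos (n + 1) i) (fun _ => hx.integral_eq_one)
    (fun n => (h.link (n + 1) i).dens.integral_eq_one)
    (fun n => (h.kl_iterate hW hx hxe n i).1) (h.tendsto_kl hW hx hxe hc hxL i)

/-- The limit density is positive, since the logarithms of the iterates are bounded in `L₁`. -/
lemma limit_pos {x : Ω → ℝ} (hxI : Integrable x Q) (hx0 : ∀ ω, 0 ≤ x ω) (ht : 0 < t)
    (hlim : Tendsto (fun n => ∫ ω, |primalDens Q P n ⟨t - 1, by omega⟩ ω - x ω| ∂Q) atTop (𝓝 0))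
    {B : ℝ} (hv : ∀ n i, Integrable (dualPot y n i) Q)
    (hB : ∀ n i, ∫ ω, |dualPot y n i ω| ∂Q ≤ B) {c : Fin t → ℝ}
    (hcle : ∀ n i, stepDiv P S n i ≤ c i) : ∀ᵐ ω ∂Q, 0 < x ω := by
  set B' : ℝ := ∑ i, (B + c i) with hB'
  have hsI : ∀ n i, Integrable (stepPot P S y n i) Q := fun n i =>
    (hv n i).add (integrable_const _)
  have hsumI : ∀ n, Integrable (fun ω => ∑ i, |stepPot P S y n i ω|) Q := fun n =>
    integrable_finsetSum _ fun i _ => (hsI n i).abs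
  have hsum : ∀ n, ∫ ω, ∑ i, |stepPot P S y n i ω| ∂Q ≤ B' := by
    intro n
    rw [integral_finsetSum _ fun i _ => (hsI n i).abs]
    refine Finset.sum_le_sum fun i _ => ?_
    have h1 : ∫ ω, |stepPot P S y n i ω| ∂Q ≤ ∫ ω, (|dualPot y n i ω| + c i) ∂Q := by
      refine integral_mono (hsI n i).abs ((hv n i).abs.add (integrable_const _)) fun ω => ?_
      refine (abs_add_le _ _).trans ?_
      rw [abs_of_nonneg (h.stepDiv_nonneg n i)]
      exact add_le_add_right (hcle n i) _
    rw [integral_add (hv n i).abs (integrable_const _)] at h1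
    simp only [integral_const, probReal_univ, one_smul] at h1
    linarith [hB n i]
  -- Where x = 0, either the total potential exceeds N in absolute value or the iterate, being at
  -- least e^(-N), stays that far from x. Markov's inequality handles both; n → ∞ removes the
  -- second, and N → ∞ later the first.
  have hbound : ∀ N : ℝ, 0 < N → Q.real {ω | x ω = 0} ≤ B' / N := by
    intro N hN
    have hle : ∀ n, Q.real {ω | x ω = 0} ≤ B' / N +
        Real.exp N * ∫ ω, |primalDens Q P n ⟨t - 1, by omega⟩ ω - x ω| ∂Q := by
      intro n
      have hp := (h.link n ⟨t - 1, by omega⟩).dens.integrable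
      have hpe := h.primalDens_last n ht
      set p := primalDens Q P n ⟨t - 1, by omega⟩
      have h1 : Q.real {ω | x ω = 0} ≤
          Q.real ({ω | N ≤ ∑ i, |stepPot P S y n i ω|} ∪ {ω | Real.exp (-N) ≤ |p ω - x ω|}) := by
        refine ENNReal.toReal_mono (measure_ne_top _ _) (measure_mono_ae ?_)
        filter_upwards [hpe] with ω hω hx
        have hx' : x ω = 0 := hx
        by_cases hN' : N ≤ ∑ i, |stepPot P S y n i ω|
        · exact Or.inl hN'
        · refine Or.inr ?_
          have h2 : -N ≤ ∑ i, stepPot P S y n i ω := by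
            have h3 := Finset.abs_sum_le_sum_abs (fun i => stepPot P S y n i ω) Finset.univ
            have h4 := neg_abs_le (∑ i, stepPot P S y n i ω)
            linarith
          show Real.exp (-N) ≤ |p ω - x ω|
          rw [hx', sub_zero, hω, abs_of_pos (Real.exp_pos _)]
          exact Real.exp_le_exp.2 h2
      refine h1.trans ((measureReal_union_le _ _).trans (add_le_add ?_ ?_))
      · rw [le_div_iff₀ hN, mul_comm]
        exact (mul_meas_ge_le_integral_of_nonneg (ae_of_all _ fun ω =>
          Finset.sum_nonneg fun i _ => abs_nonneg _) (hsumI n) N).trans (hsum n)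
      · have h2 := mul_meas_ge_le_integral_of_nonneg (ae_of_all _ fun ω => abs_nonneg _)
          (integrable_fun_sub hp hxI).abs (Real.exp (-N))
        have h3 := mul_le_mul_of_nonneg_left h2 (Real.exp_pos N).le
        rwa [← mul_assoc, ← Real.exp_add, add_neg_cancel, Real.exp_zero, one_mul] at h3
    have h1 := (hlim.const_mul (Real.exp N)).const_add (B' / N)
    rw [mul_zero, add_zero] at h1
    exact ge_of_tendsto' h1 hle
  have hzero : Q.real {ω | x ω = 0} = 0 := by
    refine le_antisymm ?_ measureReal_nonneg
    have h1 : Tendsto (fun N : ℝ => B' / N) atTop (𝓝 0) :=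
      tendsto_const_nhds.div_atTop tendsto_id
    refine ge_of_tendsto h1 ?_
    filter_upwards [eventually_gt_atTop 0] with N hN using hbound N hN
  have h1 : Q {ω | x ω = 0} = 0 := (measureReal_eq_zero_iff).1 hzero
  filter_upwards [measure_eq_zero_iff_ae_notMem.1 h1] with ω hω
  exact lt_of_le_of_ne (hx0 ω) fun he => hω he.symm

/-- The Csiszár inequality for the limit density. -/
lemma isCsiszarDens {W : ProbabilityMeasure Ω} (hW : W ∈ ⋂ i, C i) {x : Ω → ℝ}
    (hx : HasDens Q (W : Measure Ω) x) (hxe : Integrable (fun ω => x ω * Real.log (x ω)) Q)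
    {c : Fin t → ℝ} (hc : ∀ i, Tendsto (fun n => stepDiv P S n i) atTop (𝓝 (c i)))
    (hcle : ∀ n i, stepDiv P S n i ≤ c i)
    (hxL : ∫ ω, x ω * Real.log (x ω) ∂Q = ∑ i, c i) (ht : 0 < t) {B : ℝ}
    (hv : ∀ n i, Integrable (dualPot y n i) Q) (hB : ∀ n i, ∫ ω, |dualPot y n i ω| ∂Q ≤ B) :
    IsCsiszarDens Q (⋂ i, C i) W x (∑ i, c i) := by
  have hlim := h.tendsto_abs_sub hW hx hxe hc hxL ⟨t - 1, by omega⟩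
  have hpos := h.limit_pos hx.integrable hx.nonneg ht hlim hv hB hcle
  have hxI : Integrable x Q := hx.integrable
  have key : ∀ R ∈ ⋂ i, C i, ∀ r, HasDens Q (R : Measure Ω) r →
      Integrable (fun ω => r ω * Real.log (r ω)) Q →
      Integrable (fun ω => r ω * Real.log (x ω)) Q ∧
        ∑ i, c i ≤ ∫ ω, r ω * Real.log (x ω) ∂Q := by
    intro R hR r hr hri
    have hrI : Integrable r Q := hr.integrable
    -- Fatou's lemma is applied to `kl_iterate` along an a.e. convergent subsequence; positivity of
    -- x makes the logarithm continuous at the limit.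
    obtain ⟨ns, hns, hae⟩ := exists_subseq_tendsto_ae
      (r := fun n => primalDens Q P (n + 1) ⟨t - 1, by omega⟩)
      (fun n => (h.link (n + 1) ⟨t - 1, by omega⟩).dens.integrable) hxI
      ((tendsto_add_atTop_iff_nat 1).2 hlim)
    have hklim : ∀ᵐ ω ∂Q, Tendsto (fun k => kl (r ω)
        (primalDens Q P (ns k + 1) ⟨t - 1, by omega⟩ ω)) atTop (𝓝 (kl (r ω) (x ω))) := by
      filter_upwards [hae, hpos] with ω h1 h2
      have h3 : Tendsto (fun k => Real.log (primalDens Q P (ns k + 1) ⟨t - 1, by omega⟩ ω)) atTop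
          (𝓝 (Real.log (x ω))) := (Real.continuousAt_log h2.ne').tendsto.comp h1
      exact (((h3.const_sub (Real.log (r ω))).const_mul (r ω)).sub_const (r ω)).add h1
    have hmix : Tendsto (fun k => ∫ ω, r ω * Real.log (r ω) ∂Q -
        mixDiv P S (ns k) ⟨t - 1, by omega⟩) atTop
        (𝓝 (∫ ω, r ω * Real.log (r ω) ∂Q - ∑ i, c i)) :=
      ((tendsto_mixDiv hc ⟨t - 1, by omega⟩).comp hns.tendsto_atTop).const_sub _
    obtain ⟨hkI, hkL⟩ := integrable_of_tendsto_of_integral_le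
      (fun k => (h.kl_iterate hR hr hri (ns k) ⟨t - 1, by omega⟩).1)
      (fun k => by
        filter_upwards [h.primalDens_pos (ns k + 1) ⟨t - 1, by omega⟩] with ω hω
        exact kl_nonneg (hr.nonneg ω) hω)
      (fun k => (h.kl_iterate hR hr hri (ns k) ⟨t - 1, by omega⟩).2) hmix hklim
    have he : (fun ω => r ω * Real.log (x ω)) =
        fun ω => r ω * Real.log (r ω) - kl (r ω) (x ω) - r ω + x ω := by
      ext ω
      rw [kl]
      ring
    have hA : Integrable (fun ω => r ω * Real.log (r ω) - kl (r ω) (x ω)) Q := hri.sub hkI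
    have hA' : Integrable (fun ω => r ω * Real.log (r ω) - kl (r ω) (x ω) - r ω) Q := hA.sub hrI
    rw [he]
    refine ⟨hA'.add hxI, ?_⟩
    rw [integral_add hA' hxI, integral_sub hA hrI, integral_sub hri hkI, hr.integral_eq_one,
      hx.integral_eq_one]
    linarith
  exact ⟨hW, hx, hpos, hxe, hxL, fun R hR r hr hri => (key R hR r hr hri).1,
    fun R hR r hr hri => (key R hR r hr hri).2⟩

lemma tendsto_iDiv {W : ProbabilityMeasure Ω} (hW : W ∈ ⋂ i, C i) {x : Ω → ℝ}
    (hx : HasDens Q (W : Measure Ω) x) (hxe : Integrable (fun ω => x ω * Real.log (x ω)) Q)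
    {c : Fin t → ℝ} (hc : ∀ i, Tendsto (fun n => stepDiv P S n i) atTop (𝓝 (c i)))
    (hxL : ∫ ω, x ω * Real.log (x ω) ∂Q = ∑ i, c i) (i : Fin t) :
    Tendsto (fun n => iDiv (W : Measure Ω) (P n i : Measure Ω)) atTop (𝓝 0) := by
  rw [← tendsto_add_atTop_iff_nat 1]
  have hxI : Integrable x Q := hx.integrable
  have h1 : ∀ n, iDiv (W : Measure Ω) (P (n + 1) i : Measure Ω) =
      ((∫ ω, kl (x ω) (primalDens Q P (n + 1) i ω) ∂Q : ℝ) : EReal) := by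
    intro n
    have hp := (h.link (n + 1) i).dens
    have hpI : Integrable (primalDens Q P (n + 1) i) Q := hp.integrable
    have hk := (h.kl_iterate hW hx hxe n i).1
    have he : (fun ω => x ω * (Real.log (x ω) - Real.log (primalDens Q P (n + 1) i ω))) =
        fun ω => kl (x ω) (primalDens Q P (n + 1) i ω) + x ω - primalDens Q P (n + 1) i ω := by
      ext ω
      rw [kl]
      ring
    have hI : Integrable (fun ω => kl (x ω) (primalDens Q P (n + 1) i ω) + x ω) Q := hk.add hxI
    rw [hx.iDiv_eq hp (h.primalDens_pos (n + 1) i) (by rw [he]; exact hI.sub hpI), he,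
      integral_sub hI hpI, integral_add hk hxI, hx.integral_eq_one, hp.integral_eq_one,
      add_sub_cancel_right]
  simp only [h1]
  exact (continuous_coe_real_ereal.tendsto 0).comp (h.tendsto_kl hW hx hxe hc hxL i)

lemma sum_iDiv_eq (n : ℕ) : ∑ i, iDiv (P n i : Measure Ω) (S n i) =
    ((∑ i, stepDiv P S n i : ℝ) : EReal) := by
  rw [← ereal_coe_sum]
  exact Finset.sum_congr rfl fun i _ => (h.link n i).div

lemma tvDist_eq_integral {W : ProbabilityMeasure Ω} {x : Ω → ℝ} (hx : HasDens Q (W : Measure Ω) x)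
    (n : ℕ) (i : Fin t) :
    tvDist (P n i) W = ∫ ω, |primalDens Q P n i ω - x ω| ∂Q ∧
      tvDist (P n i) W = ∫ ω, |dens Q (P n i) ω - dens Q W ω| ∂Q := by
  have h1 := tvDist_eq (h.link n i).dens hx
  refine ⟨h1, h1.trans (integral_congr_ae ?_)⟩
  filter_upwards [(h.link n i).dens.coeFn_dens, hx.coeFn_dens] with ω h2 h3
  rw [h2, h3]

end IsRunPair

end IProj

end

/-! ### The main theorem. -/

theorem theorem3p1 {Ω : Type*} [MeasurableSpace Ω] (Q : Measure Ω) [IsProbabilityMeasure Q]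
    {t : ℕ} (ht : 0 < t) (C : Fin t → Set (ProbabilityMeasure Ω))
    (hclosed : ∀ i, IProj.VariationClosed (C i)) (hconv : ∀ i, IProj.ConvexPM (C i))
    (hV : ∃ V ∈ ⋂ i, C i, IProj.iDiv (V : Measure Ω) Q < ⊤)
    (P : ℕ → Fin t → ProbabilityMeasure Ω) (S : ℕ → Fin t → Measure Ω)
    (hPS : IProj.IsPrimalRun Q C P S)
    (y : ℕ → Fin t → Ω → EReal) (hy : IProj.IsDualRun Q C y)
    (hA : ∃ M₁ : ℝ≥0, ∀ n i, S n i Set.univ ≤ M₁)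
    (hB : ∃ M₂ : ℝ, ∀ n i,
      Integrable (fun ω => Real.log ((S n i).rnDeriv Q ω).toReal) (P n i : Measure Ω) ∧
      ∫ ω, Real.log ((S n i).rnDeriv Q ω).toReal ∂(P n i : Measure Ω) ≤ M₂)
    (hUI : IProj.EUnifIntegrable Q (fun k : ℕ × Fin t => y k.1 k.2)) :
    ∃ (x₀ : Ω →₁[Q] ℝ) (y₀ : Ω → EReal),
      (∀ᵐ ω ∂Q, 0 ≤ x₀ ω) ∧ ∫ ω, x₀ ω ∂Q = 1 ∧
      (∀ i, Tendsto (fun n => toWeakSpace ℝ (Ω →₁[Q] ℝ) (IProj.dens Q (P n i))) atTop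
        (𝓝 (toWeakSpace ℝ (Ω →₁[Q] ℝ) x₀))) ∧
      IProj.IsPrimalSolution Q (⋂ i, IProj.densCone Q (C i)) x₀ ∧
      (∀ x, IProj.IsPrimalSolution Q (⋂ i, IProj.densCone Q (C i)) x → x = x₀) ∧
      IProj.IsDualSolution Q (⋂ i, IProj.densCone Q (C i)) y₀ ∧
      (∀ y', IProj.IsDualSolution Q (⋂ i, IProj.densCone Q (C i)) y' → y' =ᵐ[Q] y₀) ∧
      (∀ᵐ ω ∂Q, ENNReal.ofReal (x₀ ω) = (y₀ ω).exp / ∫⁻ ω', (y₀ ω').exp ∂Q) ∧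
      ∃ Pstar ∈ ⋂ i, C i, (Pstar : Measure Ω) ≪ Q ∧ x₀ = IProj.dens Q Pstar ∧
        IProj.IsIProjection Q (⋂ i, C i) Pstar ∧
        (∀ i, Tendsto (fun n => IProj.iDiv (Pstar : Measure Ω) (P n i : Measure Ω)) atTop
          (𝓝 0)) ∧
        (∀ n i, IProj.tvDist (P n i) Pstar = ∫ ω, |IProj.dens Q (P n i) ω - x₀ ω| ∂Q) ∧
        (∀ i, Tendsto (fun n => IProj.tvDist (P n i) Pstar) atTop (𝓝 0)) ∧
        Tendsto (fun n => ∑ i, IProj.iDiv (P n i : Measure Ω) (S n i)) atTop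
          (𝓝 (IProj.iDiv (Pstar : Measure Ω) Q)) := by 
  have : Nonempty (Fin t) := ⟨⟨0, ht⟩⟩
  obtain ⟨M₁, hM₁⟩ := hA
  obtain ⟨M₂, hM₂⟩ := hB
  have hym : ∀ k : ℕ × Fin t, Measurable (y k.1 k.2) := by
    rintro ⟨n, i⟩
    cases n with
    | zero =>
      rw [show y 0 i = fun _ => 0 from funext (hy.init i)]
      exact measurable_const
    | succ n => exact (hy.mem n i).1
  obtain ⟨B, hB0, hyB⟩ := hUI.exists_integral_le hym
  have h : IProj.IsRunPair Q C P S y :=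
    { closed := hclosed
      convex := hconv
      primal := hPS
      dual := hy
      finite := fun n i => (hM₁ n i).trans_lt ENNReal.coe_lt_top
      logInt := fun n i => (hM₂ n i).1
      potFinite := fun n i => (hyB (n, i)).1 }
  have hvI : ∀ n i, Integrable (IProj.dualPot y n i) Q := fun n i => (hyB (n, i)).2.1
  have hvB : ∀ n i, ∫ ω, |IProj.dualPot y n i ω| ∂Q ≤ B := fun n i => (hyB (n, i)).2.2
  obtain ⟨V, hVC, hVQ⟩ := hV
  have hVd := IProj.HasDens.of_ac (IProj.ac_of_iDiv_lt_top hVQ)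
  have hVe := hVd.entropy_lt_top_iff.1 (hVd.iDiv_self_eq_entropy ▸ hVQ)
  obtain ⟨c, hc, hcle⟩ := h.exists_limit hVC hVd hVe
  obtain ⟨W, hW, x, hx, hxe, hxL⟩ := h.exists_limit_density
    (fun n i => ENNReal.toReal_le_coe_of_le_coe (hM₁ n i)) (fun n i => (hM₂ n i).2)
    (fun η hη => IProj.exists_measureReal_compl_le hvI hvB hB0 hη) hc hcle ht
  have hcs := h.isCsiszarDens hW hx hxe hc hcle hxL ht hvI hvB
  have hK := fun z : Ω →₁[Q] ℝ => IProj.mem_iInter_densCone_iff (C := C) (x := z)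
  have htv : ∀ i, Tendsto (fun n => IProj.tvDist (P n i) W) atTop (𝓝 0) := fun i => by
    simpa only [(h.tvDist_eq_integral hx _ i).1] using h.tendsto_abs_sub hW hx hxe hc hxL i
  refine ⟨IProj.dens Q W, fun ω => ((Real.log (x ω) - ∑ i, c i : ℝ) : EReal), ?_, ?_, fun i => ?_,
    hcs.isPrimalSolution hK, fun x' hx' => hcs.primal_unique hK hx', hcs.isDualSolution hK,
    fun w hw => hcs.dual_unique hK hw, ?_, W, hW, hx.ac, rfl, hcs.isIProjection,
    h.tendsto_iDiv hW hx hxe hc hxL, fun n i => (h.tvDist_eq_integral hx n i).2, htv, ?_⟩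
  · filter_upwards [hx.coeFn_dens] with ω hω
    rw [hω]
    exact hx.nonneg ω
  · rw [integral_congr_ae hx.coeFn_dens, hx.integral_eq_one]
  · refine ((toWeakSpaceCLM ℝ (Ω →₁[Q] ℝ)).continuous.tendsto (IProj.dens Q W)).comp ?_
    rw [tendsto_iff_dist_tendsto_zero]
    refine (htv i).congr fun n => ?_
    rw [(h.tvDist_eq_integral hx n i).2, dist_eq_norm, L1.norm_eq_integral_norm]
    refine integral_congr_ae ?_
    filter_upwards [Lp.coeFn_sub (IProj.dens Q (P n i)) (IProj.dens Q W)] with ω hω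
    rw [hω]
    rfl
  · filter_upwards [hx.coeFn_dens, hcs.ofReal_eq_exp_dual_div] with ω h1 h2
    rw [h1, h2]
  · rw [hx.iDiv_self_eq_entropy, hcs.entropy_dens]
    simp only [h.sum_iDiv_eq]
    exact (continuous_coe_real_ereal.tendsto _).comp (tendsto_finsetSum _ fun i _ => hc i)
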